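/- Let $k$ be an algebraically closed field of characteristic $0$, let $\ell$ be a positive integer and let $q=\varepsilon^{1/2}\in k$ be a primitive $\ell$-th root of unity. Let $\mathrm{ex},\mathrm{inv}\subseteq[1,N]$ be disjoint (exchangeable indices, and frozen indices whose variables are inverted). Let $\mathcal F_\varepsilon$ be a division $k$-algebra and let $(M_\varepsilon,\widetilde B)$ be a root of unity quantum seed in it: $M_\varepsilon:\mathbb Z^N\to\mathcal F_\varepsilon$ is a toric frame, i.e. the elements $M_\varepsilon(f)$ are linearly independent over $k$, $M_\varepsilon(f)M_\varepsilon(g)=q^{\Lambda(f,g)}M_\varepsilon(f+g)$ for a skew-symmetric bicharacter $\Lambda:\mathbb Z^N\times\mathbb Z^N\to\mathbb Z/\ell$, and $\mathcal F_\varepsilon$ is the division algebra of fractions of their span; $\widetilde B=(b_{ij})\in M_{N\times \mathrm{ex}}(\mathbb Z)$; and $\Lambda^{\top}\widetilde B\equiv\begin{bmatrix}D\\0\end{bmatrix}\pmod \ell$, where $D$ is a diagonal matrix with positive integer diagonal entries which skew-symmetrizes the principal part of $\widetilde B$. The mutation in direction $r\in\mathrm{ex}$ is matrix mutation on $\widetilde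 B$; it leaves $M_\varepsilon(e_i)$, $i\ne r$, unchanged and replaces $M_\varepsilon(e_r)$ by $M_\varepsilon(-e_r+[b^r]_+)+M_\varepsilon(-e_r-[b^r]_-)$, where $b^r$ is the $r$-th column of $\widetilde B$, $[b^r]_+=\sum_{b_{ir}>0}b_{ir}e_i$ and $[b^r]_-=\sum_{b_{ir}<0}b_{ir}e_i$. The exchange graph has as vertices the seeds obtained from $(M_\varepsilon,\widetilde B)$ by sequences of mutations, and as edges the mutations. For a seed $(M',\widetilde B')$ let $\mathcal T(M')_{\ge}$ be the span of the $M'(f)$ with $f_j\ge0$ for $j\notin \mathrm{ex}\sqcup \mathrm{inv}$, and let $\mathcal T(M')^{\ell}_{\ge}=k[M'(e_i)^{\pm\ell},M'(e_j)^{\ell};\, i\in \mathrm{ex}\sqcup \mathrm{inv},\, j\notin \mathrm{ex}\sqcup \mathrm{inv}]$, which is a subalgebra of the center of $\mathcal F_\varepsilon$. For a set $\Theta$ of seeds put $\mathsf U(\Theta)=\bigcap_{\Theta}\mathcal T(M')_{\ge}$ and $\mathsf{CU}(\Theta)=\bigcap_{\Theta}\mathcal T(M')^{\ell}_{\ge}$.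 Let $d=\sqrt{[\mathbb Z^N:\operatorname{Ker}\Lambda]}$ with $\operatorname{Ker}\Lambda=\{f\mid\Lambda(f,g)=0\ \forall g\in\mathbb Z^N\}$. Assume (Coprime): $\ell$ is odd and coprime to the diagonal entries of $D$. Then $d$ is an integer, it is the same for all seeds mutation-equivalent to $(M_\varepsilon,\widetilde B)$, and the following hold. (a) Let $\Theta$ be a connected set of vertices of the exchange graph. For each seed in $\Theta$, contraction of ideals is an injective map from $\operatorname{MaxSpec}\mathsf{CU}(\Theta)[M'(e_i)^{-\ell},1\le i\le N]$ to $\operatorname{MaxSpec}\mathsf{CU}(\Theta)$, and the union $$\bigcup_{(M',\widetilde B')\in\Theta}\operatorname{MaxSpec}\big(\mathsf{CU}(\Theta)[M'(e_i)^{-\ell},1\le i\le N]\big)\subseteq\operatorname{MaxSpec}\mathsf{CU}(\Theta)$$ lies in the fully Azumaya locus of $\mathsf U(\Theta)$ with respect to $\mathsf{CU}(\Theta)$: for every $\mathfrak m$ in the union, all irreducible representations of $\mathsf U(\Theta)$ annihilated by $\mathfrak m\,\mathsf U(\Theta)$ are finite dimensional and have the maximal dimension among the finite dimensional irreducible representations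 of $\mathsf U(\Theta)$. (b) Over each such point $\mathfrak m$ every irreducible representation of $\mathsf U(\Theta)$ has dimension $d$, there are exactly $\ell^N/d^2$ of them up to isomorphism, and $\mathsf U(\Theta)/\mathfrak m\,\mathsf U(\Theta)$, as a left module over $\mathsf U(\Theta)$, is a direct sum of exactly $\ell^N/d$ irreducible representations (so there are $\ell^N/d$ of them when each is counted with its multiplicity $d$). (c) Let $\Theta$ be the set of all seeds. Let $\mathsf U(\widetilde B,\mathrm{inv})_k\subseteq k(x_1,\dots,x_N)$ be the classical upper cluster algebra, i.e. the intersection over all seeds $(\widetilde{\mathbf x}',\widetilde B')\sim(\widetilde{\mathbf x},\widetilde B)$ of the rings $k[(x_i')^{\pm1},x_j';\, i\in \mathrm{ex}\sqcup \mathrm{inv},\, j\notin \mathrm{ex}\sqcup \mathrm{inv}]$. There is an isomorphism of $k$-algebras $\mathsf{CU}(\Theta)\cong\mathsf U(\widetilde B,\mathrm{inv})_k$ which, for each sequence of mutations, sends the elements $M'(e_i)^\ell$ of the quantum seed it leads to to the variables $x'_i$ of the classical seed it leads to. The union in (a) is the set of points of an open subscheme $X$ of $\operatorname{Spec}\mathsf{CU}(\Theta)$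 which are maximal ideals of $\mathsf{CU}(\Theta)$; $X$ is the union of the images of the $\operatorname{Spec}\mathsf{CU}(\Theta)[M'(e_i)^{-\ell},1\le i\le N]$. Via this isomorphism $X$ is the cluster $\mathcal A$-variety $\bigcup_{(\widetilde{\mathbf x}',\widetilde B')\sim(\widetilde{\mathbf x},\widetilde B)}\operatorname{Spec}k[(x_i')^{\pm1},1\le i\le N]$, the separated scheme over $k$ which is glued from the tori of all classical seeds along the birational maps given by mutation. -/

import Mathlib

open AlgebraicGeometry CategoryTheory

universe u

/-! ### Matrix mutation -/

/-- Mutation of an exchange matrix in the direction `k`.  The rows are indexed by `Fin N` and the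
columns by the exchangeable indices `ex`; the division by `2` is exact. -/
def mutateMatrix {N : ℕ} {ex : Finset (Fin N)} (k : ex) (B : Matrix (Fin N) ex ℤ) :
    Matrix (Fin N) ex ℤ :=
  fun i j =>
    if i = k.1 ∨ j = k then -B i j
    else B i j + (|B i k| * B k.1 j + B i k * |B k.1 j|) / 2

/-! ### Classical seeds, the upper cluster algebra, the cluster `𝒜`-variety -/

/-- A seed `(x, B)` in a field `K`. -/
structure ClusterSeed (N : ℕ) (ex : Finset (Fin N)) (K : Type u) where
  x : Fin N → K
  B : Matrix (Fin N) ex ℤ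

namespace ClusterSeed

variable {N : ℕ} {ex : Finset (Fin N)} {K : Type u} [Field K]

/-- Classical seed mutation in the direction `k`. -/
def mutate (k : ex) (s : ClusterSeed N ex K) : ClusterSeed N ex K where
  x := Function.update s.x k.1
    ((∏ i, s.x i ^ (s.B i k).toNat + ∏ i, s.x i ^ (-(s.B i k)).toNat) / s.x k.1)
  B := mutateMatrix k s.B

/-- The seed reached from `s` by performing successively the mutations in the list `w`. -/
def mutateList (s : ClusterSeed N ex K) (w : List ex) : ClusterSeed N ex K :=
  w.foldl (fun t k => t.mutate k) s

/-- The seeds which are mutation-equivalent to `s`. -/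
def mutationClass (s : ClusterSeed N ex K) : Set (ClusterSeed N ex K) :=
  Set.range s.mutateList

variable (k : Type u) [Field k] [Algebra k K]

/-- The Laurent polynomial ring `k[x₁^{±1}, …, x_N^{±1}]` of a seed. -/
def torus (s : ClusterSeed N ex K) : Subalgebra k K :=
  Algebra.adjoin k (Set.range s.x ∪ Set.range fun i => (s.x i)⁻¹)

/-- The mixed polynomial / Laurent polynomial ring of a seed: the exchangeable variables and the
frozen variables in `inv` are inverted, the other frozen variables are not. -/
def mixedTorus (inv : Finset (Fin N)) (s : ClusterSeed N ex K) : Subalgebra k K :=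
  Algebra.adjoin k (Set.range s.x ∪ {z | ∃ i ∈ ex ∪ inv, z = (s.x i)⁻¹})

/-- The torus of a seed: the spectrum of its Laurent polynomial ring. -/
noncomputable def torusSpec (s : ClusterSeed N ex K) : Scheme.{u} :=
  Spec (.of (s.torus k))

/-- The structure morphism of the torus of a seed. -/
noncomputable def torusStructure (s : ClusterSeed N ex K) : s.torusSpec k ⟶ Spec (.of k) :=
  Spec.map (CommRingCat.ofHom (algebraMap k (s.torus k)))

/-- The morphism on spectra induced by the inclusion of the Laurent polynomial ring of a seed
into the ambient field. -/
noncomputable def torusGeneric (s : ClusterSeed N ex K) : Spec (.of K) ⟶ s.torusSpec k :=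
  Spec.map (CommRingCat.ofHom (s.torus k).val.toRingHom)

end ClusterSeed

/-- The ambient field of rational functions in `N` variables. -/
abbrev ClusterField (k : Type u) [Field k] (N : ℕ) : Type u :=
  FractionRing (MvPolynomial (Fin N) k)

/-- The initial seed, whose cluster consists of the `N` independent variables. -/
noncomputable def initialSeed (k : Type u) [Field k] {N : ℕ} {ex : Finset (Fin N)}
    (B : Matrix (Fin N) ex ℤ) : ClusterSeed N ex (ClusterField k N) where
  x := fun i => algebraMap (MvPolynomial (Fin N) k) (ClusterField k N) (MvPolynomial.X i)
  B := B

/-- The upper cluster algebra of `B` over `k`, with the frozen variables in `inv` inverted. -/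
noncomputable def upperClusterAlgebra (k : Type u) [Field k] {N : ℕ} {ex : Finset (Fin N)}
    (inv : Finset (Fin N)) (B : Matrix (Fin N) ex ℤ) : Subalgebra k (ClusterField k N) :=
  ⨅ s ∈ (initialSeed k B).mutationClass, ClusterSeed.mixedTorus k inv s

/-- The structure of a cluster `𝒜`-variety of the exchange matrix `B` on a `k`-scheme `X`:
`X` is obtained by gluing the tori `Spec k[x₁'^{±1}, …, x_N'^{±1}]`, one for each seed, along the
birational maps given by mutation, i.e. by the identification of their function fields with the
ambient field.  Separatedness says that the gluing is along the largest open subsets on which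
these birational maps are isomorphisms, so `X` is unique up to a unique isomorphism. -/
structure ClusterAVariety (k : Type u) [Field k] {N : ℕ} {ex : Finset (Fin N)}
    (B : Matrix (Fin N) ex ℤ) (X : Scheme.{u}) (π : X ⟶ Spec (.of k)) where
  /-- the toric charts -/
  chart : ∀ s : (initialSeed k B).mutationClass, s.1.torusSpec k ⟶ X
  isOpenImmersion : ∀ s, IsOpenImmersion (chart s)
  chart_comp : ∀ s, chart s ≫ π = s.1.torusStructure k
  cover : ∀ p : X, ∃ s, p ∈ Set.range (chart s)
  glue : ∀ s t, s.1.torusGeneric k ≫ chart s = t.1.torusGeneric k ≫ chart t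
  separated : IsSeparated π

/-! ### Root of unity quantum seeds -/

/-- The data of a root of unity quantum seed: a based frame `M : ℤ^N → F`, its bicharacter `Λ`
with values in `ℤ/ℓ`, and an exchange matrix `B`.  The other laws of a toric frame and the
compatibility condition are in `QuantumSeed.IsRootOfUnityQuantumSeed`. -/
structure QuantumSeed (ℓ N : ℕ) (ex : Finset (Fin N)) (F : Type u) [DivisionRing F] where
  M : (Fin N → ℤ) → F
  Λ : LinearMap.BilinMap ℤ (Fin N → ℤ) (ZMod ℓ)
  B : Matrix (Fin N) ex ℤ
  M_zero : M 0 = 1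
  M_single : ∀ (i : Fin N) (n : ℤ), M (Pi.single i n) = M (Pi.single i 1) ^ n

/-- `q ^ z` for an exponent `z` in `ℤ/ℓ`, where `q ^ ℓ = 1`.  With `q = ε^{1/2}` this is
`ε^{z/2}`. -/
def zmodPow {k : Type u} [Monoid k] {ℓ : ℕ} (q : k) (z : ZMod ℓ) : k := q ^ z.val

namespace QuantumSeed

variable {ℓ N : ℕ} {ex : Finset (Fin N)} {F : Type u} [DivisionRing F]

/-- The vector `-e_k + [b^k]_+`. -/
def vPos (S : QuantumSeed ℓ N ex F) (k : ex) : Fin N → ℤ :=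
  -Pi.single k.1 1 + fun i => max (S.B i k) 0

/-- The vector `-e_k - [b^k]_-`. -/
def vNeg (S : QuantumSeed ℓ N ex F) (k : ex) : Fin N → ℤ :=
  -Pi.single k.1 1 + fun i => max (-S.B i k) 0

/-- The endomorphism of `ℤ^N` with `e_i ↦ e_i` for `i ≠ k` and `e_k ↦ -e_k + [b^k]_+`. -/
def mutationMap (S : QuantumSeed ℓ N ex F) (k : ex) : (Fin N → ℤ) →ₗ[ℤ] (Fin N → ℤ) :=
  LinearMap.id + (LinearMap.proj k.1 : (Fin N → ℤ) →ₗ[ℤ] ℤ).smulRight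
    (S.vPos k - Pi.single k.1 1)

variable {k : Type u} [Field k] [Algebra k F]

/-- Mutation in the direction `j`.  The new frame agrees with the old one on the `e_i`, `i ≠ j`,
it maps `e_j` to `M(-e_j + [b^j]_+) + M(-e_j - [b^j]_-)`, and the other values are determined by
these by the product law `M'(f) M'(g) = q ^ Λ'(f,g) M'(f + g)` for the mutated bicharacter `Λ'`,
applied to the decomposition of a vector into its part away from `j` and its `j`-th part. -/
noncomputable def mutate (q : k) (j : ex) (S : QuantumSeed ℓ N ex F) : QuantumSeed ℓ N ex F where
  M := fun f =>
    zmodPow q (-S.Λ (Function.update f j.1 0) (f j.1 • S.vPos j)) •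
      (S.M (Function.update f j.1 0) * (S.M (S.vPos j) + S.M (S.vNeg j)) ^ f j.1)
  Λ := S.Λ.compl₁₂ (S.mutationMap j) (S.mutationMap j)
  B := mutateMatrix j S.B
  M_zero := by
    have h : Function.update (0 : Fin N → ℤ) j.1 0 = 0 := by
      rw [Function.update_eq_self_iff]; rfl
    simp [h, S.M_zero, zmodPow]
  M_single := by
    intro i n
    by_cases hi : i = j.1
    · subst hi
      have h : ∀ m : ℤ, Function.update (Pi.single j.1 m : Fin N → ℤ) j.1 0 = 0 := by
        intro m
        funext a
        by_cases ha : a = j.1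
        · subst ha; simp
        · simp [ha]
      simp [h, S.M_zero, zmodPow]
    · have h : ∀ m : ℤ, Function.update (Pi.single i m : Fin N → ℤ) j.1 0 = Pi.single i m := by
        intro m
        rw [Function.update_eq_self_iff]
        simp [Ne.symm hi]
      have h' : ∀ m : ℤ, (Pi.single i m : Fin N → ℤ) j.1 = 0 := by
        intro m
        simp [Ne.symm hi]
      simp [h, h', zmodPow, ← S.M_single]

/-- The seed reached from `S` by performing successively the mutations in the list `w`. -/
noncomputable def mutateList (q : k) (S : QuantumSeed ℓ N ex F) (w : List ex) :
    QuantumSeed ℓ N ex F :=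
  w.foldl (fun T j => T.mutate q j) S

/-- The seeds which are mutation-equivalent to `S`: the vertices of its exchange graph. -/
def mutationClass (q : k) (S : QuantumSeed ℓ N ex F) : Set (QuantumSeed ℓ N ex F) :=
  Set.range (S.mutateList q)

/-- The graph whose edges are the seed mutations. -/
def exchangeGraph (ℓ : ℕ) (ex : Finset (Fin N)) (F : Type u) [DivisionRing F] [Algebra k F]
    (q : k) : SimpleGraph (QuantumSeed ℓ N ex F) :=
  SimpleGraph.fromRel fun S T => ∃ j : ex, T = S.mutate q j

/-- `M` is a root of unity toric frame of the division algebra `F` with bicharacter `Λ`. -/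
structure IsToricFrame (q : k) (S : QuantumSeed ℓ N ex F) : Prop where
  skew : ∀ f g, S.Λ f g = -S.Λ g f
  mul : ∀ f g, S.M f * S.M g = zmodPow q (S.Λ f g) • S.M (f + g)
  linearIndependent : LinearIndependent k S.M
  fractions : ∀ z : F, ∃ a ∈ Submodule.span k (Set.range S.M),
    ∃ b ∈ Submodule.span k (Set.range S.M), b ≠ 0 ∧ z = a * b⁻¹

/-- `S` is a root of unity quantum seed, with skew-symmetrizing matrix `D`: `M` is a toric frame,
`D` is a diagonal matrix with positive integral entries which skew-symmetrizes the principal part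
of `B`, and `(Λ, B)` is `ℓ`-compatible, i.e. `Λᵀ B` is congruent modulo `ℓ` to `D` on top of
`0`. -/
structure IsRootOfUnityQuantumSeed (q : k) (D : ex → ℕ) (S : QuantumSeed ℓ N ex F) : Prop where
  frame : S.IsToricFrame q
  pos : ∀ i, 0 < D i
  skewSymmetrizable : ∀ i j : ex, (D i : ℤ) * S.B i.1 j = -((D j : ℤ) * S.B j.1 i)
  compatible : ∀ (i : Fin N) (j : ex),
    S.Λ (fun a => S.B a j) (Pi.single i 1) = if i = j.1 then (D j : ZMod ℓ) else 0

/-- The radical of the bicharacter of a seed. -/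
def ker (S : QuantumSeed ℓ N ex F) : AddSubgroup (Fin N → ℤ) :=
  (LinearMap.ker S.Λ).toAddSubgroup

/-- The number `d(Λ) = √[ℤ^N : Ker Λ]` (the index is a perfect square for a quantum seed). -/
noncomputable def d (S : QuantumSeed ℓ N ex F) : ℕ := S.ker.index.sqrt

variable (k)

/-- The mixed quantum torus of a seed, generated by the `M(f)` for those `f` whose entries are
nonnegative at the frozen indices which are not inverted. -/
def mixedTorus (inv : Finset (Fin N)) (S : QuantumSeed ℓ N ex F) : Subalgebra k F :=
  Algebra.adjoin k {z | ∃ f : Fin N → ℤ, (∀ j, j ∉ ex ∪ inv → 0 ≤ f j) ∧ z = S.M f}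

/-- The subalgebra of the mixed quantum torus generated by the `ℓ`-th powers `M(e_i)^ℓ` for all
`i`, and by `M(e_i)^{-ℓ}` for `i ∈ ex ∪ inv`.  For quantum seeds these elements are central in
`F`; we regard this algebra as a subalgebra of the center of `F`. -/
def centralMixedTorus (inv : Finset (Fin N)) (S : QuantumSeed ℓ N ex F) :
    Subalgebra k (Subalgebra.center k F) :=
  Algebra.adjoin k
    ({z | ∃ i, (z : F) = S.M (Pi.single i 1) ^ ℓ} ∪
      {z | ∃ i ∈ ex ∪ inv, (z : F) = (S.M (Pi.single i 1) ^ ℓ)⁻¹})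

end QuantumSeed

section Algebras

open QuantumSeed

variable {ℓ N : ℕ} {ex : Finset (Fin N)} {F : Type u} [DivisionRing F]
variable (k : Type u) [Field k] [Algebra k F]

/-- The intersection `U(Θ)` of the mixed quantum tori of the seeds in `Θ`. -/
def interU (inv : Finset (Fin N)) (Θ : Set (QuantumSeed ℓ N ex F)) : Subalgebra k F :=
  ⨅ S ∈ Θ, S.mixedTorus k inv

/-- The intersection `CU(Θ)` of the central mixed tori of the seeds in `Θ`. -/
def interCU (inv : Finset (Fin N)) (Θ : Set (QuantumSeed ℓ N ex F)) :
    Subalgebra k (Subalgebra.center k F) :=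
  ⨅ S ∈ Θ, S.centralMixedTorus k inv

/-- The localization `CU(Θ)[M(e_i)^{-ℓ}, 1 ≤ i ≤ N]` at a seed. -/
def locCU (inv : Finset (Fin N)) (Θ : Set (QuantumSeed ℓ N ex F)) (S : QuantumSeed ℓ N ex F) :
    Subalgebra k (Subalgebra.center k F) :=
  interCU k inv Θ ⊔ Algebra.adjoin k {z | ∃ i, (z : F) = (S.M (Pi.single i 1) ^ ℓ)⁻¹}

/-- The inclusion of `CU(Θ)` into its localization at a seed. -/
def toLocCU (inv : Finset (Fin N)) (Θ : Set (QuantumSeed ℓ N ex F)) (S : QuantumSeed ℓ N ex F) :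
    interCU k inv Θ →ₐ[k] locCU k inv Θ S :=
  Subalgebra.inclusion le_sup_left

theorem centralMixedTorus_le (inv : Finset (Fin N)) (S : QuantumSeed ℓ N ex F) :
    S.centralMixedTorus k inv ≤ (S.mixedTorus k inv).comap (Subalgebra.center k F).val := by
  refine Algebra.adjoin_le ?_
  rintro z (⟨i, hz⟩ | ⟨i, hi, hz⟩)
  · refine Algebra.subset_adjoin ⟨Pi.single i (ℓ : ℤ), ?_, ?_⟩
    · intro j _
      by_cases h : j = i
      · subst h; simp
      · simp [h]
    · rw [S.M_single, zpow_natCast]; exact hz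
  · refine Algebra.subset_adjoin ⟨Pi.single i (-(ℓ : ℤ)), ?_, ?_⟩
    · intro j hj
      have h : j ≠ i := fun h => hj (h ▸ hi)
      simp [h]
    · rw [S.M_single, zpow_neg, zpow_natCast]; exact hz

theorem interCU_le (inv : Finset (Fin N)) (Θ : Set (QuantumSeed ℓ N ex F))
    (c : interCU k inv Θ) : ((c : Subalgebra.center k F) : F) ∈ interU k inv Θ := by
  have hc : (c : Subalgebra.center k F) ∈ interCU k inv Θ := c.2
  simp only [interCU, interU, Algebra.mem_iInf] at hc ⊢
  intro S hS
  exact centralMixedTorus_le k inv S (hc S hS)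

/-- The inclusion of `CU(Θ)` into `U(Θ)`. -/
def cuToU (inv : Finset (Fin N)) (Θ : Set (QuantumSeed ℓ N ex F)) :
    interCU k inv Θ →ₐ[k] interU k inv Θ :=
  ((Subalgebra.center k F).val.comp (interCU k inv Θ).val).codRestrict _ (interCU_le k inv Θ)

/-- The union over the seeds `S` in `Θ` of the maximal spectra of `CU(Θ)[M_S(e_i)^{-ℓ}]`,
as a set of ideals of `CU(Θ)`. -/
def maxSpecUnion (inv : Finset (Fin N)) (Θ : Set (QuantumSeed ℓ N ex F)) :
    Set (Ideal (interCU k inv Θ)) :=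
  {m | ∃ S ∈ Θ, ∃ n : MaximalSpectrum (locCU k inv Θ S),
    m = n.asIdeal.comap (toLocCU k inv Θ S)}

/-- The spectrum of `CU(Θ)`. -/
noncomputable def specCU (inv : Finset (Fin N)) (Θ : Set (QuantumSeed ℓ N ex F)) : Scheme.{u} :=
  Spec (.of (interCU k inv Θ))

/-- The structure morphism of the spectrum of `CU(Θ)`. -/
noncomputable def specCUStructure (inv : Finset (Fin N)) (Θ : Set (QuantumSeed ℓ N ex F)) :
    specCU k inv Θ ⟶ Spec (.of k) :=
  Spec.map (CommRingCat.ofHom (algebraMap k (interCU k inv Θ)))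

/-- The morphism to the spectrum of `CU(Θ)` from the spectrum of its localization at a seed. -/
noncomputable def specLocCU (inv : Finset (Fin N)) (Θ : Set (QuantumSeed ℓ N ex F))
    (S : QuantumSeed ℓ N ex F) : Spec (.of (locCU k inv Θ S)) ⟶ specCU k inv Θ :=
  Spec.map (CommRingCat.ofHom (toLocCU k inv Θ S).toRingHom)

/-- The morphism on spectra induced by a homomorphism from `CU(Θ)` to a field. -/
noncomputable def specCUGeneric (inv : Finset (Fin N)) (Θ : Set (QuantumSeed ℓ N ex F))
    {K : Type u} [Field K] [Algebra k K] (φ : interCU k inv Θ →ₐ[k] K) :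
    Spec (.of K) ⟶ specCU k inv Θ :=
  Spec.map (CommRingCat.ofHom φ.toRingHom)

/-- A prime ideal of `CU(Θ)` as a point of its spectrum. -/
def specCUPoint (inv : Finset (Fin N)) (Θ : Set (QuantumSeed ℓ N ex F))
    (p : PrimeSpectrum (interCU k inv Θ)) : specCU k inv Θ := p

end Algebras

/-! ### The fully Azumaya locus -/

section Azumaya

variable (k : Type u) [Field k] {C R : Type u} [CommRing C] [Ring R] [Algebra k R]

/-- The left ideal `mR` of `R` generated by an ideal `m` of the central subring `C`
(embedded by `ι`). -/
def extendedIdeal (ι : C →+* R) (m : Ideal C) : Ideal R := Ideal.span (ι '' m)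

/-- The `R`-module `V` is annihilated by `mR`. -/
def AnnihilatedBy (ι : C →+* R) (m : Ideal C) (V : Type u) [AddCommGroup V] [Module R V] : Prop :=
  ∀ a ∈ extendedIdeal ι m, ∀ v : V, a • v = 0

/-- The ideal `m` is in the fully Azumaya locus of the `k`-algebra `R` with respect to its central
subalgebra `C`: all irreducible representations of `R` which are annihilated by `mR` have maximal
dimension (among the finite dimensional irreducible representations of `R`; if `R` is an affine
`k`-algebra which is a finite `C`-module and `k` is algebraically closed then all irreducible
representations of `R` are finite dimensional). -/
def IsFullyAzumayaAt (ι : C →+* R) (m : Ideal C) : Prop :=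
  ∀ (V : Type u) [AddCommGroup V] [Module k V] [Module R V] [IsScalarTower k R V],
    IsSimpleModule R V → AnnihilatedBy ι m V →
    FiniteDimensional k V ∧
    ∀ (W : Type u) [AddCommGroup W] [Module k W] [Module R W] [IsScalarTower k R W],
      IsSimpleModule R W → FiniteDimensional k W → Module.finrank k W ≤ Module.finrank k V

/-- There are exactly `n` isomorphism classes of irreducible representations of `R` which are
annihilated by `mR`. -/
def HasExactlyIrreps (ι : C →+* R) (m : Ideal C) (n : ℕ) : Prop :=
  ∃ V : Fin n → ModuleCat.{u} R,
    (∀ i, IsSimpleModule R (V i) ∧ AnnihilatedBy ι m (V i)) ∧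
    (∀ i j, Nonempty (V i ≃ₗ[R] V j) → i = j) ∧
    ∀ (W : Type u) [AddCommGroup W] [Module R W],
      IsSimpleModule R W → AnnihilatedBy ι m W → ∃ i, Nonempty (W ≃ₗ[R] V i)

end Azumaya

/-! Centre. Since `Λ` has values modulo `ℓ`, the monomials `M(ℓf)` are central. An exchange element
has the form `M(v)(1 + y)`, where `y` is a scalar multiple of a monomial and `y`, `M(v)` commute up
to `q^(2 D_j)`. By (Coprime) this is a primitive `ℓ`-th root of unity, so only the two extreme terms
survive in the `ℓ`-th power (`exch_pow`). Hence the `ℓ`-th powers of the cluster variables mutate by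
the classical exchange relations, and `x_i ↦ M(e_i)^ℓ` embeds the field of rational functions into
the centre of `F`, compatibly with all mutations (`Intertwines.mutateList`, `centerHom`).

Laurent phenomenon. The cluster variables of all seeds must lie in `U(Θ)`, and their `ℓ`-th powers
in `CU(Θ)`. For `ℓ > 1` compatibility forces the exchange matrix to have full rank, and the upper
bound argument of Berenstein, Fomin and Zelevinsky applies: the intersection of the torus of a seed
with the tori of its neighbours is invariant under mutation. This reduces to rank two, where the
possible denominators are powers of two coprime central elements (`mem_mutate_of_mem`). For `ℓ = 1`
compatibility is an empty condition; there the same argument is run with principal coefficients,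
which are then specialized to `1` (`mutateList_x_mem_torus`). It follows that the localization of
`CU(Θ)` at a seed of `Θ` is the Laurent polynomial ring in the `ℓ`-th powers, whatever `Θ` is
(`mem_locCU_iff`).

Fibres. Over a point `m` of such a torus, `U/mU` has as basis the images of the `M(f)` with `0 ≤ f_i
< ℓ`: it is a twisted group algebra of `(ℤ/ℓ)^N`, of dimension `ℓ^N`. Averaging over this group
shows that it is semisimple. In a simple block the monomials from `Ker Λ` are scalars, and those
from distinct classes modulo `Ker Λ` are eigenvectors for distinct characters, so each block has
dimension `[ℤ^N : Ker Λ]` (`finrank_eq_index`). Thus the index is a square `d^2`, and `U/mU` is a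
product of `n` copies of `M_d(k)` with `n d^2 = ℓ^N` (`exists_fibre`). Conversely `F` has dimension
at most `d^2` over its centre, so the Capelli polynomials vanish on `U(Θ)` in larger degree and no
finite dimensional irreducible representation exceeds dimension `d`
(`finrank_sq_le_of_isSimpleModule`).

Geometry. Localizing `CU(Θ)` at a seed inverts a single element, so the tori are open in the
spectrum. For the set of all seeds `centerHom` identifies them with the classical tori, and their
union is separated because it is open in an affine scheme. -/

set_option linter.unusedSectionVars false

/-! ### Powers of `q` with exponents modulo `ℓ` -/

section ZModPow

variable {k : Type u} [Field k] {ℓ : ℕ} {q : k}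

theorem zmodPow_zero : zmodPow q (0 : ZMod ℓ) = 1 := by simp [zmodPow]

variable [NeZero ℓ]

theorem zmodPow_add (hq : q ^ ℓ = 1) (a b : ZMod ℓ) :
    zmodPow q (a + b) = zmodPow q a * zmodPow q b := by
  rw [zmodPow, zmodPow, zmodPow, ← pow_add, ZMod.val_add, ← pow_mod_natCast_aux hq]
where
  pow_mod_natCast_aux (hq : q ^ ℓ = 1) {n : ℕ} : q ^ n = q ^ (n % ℓ) :=
    pow_eq_pow_mod n hq

theorem zmodPow_ne_zero (hq : q ^ ℓ = 1) (a : ZMod ℓ) : zmodPow q a ≠ 0 := by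
  refine pow_ne_zero _ ?_
  rintro rfl
  simp [NeZero.ne ℓ] at hq

theorem zmodPow_neg (hq : q ^ ℓ = 1) (a : ZMod ℓ) : zmodPow q (-a) = (zmodPow q a)⁻¹ := by
  refine eq_inv_of_mul_eq_one_left ?_
  rw [← zmodPow_add hq, neg_add_cancel, zmodPow_zero]

theorem zmodPow_natCast_mul (hq : q ^ ℓ = 1) (n : ℕ) (a : ZMod ℓ) :
    zmodPow q ((n : ZMod ℓ) * a) = zmodPow q a ^ n := by
  induction n with
  | zero => simp [zmodPow_zero]
  | succ n ih => rw [Nat.cast_succ, add_mul, one_mul, zmodPow_add hq, ih, pow_succ]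

theorem zmodPow_intCast_mul (hq : q ^ ℓ = 1) (n : ℤ) (a : ZMod ℓ) :
    zmodPow q ((n : ZMod ℓ) * a) = zmodPow q a ^ n := by
  obtain ⟨n, rfl | rfl⟩ := n.eq_nat_or_neg
  · simp [zmodPow_natCast_mul hq]
  · simp [neg_mul, zmodPow_neg hq, zmodPow_natCast_mul hq]

theorem zmodPow_one (hq : q ^ ℓ = 1) : zmodPow q (1 : ZMod ℓ) = q := by
  rcases Nat.lt_or_ge 1 ℓ with h | h
  · have : Fact (1 < ℓ) := ⟨h⟩
    rw [zmodPow, ZMod.val_one, pow_one]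
  · have h1 : ℓ = 1 := le_antisymm h (Nat.one_le_iff_ne_zero.2 (NeZero.ne ℓ))
    subst h1
    rw [pow_one] at hq
    simp [zmodPow, hq]

theorem zmodPow_natCast (hq : q ^ ℓ = 1) (n : ℕ) : zmodPow q (n : ZMod ℓ) = q ^ n := by
  rw [← mul_one (n : ZMod ℓ), zmodPow_natCast_mul hq, zmodPow_one hq]

theorem zmodPow_injective (hq : IsPrimitiveRoot q ℓ) :
    Function.Injective (zmodPow q : ZMod ℓ → k) := by
  intro a b hab
  exact ZMod.val_injective ℓ (hq.pow_inj (ZMod.val_lt a) (ZMod.val_lt b) hab)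

end ZModPow

/-- A frame is independent in `F` but need not span it. Extending arbitrarily off its span gives
projections and functionals defined on all of `F`, so that no separate type for the quantum torus is
needed. -/
theorem LinearIndependent.exists_linearMap_apply {k ι V W : Type*} [Field k] [AddCommGroup V]
    [Module k V] [AddCommGroup W] [Module k W] {v : ι → V} (hv : LinearIndependent k v)
    (g : ι → W) : ∃ L : V →ₗ[k] W, ∀ i, L (v i) = g i := by
  obtain ⟨L, hL⟩ := LinearMap.exists_extend
    ((Finsupp.linearCombination k g).comp (hv.repr : _ →ₗ[k] ι →₀ k))
  refine ⟨L, fun i => ?_⟩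
  have h := LinearMap.congr_fun hL ⟨v i, Submodule.subset_span ⟨i, rfl⟩⟩
  simp only [LinearMap.comp_apply, Submodule.subtype_apply] at h
  rw [h]
  change Finsupp.linearCombination k g (hv.repr ⟨v i, _⟩) = g i
  rw [hv.repr_eq_single i _ rfl]
  simp

/-- If `a` and `b` commute up to a scalar then so do `a ^ n` and `b`. -/
theorem zpow_mul_of_mul_eq_smul {k F : Type*} [Field k] [DivisionRing F] [Algebra k F] {a b : F}
    {c : k} (h : a * b = c • (b * a)) (n : ℤ) : a ^ n * b = c ^ n • (b * a ^ n) := by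
  have h1 : SemiconjBy b (c • a) a := by
    rw [SemiconjBy, h, mul_smul_comm]
  have h2 := (h1.zpow_right₀ n).eq
  rw [← h2, Algebra.smul_def, Commute.mul_zpow (Algebra.commutes c a), ← map_zpow₀,
    ← Algebra.smul_def, mul_smul_comm]

/-! ### Spans, projections and gradings of a toric frame -/

namespace QuantumSeed

variable {ℓ N : ℕ} {ex : Finset (Fin N)} {F : Type u} [DivisionRing F]
variable {k : Type u} [Field k] [Algebra k F] {q : k} {S : QuantumSeed ℓ N ex F}

variable (k) in
/-- The span of the `M f` with `f` in a set of exponents. -/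
def frameSpan (S : QuantumSeed ℓ N ex F) (P : Set (Fin N → ℤ)) : Submodule k F :=
  Submodule.span k (S.M '' P)

theorem M_mem_frameSpan {P : Set (Fin N → ℤ)} {f : Fin N → ℤ} (hf : f ∈ P) :
    S.M f ∈ S.frameSpan k P :=
  Submodule.subset_span ⟨f, hf, rfl⟩

theorem frameSpan_mono {P Q : Set (Fin N → ℤ)} (h : P ⊆ Q) :
    S.frameSpan k P ≤ S.frameSpan k Q :=
  Submodule.span_mono (Set.image_mono h)

theorem one_mem_frameSpan {P : Set (Fin N → ℤ)} (h : 0 ∈ P) : (1 : F) ∈ S.frameSpan k P := by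
  rw [← S.M_zero]; exact M_mem_frameSpan h

@[elab_as_elim]
theorem frameSpan_induction {P : Set (Fin N → ℤ)} {p : ∀ a : F, a ∈ S.frameSpan k P → Prop}
    (mem : ∀ f (hf : f ∈ P), p (S.M f) (M_mem_frameSpan hf)) (zero : p 0 (zero_mem _))
    (add : ∀ a b ha hb, p a ha → p b hb → p (a + b) (add_mem ha hb))
    (smul : ∀ (c : k) a ha, p a ha → p (c • a) (Submodule.smul_mem _ c ha)) {a : F}
    (ha : a ∈ S.frameSpan k P) : p a ha := by
  induction ha using Submodule.span_induction with
  | mem x hx => obtain ⟨f, hf, rfl⟩ := hx; exact mem f hf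
  | zero => exact zero
  | add x y hx' hy' hx hy => exact add x y hx' hy' hx hy
  | smul c x hx' hx => exact smul c x hx' hx

section Projection

open Classical in
theorem exists_frameProj (h : LinearIndependent k S.M) (P : Set (Fin N → ℤ)) :
    ∃ L : F →ₗ[k] F, ∀ f, L (S.M f) = if f ∈ P then S.M f else 0 :=
  h.exists_linearMap_apply _

/-- A linear projection which maps `M f` to itself for `f ∈ P` and to zero for `f ∉ P`. -/
noncomputable def frameProj (h : LinearIndependent k S.M) (P : Set (Fin N → ℤ)) : F →ₗ[k] F :=
  (exists_frameProj h P).choose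

variable (h : LinearIndependent k S.M) {P Q R : Set (Fin N → ℤ)}

theorem frameProj_M_of_mem {f : Fin N → ℤ} (hf : f ∈ P) : frameProj h P (S.M f) = S.M f := by
  rw [frameProj, (exists_frameProj h P).choose_spec, if_pos hf]

theorem frameProj_M_of_notMem {f : Fin N → ℤ} (hf : f ∉ P) : frameProj h P (S.M f) = 0 := by
  rw [frameProj, (exists_frameProj h P).choose_spec, if_neg hf]

theorem frameProj_eq_self {a : F} (ha : a ∈ S.frameSpan k P) : frameProj h P a = a := by
  induction ha using frameSpan_induction with
  | mem f hf => exact frameProj_M_of_mem h hf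
  | zero => simp
  | add a b _ _ ha hb => rw [map_add, ha, hb]
  | smul c a _ ha => rw [map_smul, ha]

theorem frameProj_mem_inter {a : F} (ha : a ∈ S.frameSpan k Q) :
    frameProj h P a ∈ S.frameSpan k (P ∩ Q) := by
  induction ha using frameSpan_induction with
  | mem f hf =>
    by_cases hP : f ∈ P
    · rw [frameProj_M_of_mem h hP]; exact M_mem_frameSpan ⟨hP, hf⟩
    · rw [frameProj_M_of_notMem h hP]; exact zero_mem _
  | zero => simp
  | add a b _ _ ha hb => rw [map_add]; exact add_mem ha hb
  | smul c a _ ha => rw [map_smul]; exact Submodule.smul_mem _ _ ha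

theorem frameProj_mem_right {a : F} (ha : a ∈ S.frameSpan k Q) :
    frameProj h P a ∈ S.frameSpan k Q :=
  frameSpan_mono Set.inter_subset_right (frameProj_mem_inter h ha)

theorem frameProj_eq_zero (hPQ : Disjoint P Q) {a : F} (ha : a ∈ S.frameSpan k Q) :
    frameProj h P a = 0 := by
  have := frameProj_mem_inter h (P := P) ha
  rw [hPQ.inter_eq] at this
  simpa [frameSpan] using this

/-- The part of degree `d` with respect to a linear form on the exponents. -/
noncomputable def comp (lam : (Fin N → ℤ) →+ ℤ) (d : ℤ) : F →ₗ[k] F :=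
  frameProj h {f | lam f = d}

theorem exists_finset_comp (lam : (Fin N → ℤ) →+ ℤ) {a : F} (ha : a ∈ S.frameSpan k P) :
    ∃ s : Finset ℤ, (∀ d ∉ s, comp h lam d a = 0) ∧ a = ∑ d ∈ s, comp h lam d a := by
  -- Allowing every larger finite set makes the sum of two elements treatable by the union of their
  -- sets.
  have key : ∃ s : Finset ℤ, ∀ t, s ⊆ t →
      (∀ d ∉ t, comp h lam d a = 0) ∧ a = ∑ d ∈ t, comp h lam d a := by
    induction ha using frameSpan_induction with
    | mem f hf =>
      have h0 : ∀ d, d ≠ lam f → comp h lam d (S.M f) = 0 := fun d hd =>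
        frameProj_M_of_notMem h (fun h' => hd (by simpa using h'.symm))
      refine ⟨{lam f}, fun t ht => ⟨fun d hd => h0 d ?_, ?_⟩⟩
      · rintro rfl; exact hd (ht (by simp))
      · rw [Finset.sum_eq_single_of_mem (lam f) (ht (by simp)) (fun d _ hd => h0 d hd)]
        exact (frameProj_M_of_mem h (P := {g | lam g = lam f}) rfl).symm
    | zero => exact ⟨∅, fun t _ => by simp⟩
    | add a b _ _ ha hb =>
      classical
      obtain ⟨s, hs⟩ := ha
      obtain ⟨t, ht⟩ := hb
      refine ⟨s ∪ t, fun r hr => ?_⟩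
      obtain ⟨h1, h2⟩ := hs r (Finset.union_subset_left hr)
      obtain ⟨h3, h4⟩ := ht r (Finset.union_subset_right hr)
      refine ⟨fun d hd => by rw [map_add, h1 d hd, h3 d hd, add_zero], ?_⟩
      simp only [map_add, Finset.sum_add_distrib, ← h2, ← h4]
    | smul c a _ ha =>
      obtain ⟨s, hs⟩ := ha
      refine ⟨s, fun r hr => ?_⟩
      obtain ⟨h1, h2⟩ := hs r hr
      refine ⟨fun d hd => by rw [map_smul, h1 d hd, smul_zero], ?_⟩
      simp only [map_smul, ← Finset.smul_sum, ← h2]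
  obtain ⟨s, hs⟩ := key
  exact ⟨s, hs s subset_rfl⟩

theorem mem_of_comp_mem (lam : (Fin N → ℤ) →+ ℤ) {a : F} (ha : a ∈ S.frameSpan k P)
    {W : Submodule k F} (hW : ∀ d, comp h lam d a ∈ W) : a ∈ W := by
  obtain ⟨s, -, hs⟩ := exists_finset_comp h lam ha
  rw [hs]
  exact sum_mem fun d _ => hW d

theorem exists_comp_eq_zero_of_lt (lam : (Fin N → ℤ) →+ ℤ) {a : F} (ha : a ∈ S.frameSpan k P) :
    ∃ m : ℤ, ∀ d < m, comp h lam d a = 0 := by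
  obtain ⟨s, hs, -⟩ := exists_finset_comp h lam ha
  by_cases hne : s.Nonempty
  · refine ⟨s.min' hne, fun d hd => hs d fun hds => ?_⟩
    exact absurd (s.min'_le d hds) (not_le.2 hd)
  · rw [Finset.not_nonempty_iff_eq_empty] at hne
    exact ⟨0, fun d _ => hs d (by simp [hne])⟩

theorem comp_mem (lam : (Fin N → ℤ) →+ ℤ) (d : ℤ) {a : F} (ha : a ∈ S.frameSpan k P) :
    comp h lam d a ∈ S.frameSpan k (P ∩ {f | lam f = d}) := by
  rw [Set.inter_comm]; exact frameProj_mem_inter h ha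

end Projection

theorem mem_frameSpan_univ {P : Set (Fin N → ℤ)} {a : F} (ha : a ∈ S.frameSpan k P) :
    a ∈ S.frameSpan k Set.univ :=
  frameSpan_mono (Set.subset_univ P) ha

theorem Λ_smul_left (S : QuantumSeed ℓ N ex F) (f g : Fin N → ℤ) : S.Λ (ℓ • f) g = 0 := by
  rw [map_nsmul, LinearMap.smul_apply, nsmul_eq_mul, ZMod.natCast_self, zero_mul]

theorem Λ_smul_right (S : QuantumSeed ℓ N ex F) (f g : Fin N → ℤ) : S.Λ f (ℓ • g) = 0 := by
  rw [map_nsmul, nsmul_eq_mul, ZMod.natCast_self, zero_mul]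

namespace IsToricFrame

theorem M_ne_zero (h : S.IsToricFrame q) (f : Fin N → ℤ) : S.M f ≠ 0 :=
  h.linearIndependent.ne_zero f

variable [NeZero ℓ] (h : S.IsToricFrame q)
include h

theorem mul_mem_frameSpan {P Q R : Set (Fin N → ℤ)} (hR : ∀ f ∈ P, ∀ g ∈ Q, f + g ∈ R) {a b : F}
    (ha : a ∈ S.frameSpan k P) (hb : b ∈ S.frameSpan k Q) : a * b ∈ S.frameSpan k R := by
  induction ha using frameSpan_induction with
  | mem f hf =>
    induction hb using frameSpan_induction with
    | mem g hg =>
      rw [h.mul]; exact Submodule.smul_mem _ _ (M_mem_frameSpan (hR f hf g hg))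
    | zero => simp
    | add a b _ _ ha hb => rw [mul_add]; exact add_mem ha hb
    | smul c a _ ha => rw [mul_smul_comm]; exact Submodule.smul_mem _ _ ha
  | zero => simp
  | add a b _ _ ha hb => rw [add_mul]; exact add_mem ha hb
  | smul c a _ ha => rw [smul_mul_assoc]; exact Submodule.smul_mem _ _ ha

theorem pow_mem_frameSpan {P : Set (Fin N → ℤ)} (h0 : 0 ∈ P) (hP : ∀ f ∈ P, ∀ g ∈ P, f + g ∈ P)
    {a : F} (ha : a ∈ S.frameSpan k P) (n : ℕ) : a ^ n ∈ S.frameSpan k P := by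
  induction n with
  | zero => rw [pow_zero]; exact one_mem_frameSpan h0
  | succ n ih => rw [pow_succ]; exact h.mul_mem_frameSpan hP ih ha

theorem adjoin_eq_frameSpan {P : Set (Fin N → ℤ)} (h0 : 0 ∈ P)
    (hP : ∀ f ∈ P, ∀ g ∈ P, f + g ∈ P) {z : F} :
    z ∈ Algebra.adjoin k (S.M '' P) ↔ z ∈ S.frameSpan k P := by
  constructor
  · intro hz
    induction hz using Algebra.adjoin_induction with
    | mem x hx => exact Submodule.subset_span hx
    | algebraMap r =>
      rw [Algebra.algebraMap_eq_smul_one]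
      exact Submodule.smul_mem _ _ (one_mem_frameSpan h0)
    | add x y _ _ hx hy => exact add_mem hx hy
    | mul x y _ _ hx hy => exact h.mul_mem_frameSpan hP hx hy
  · exact fun hz => Algebra.span_le_adjoin k _ hz

/-- Translation by exponents in `Q` turns `P` into `P'` and its complement into the complement. It
is applied to level sets of a linear form and to the sublattice `ℓℤ^N`. -/
theorem frameProj_mul {P P' Q R : Set (Fin N → ℤ)}
    (hP : ∀ f, ∀ g ∈ Q, f + g ∈ P' ↔ f ∈ P) {a x : F} (ha : a ∈ S.frameSpan k R)
    (hx : x ∈ S.frameSpan k Q) :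
    frameProj h.linearIndependent P' (a * x) = frameProj h.linearIndependent P a * x := by
  induction ha using frameSpan_induction with
  | mem f hf =>
    induction hx using frameSpan_induction with
    | mem g hg =>
      rw [h.mul, map_smul]
      by_cases hfP : f ∈ P
      · rw [frameProj_M_of_mem _ hfP, frameProj_M_of_mem _ ((hP f g hg).2 hfP), h.mul]
      · rw [frameProj_M_of_notMem _ hfP, frameProj_M_of_notMem _ (fun h' => hfP ((hP f g hg).1 h')),
          zero_mul, smul_zero]
    | zero => simp
    | add a b _ _ ha hb => rw [mul_add, mul_add, map_add, ha, hb]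
    | smul c a _ ha => rw [mul_smul_comm, mul_smul_comm, map_smul, ha]
  | zero => simp
  | add a b _ _ ha hb => rw [add_mul, map_add, map_add, ha, hb, add_mul]
  | smul c a _ ha => rw [smul_mul_assoc, map_smul, map_smul, ha, smul_mul_assoc]

theorem comp_mul (lam : (Fin N → ℤ) →+ ℤ) {e : ℤ} {R : Set (Fin N → ℤ)} {a x : F}
    (ha : a ∈ S.frameSpan k R) (hx : x ∈ S.frameSpan k {f | lam f = e}) (d : ℤ) :
    comp h.linearIndependent lam d (a * x) = comp h.linearIndependent lam (d - e) a * x := by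
  refine h.frameProj_mul (fun f g hg => ?_) ha hx
  simp only [Set.mem_ofPred_eq] at hg ⊢
  rw [map_add, hg]
  omega

theorem M_neg_of (f : Fin N → ℤ) (hf : S.Λ f f = 0) : S.M (-f) = (S.M f)⁻¹ := by
  refine eq_inv_of_mul_eq_one_left ?_
  rw [h.mul, map_neg, LinearMap.neg_apply, hf, neg_zero, zmodPow_zero, one_smul, neg_add_cancel,
    S.M_zero]

variable (hq : IsPrimitiveRoot q ℓ) (hodd : Odd ℓ)

omit hq [NeZero ℓ] in
include hodd in
-- Skew-symmetry only gives `2 Λ(f,f) = 0`; oddness of `ℓ` makes `2` invertible.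
theorem Λ_self (f : Fin N → ℤ) : S.Λ f f = 0 := by
  have h1 := h.skew f f
  have h2 : (2 : ZMod ℓ) * S.Λ f f = 0 := by rw [two_mul]; nth_rewrite 2 [h1]; ring
  have h3 : IsUnit (2 : ZMod ℓ) := by
    have := (ZMod.isUnit_iff_coprime 2 ℓ).2 (Nat.coprime_two_left.2 hodd)
    simpa using this
  exact (h3.mul_right_eq_zero).1 h2

include hodd in
theorem M_neg (f : Fin N → ℤ) : S.M (-f) = (S.M f)⁻¹ := h.M_neg_of f (h.Λ_self hodd f)

include hodd in
theorem M_nsmul (n : ℕ) (f : Fin N → ℤ) : S.M (n • f) = S.M f ^ n := by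
  induction n with
  | zero => simp [S.M_zero]
  | succ n ih =>
    rw [pow_succ, ← ih, h.mul, succ_nsmul, map_nsmul, LinearMap.smul_apply, h.Λ_self hodd,
      smul_zero, zmodPow_zero, one_smul]

include hodd in
theorem M_zsmul (n : ℤ) (f : Fin N → ℤ) : S.M (n • f) = S.M f ^ n := by
  obtain ⟨n, rfl | rfl⟩ := n.eq_nat_or_neg
  · rw [natCast_zsmul, h.M_nsmul hodd, zpow_natCast]
  · rw [neg_smul, h.M_neg hodd, natCast_zsmul, h.M_nsmul hodd, zpow_neg, zpow_natCast]

include hq in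
theorem M_add (f g : Fin N → ℤ) : S.M (f + g) = zmodPow q (-S.Λ f g) • (S.M f * S.M g) := by
  rw [h.mul, smul_smul, ← zmodPow_add hq.pow_eq_one, neg_add_cancel, zmodPow_zero, one_smul]

include hq in
theorem M_mul_comm (f g : Fin N → ℤ) :
    S.M f * S.M g = zmodPow q (2 * S.Λ f g) • (S.M g * S.M f) := by
  rw [h.mul, h.mul, smul_smul, ← zmodPow_add hq.pow_eq_one, add_comm g f, h.skew g f]
  congr 2
  ring

theorem M_mul_M_smul (f g : Fin N → ℤ) : S.M f * S.M (ℓ • g) = S.M (f + ℓ • g) := by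
  rw [h.mul, S.Λ_smul_right, zmodPow_zero, one_smul]

theorem M_smul_mul_M (f g : Fin N → ℤ) : S.M (ℓ • f) * S.M g = S.M (ℓ • f + g) := by
  rw [h.mul, S.Λ_smul_left, zmodPow_zero, one_smul]

/-- `Λ` kills multiples of `ℓ`, which gives commutation with the frame; fractions of its span
inherit it. -/
theorem commute_M_smul (f : Fin N → ℤ) (z : F) : Commute (S.M (ℓ • f)) z := by
  have key : ∀ a ∈ Submodule.span k (Set.range S.M), Commute (S.M (ℓ • f)) a := by
    intro a ha
    induction ha using Submodule.span_induction with
    | mem x hx =>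
      obtain ⟨g, rfl⟩ := hx
      rw [commute_iff_eq, h.M_smul_mul_M, h.M_mul_M_smul, add_comm]
    | zero => exact Commute.zero_right _
    | add x y _ _ hx hy => exact hx.add_right hy
    | smul c x _ hx => exact hx.smul_right c
  obtain ⟨a, ha, b, hb, -, rfl⟩ := h.fractions z
  exact (key a ha).mul_right ((key b hb).inv_right₀)

theorem M_smul_mem_center (f : Fin N → ℤ) : S.M (ℓ • f) ∈ Subalgebra.center k F :=
  Subalgebra.mem_center_iff.2 fun z => (h.commute_M_smul f z).eq.symm

end IsToricFrame

end QuantumSeed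

/-! ### Mutation of exchange matrices -/

section MatrixMutation

variable {N : ℕ} {ex : Finset (Fin N)}

theorem mutateMatrix_of_eq (k : ex) (B : Matrix (Fin N) ex ℤ) {i : Fin N} {j : ex}
    (h : i = k.1 ∨ j = k) : mutateMatrix k B i j = -B i j := by
  rw [mutateMatrix, if_pos h]

/-- With `|a| = 2 max(a,0) - a` and `|b| = b + 2 max(-b,0)` the products `ab` cancel and the
division by `2` is exact. This asymmetric form is the one that matches the exponents `vPos` and
`vNeg`. -/
theorem mutateMatrix_of_ne (k : ex) (B : Matrix (Fin N) ex ℤ) {i : Fin N} {j : ex}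
    (hi : i ≠ k.1) (hj : j ≠ k) : mutateMatrix k B i j =
      B i j + max (B i k) 0 * B k.1 j + B i k * max (-B k.1 j) 0 := by
  rw [mutateMatrix, if_neg (by tauto), add_assoc]
  congr 1
  refine Int.ediv_eq_of_eq_mul_right two_ne_zero ?_
  rcases le_total 0 (B i k) with h1 | h1 <;> rcases le_total 0 (B k.1 j) with h2 | h2 <;>
    simp [abs_of_nonneg, abs_of_nonpos, h1, h2] <;> ring

theorem mutateMatrix_mutateMatrix (k : ex) (B : Matrix (Fin N) ex ℤ) :
    mutateMatrix k (mutateMatrix k B) = B := by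
  funext i j
  by_cases h : i = k.1 ∨ j = k
  · rw [mutateMatrix_of_eq k _ h, mutateMatrix_of_eq k _ h, neg_neg]
  · push Not at h
    rw [mutateMatrix_of_ne k _ h.1 h.2, mutateMatrix_of_ne k _ h.1 h.2,
      mutateMatrix_of_eq k B (i := i) (j := k) (Or.inr rfl),
      mutateMatrix_of_eq k B (i := k.1) (j := j) (Or.inl rfl)]
    rcases le_total 0 (B i k) with h1 | h1 <;> rcases le_total 0 (B k.1 j) with h2 | h2 <;>
      simp [h1, h2]

/-- `D` skew-symmetrizes the principal part of `B`. -/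
def IsSkewSymmetrizer (D : ex → ℕ) (B : Matrix (Fin N) ex ℤ) : Prop :=
  (∀ i, 0 < D i) ∧ ∀ i j : ex, (D i : ℤ) * B i.1 j = -((D j : ℤ) * B j.1 i)

namespace IsSkewSymmetrizer

variable {D : ex → ℕ} {B : Matrix (Fin N) ex ℤ} (h : IsSkewSymmetrizer D B)
include h

theorem diag (j : ex) : B j.1 j = 0 := by
  have h1 := h.2 j j
  have h2 : (D j : ℤ) ≠ 0 := by exact_mod_cast (h.1 j).ne'
  have h3 : (D j : ℤ) * B j.1 j = 0 := by omega
  exact (mul_eq_zero.1 h3).resolve_left h2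

theorem mul_max (i j : ex) : (D i : ℤ) * max (B i.1 j) 0 = (D j : ℤ) * max (-B j.1 i) 0 := by
  rw [mul_max_of_nonneg _ _ (by positivity), mul_max_of_nonneg _ _ (by positivity), h.2 i j]
  simp

theorem mutate (k : ex) : IsSkewSymmetrizer D (mutateMatrix k B) := by
  refine ⟨h.1, fun i j => ?_⟩
  by_cases hi : i = k
  · rw [mutateMatrix_of_eq k B (Or.inl (congrArg Subtype.val hi)),
      mutateMatrix_of_eq k B (Or.inr hi), mul_neg, mul_neg, h.2 i j]
  by_cases hj : j = k
  · rw [mutateMatrix_of_eq k B (Or.inl (congrArg Subtype.val hj)),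
      mutateMatrix_of_eq k B (Or.inr hj), mul_neg, mul_neg, h.2 i j]
  rw [mutateMatrix_of_ne k B (fun e => hi (Subtype.ext e)) hj,
    mutateMatrix_of_ne k B (fun e => hj (Subtype.ext e)) hi]
  linear_combination h.2 i j + B k.1 j * h.mul_max i k + max (-B k.1 j) 0 * h.2 i k +
    B k.1 i * h.mul_max j k + max (-B k.1 i) 0 * h.2 j k

theorem eq_zero_iff (i j : ex) : B i.1 j = 0 ↔ B j.1 i = 0 := by
  have h1 := h.2 i j
  have hi : (D i : ℤ) ≠ 0 := by exact_mod_cast (h.1 i).ne'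
  have hj : (D j : ℤ) ≠ 0 := by exact_mod_cast (h.1 j).ne'
  constructor
  · intro h0; rw [h0, mul_zero, zero_eq_neg] at h1; exact (mul_eq_zero.1 h1).resolve_left hj
  · intro h0; rw [h0, mul_zero, neg_zero] at h1; exact (mul_eq_zero.1 h1).resolve_left hi

theorem pos_iff (i j : ex) : 0 < B i.1 j ↔ B j.1 i < 0 := by
  have h1 := h.2 i j
  have hi : (0 : ℤ) < D i := by exact_mod_cast h.1 i
  have hj : (0 : ℤ) < D j := by exact_mod_cast h.1 j
  constructor <;> intro h0 <;> nlinarith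

end IsSkewSymmetrizer

end MatrixMutation

/-! ### Mutation preserves root of unity quantum seeds and is an involution -/

namespace QuantumSeed

variable {ℓ N : ℕ} {ex : Finset (Fin N)} {F : Type u} [DivisionRing F]
variable {k : Type u} [Field k] [Algebra k F] {q : k} {S : QuantumSeed ℓ N ex F}

theorem ext' {S T : QuantumSeed ℓ N ex F} (h1 : S.M = T.M) (h2 : S.Λ = T.Λ) (h3 : S.B = T.B) :
    S = T := by
  cases S; cases T; simp_all

theorem Λ_zsmul_left (S : QuantumSeed ℓ N ex F) (n : ℤ) (f g : Fin N → ℤ) :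
    S.Λ (n • f) g = n * S.Λ f g := by
  rw [map_zsmul, LinearMap.smul_apply, zsmul_eq_mul]

theorem Λ_zsmul_right (S : QuantumSeed ℓ N ex F) (n : ℤ) (f g : Fin N → ℤ) :
    S.Λ f (n • g) = n * S.Λ f g := by
  rw [map_zsmul, zsmul_eq_mul]

/-- The column of the exchange matrix at `j`. -/
def col (S : QuantumSeed ℓ N ex F) (j : ex) : Fin N → ℤ := fun a => S.B a j

theorem vPos_eq (S : QuantumSeed ℓ N ex F) (j : ex) : S.vPos j = S.vNeg j + S.col j := by
  funext a
  simp only [vPos, vNeg, col, Pi.add_apply]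
  rcases le_total 0 (S.B a j) with h | h <;> simp [h]

theorem vPos_apply (S : QuantumSeed ℓ N ex F) (j : ex) {a : Fin N} (ha : a ≠ j.1) :
    S.vPos j a = max (S.B a j) 0 := by
  simp [vPos, ha]

theorem vNeg_apply (S : QuantumSeed ℓ N ex F) (j : ex) {a : Fin N} (ha : a ≠ j.1) :
    S.vNeg j a = max (-S.B a j) 0 := by
  simp [vNeg, ha]

/-- The sum `M(-e_j + [b^j]_+) + M(-e_j - [b^j]_-)`. -/
def exch (S : QuantumSeed ℓ N ex F) (j : ex) : F := S.M (S.vPos j) + S.M (S.vNeg j)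

theorem mutationMap_apply (S : QuantumSeed ℓ N ex F) (j : ex) (f : Fin N → ℤ) :
    S.mutationMap j f = Function.update f j.1 0 + f j.1 • S.vPos j := by
  have : f = Function.update f j.1 0 + f j.1 • Pi.single j.1 1 := by
    funext a
    by_cases ha : a = j.1
    · subst ha; simp
    · simp [ha]
  simp only [mutationMap, LinearMap.add_apply, LinearMap.id_apply, LinearMap.smulRight_apply,
    LinearMap.proj_apply, smul_sub]
  nth_rewrite 1 [this]
  abel

theorem update_add_single (f : Fin N → ℤ) (j : Fin N) :
    Function.update f j 0 + f j • Pi.single j 1 = f := by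
  funext a
  by_cases ha : a = j
  · subst ha; simp
  · simp [ha]

theorem mutate_M (S : QuantumSeed ℓ N ex F) (j : ex) (f : Fin N → ℤ) :
    (S.mutate q j).M f = zmodPow q (-S.Λ (Function.update f j.1 0) (f j.1 • S.vPos j)) •
      (S.M (Function.update f j.1 0) * S.exch j ^ f j.1) := rfl

theorem mutate_M_of_eq_zero (S : QuantumSeed ℓ N ex F) (j : ex) {f : Fin N → ℤ}
    (hf : f j.1 = 0) : (S.mutate q j).M f = S.M f := by
  have : Function.update f j.1 0 = f := by rw [Function.update_eq_self_iff, hf]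
  simp [mutate_M, this, hf, zmodPow_zero]

theorem mutate_M_single (S : QuantumSeed ℓ N ex F) (j : ex) :
    (S.mutate q j).M (Pi.single j.1 1) = S.exch j := by
  have : Function.update (Pi.single j.1 1 : Fin N → ℤ) j.1 0 = 0 := by
    funext a
    by_cases ha : a = j.1
    · subst ha; simp
    · simp [ha]
  simp [mutate_M, this, zmodPow_zero, S.M_zero]

theorem mutate_Λ (S : QuantumSeed ℓ N ex F) (j : ex) (f g : Fin N → ℤ) :
    (S.mutate q j).Λ f g = S.Λ (Function.update f j.1 0 + f j.1 • S.vPos j)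
      (Function.update g j.1 0 + g j.1 • S.vPos j) := by
  rw [← mutationMap_apply, ← mutationMap_apply]; rfl

theorem mutate_B (S : QuantumSeed ℓ N ex F) (j : ex) :
    (S.mutate q j).B = mutateMatrix j S.B := rfl

/-- The degree of an exponent at `j`. -/
def deg (j : Fin N) : (Fin N → ℤ) →+ ℤ := Pi.evalAddMonoidHom (fun _ => ℤ) j

@[simp] theorem deg_apply (j : Fin N) (f : Fin N → ℤ) : deg j f = f j := rfl

namespace IsRootOfUnityQuantumSeed

variable {D : ex → ℕ} (hS : S.IsRootOfUnityQuantumSeed q D)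
include hS

theorem skew : IsSkewSymmetrizer D S.B := ⟨hS.pos, hS.skewSymmetrizable⟩

theorem vPos_self (j : ex) : S.vPos j j.1 = -1 := by simp [vPos, hS.skew.diag]

theorem vNeg_self (j : ex) : S.vNeg j j.1 = -1 := by simp [vNeg, hS.skew.diag]

theorem Λ_col (j : ex) (f : Fin N → ℤ) : S.Λ (S.col j) f = (f j.1 : ZMod ℓ) * D j := by
  have h1 : f = ∑ i, f i • (Pi.single i 1 : Fin N → ℤ) := by
    funext a
    simp [Finset.sum_apply, Pi.single_apply]
  conv_lhs => rw [h1, map_sum]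
  have h2 : ∀ i, S.Λ (S.col j) (f i • (Pi.single i 1 : Fin N → ℤ)) =
      if i = j.1 then (f i : ZMod ℓ) * D j else 0 := by
    intro i
    rw [Λ_zsmul_right, show S.col j = fun a => S.B a j from rfl, hS.compatible i j]
    split_ifs <;> simp
  rw [Finset.sum_congr rfl fun i _ => h2 i]
  simp

theorem Λ_col_right (j : ex) (f : Fin N → ℤ) : S.Λ f (S.col j) = -((f j.1 : ZMod ℓ) * D j) := by
  rw [hS.frame.skew, hS.Λ_col]

/-- The two exchange exponents differ by `b^j`, which pairs to zero with `f`. Hence both summands of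
`exch`, and so `exch` itself, commute with `M f` up to one common scalar. -/
theorem Λ_vNeg_of_eq_zero (j : ex) {f : Fin N → ℤ} (hf : f j.1 = 0) :
    S.Λ f (S.vNeg j) = S.Λ f (S.vPos j) := by
  rw [vPos_eq, map_add, hS.Λ_col_right, hf]; simp

theorem exch_mem_deg (j : ex) : S.exch j ∈ S.frameSpan k {f | deg j.1 f = -1} :=
  add_mem (M_mem_frameSpan (hS.vPos_self j)) (M_mem_frameSpan (hS.vNeg_self j))

theorem exch_ne_zero [CharZero k] (j : ex) : S.exch j ≠ 0 := by
  intro h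
  -- For a zero column the two exponents agree and the sum is `2 M(v)`, nonzero in characteristic
  -- `0`; otherwise project to one of the two monomials.
  by_cases hv : S.vPos j = S.vNeg j
  · rw [exch, hv, ← two_smul k] at h
    rcases smul_eq_zero.1 h with h | h
    · exact two_ne_zero h
    · exact hS.frame.M_ne_zero _ h
  · have h1 := congrArg (frameProj hS.frame.linearIndependent {S.vPos j}) h
    rw [exch, map_add, map_zero, frameProj_M_of_mem _ (Set.mem_singleton _),
      frameProj_M_of_notMem _ (fun e => hv e.symm), add_zero] at h1
    exact hS.frame.M_ne_zero _ h1

variable [NeZero ℓ]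

theorem exch_pow_mem_deg (j : ex) (n : ℕ) :
    S.exch j ^ n ∈ S.frameSpan k {f | deg j.1 f = -n} := by
  induction n with
  | zero => rw [pow_zero]; exact one_mem_frameSpan (by simp)
  | succ n ih =>
    rw [pow_succ]
    refine hS.frame.mul_mem_frameSpan (fun f hf g hg => ?_) ih (hS.exch_mem_deg j)
    simp only [Set.mem_ofPred_eq, map_add] at hf hg ⊢
    push_cast
    omega

variable (hq : IsPrimitiveRoot q ℓ)
include hq

theorem exch_zpow_mul_M (j : ex) {f : Fin N → ℤ} (hf : f j.1 = 0) (n : ℤ) :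
    S.exch j ^ n * S.M f = zmodPow q (2 * S.Λ (n • S.vPos j) f) • (S.M f * S.exch j ^ n) := by
  have h1 : S.exch j * S.M f = zmodPow q (2 * S.Λ (S.vPos j) f) • (S.M f * S.exch j) := by
    rw [exch, add_mul, mul_add, smul_add, hS.frame.M_mul_comm hq (S.vPos j) f,
      hS.frame.M_mul_comm hq (S.vNeg j) f, hS.frame.skew (S.vNeg j), hS.Λ_vNeg_of_eq_zero j hf,
      hS.frame.skew (S.vPos j)]
  rw [zpow_mul_of_mul_eq_smul h1, ← zmodPow_intCast_mul hq.pow_eq_one]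
  congr 2
  rw [Λ_zsmul_left]
  ring

variable [CharZero k] (hodd : Odd ℓ)

include hodd in
-- Up to a scalar `M'(f)` is `M(f°) X^{f_j}`, with `f°` the part of `f` away from `j` and `X` the
-- exchange element. Moving `X^{f_j}` past `M(g°)` costs a power of `q`, and the comparison of
-- exponents is bilinearity together with `Λ(v,v) = 0`.
theorem mutate_mul (j : ex) (f g : Fin N → ℤ) :
    (S.mutate q j).M f * (S.mutate q j).M g =
      zmodPow q ((S.mutate q j).Λ f g) • (S.mutate q j).M (f + g) := by
  have hX := hS.exch_ne_zero j
  set a := Function.update f j.1 0 with ha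
  set b := Function.update g j.1 0 with hb
  have hab : Function.update (f + g) j.1 0 = a + b := by
    funext i
    by_cases hi : i = j.1
    · subst hi; simp [ha, hb]
    · simp [ha, hb, hi]
  have hbj : b j.1 = 0 := by simp [hb]
  rw [mutate_M, mutate_M, mutate_M, mutate_Λ, ← ha, ← hb, hab, smul_mul_smul_comm, mul_assoc,
    ← mul_assoc _ (S.M b), hS.exch_zpow_mul_M hq j hbj, smul_mul_assoc, mul_smul_comm,
    mul_assoc, ← zpow_add₀ hX, ← mul_assoc, hS.frame.mul, smul_mul_assoc, smul_smul, smul_smul,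
    smul_smul]
  simp only [← zmodPow_add hq.pow_eq_one, Pi.add_apply]
  congr 2
  have hv := hS.frame.Λ_self hodd (S.vPos j)
  have hs := hS.frame.skew b (S.vPos j)
  simp only [Λ_zsmul_left, Λ_zsmul_right, map_add, LinearMap.add_apply, hv]
  rw [hs]
  push_cast
  ring

theorem mutate_M_mul_exch (j : ex) (f : Fin N → ℤ) (m n : ℕ) (hn : f j.1 + m = n) :
    (S.mutate q j).M f * S.exch j ^ m ∈ S.frameSpan k {g | deg j.1 g = -n} := by
  rw [mutate_M, smul_mul_assoc, mul_assoc, ← zpow_natCast, ← zpow_add₀ (hS.exch_ne_zero j), hn,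
    zpow_natCast]
  refine Submodule.smul_mem _ _ (hS.frame.mul_mem_frameSpan (P := {Function.update f j.1 0})
    ?_ (M_mem_frameSpan rfl) (hS.exch_pow_mem_deg j n))
  rintro g hg h' hh
  rw [Set.mem_singleton_iff] at hg
  simp only [Set.mem_ofPred_eq, map_add] at hh ⊢
  rw [hh, hg]
  simp

open Classical in
/-- The homogeneous components of an element of both quantum tori agree. -/
theorem comp_linearCombination_mutate (j : ex) (c : (Fin N → ℤ) →₀ k)
    (hc : Finsupp.linearCombination k (S.mutate q j).M c ∈ S.frameSpan k Set.univ) (d : ℤ) :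
    comp hS.frame.linearIndependent (deg j.1) d
      (Finsupp.linearCombination k (S.mutate q j).M c) =
    ∑ f ∈ c.support with f j.1 = -d, c f • (S.mutate q j).M f := by
  -- Multiplication by `X^m` clears all negative powers of the exchange element `X`, and brings
  -- every term into the old torus.
  obtain ⟨m, hm⟩ : ∃ m : ℕ, ∀ f ∈ c.support, 0 ≤ f j.1 + m := by
    refine ⟨∑ f ∈ c.support, (f j.1).natAbs, fun f hf => ?_⟩
    have h1 := Finset.single_le_sum (f := fun f : Fin N → ℤ => (f j.1).natAbs)
      (fun _ _ => Nat.zero_le _) hf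
    have h2 : (f j.1).natAbs ≤ ∑ f ∈ c.support, (f j.1).natAbs := h1
    omega
  have hX := pow_ne_zero m (hS.exch_ne_zero j)
  refine mul_right_cancel₀ hX ?_
  -- `X^m` is homogeneous of degree `-m` at `j`, so degree `d` of the element becomes degree `d - m`
  -- of the product.
  have h1 := hS.frame.comp_mul (deg j.1) hc (hS.exch_pow_mem_deg j m) (d - m)
  rw [sub_neg_eq_add, sub_add_cancel] at h1
  rw [← h1, Finsupp.linearCombination_apply, Finsupp.sum, Finset.sum_mul, map_sum,
    Finset.sum_mul, Finset.sum_filter]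
  refine Finset.sum_congr rfl fun f hf => ?_
  obtain ⟨n, hn⟩ := Int.eq_ofNat_of_zero_le (hm f hf)
  have h2 := hS.mutate_M_mul_exch hq j f m n hn
  rw [smul_mul_assoc, map_smul]
  split_ifs with hfd
  · congr 1
    refine frameProj_eq_self _ ?_
    convert h2 using 3
    ext g
    simp only [deg_apply]
    omega
  · rw [comp, frameProj_eq_zero _ _ h2, smul_zero]
    rw [Set.disjoint_left]
    intro g hg hg'
    simp only [Set.mem_ofPred_eq] at hg hg'
    omega

/-- The grading at `j` separates terms with different `f_j`. For fixed `f_j` the common factor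
`X^{f_j}` cancels, leaving old monomials `M(f°)` with distinct exponents. -/
theorem mutate_linearIndependent (j : ex) : LinearIndependent k (S.mutate q j).M := by
  classical
  rw [linearIndependent_iff]
  intro c hc
  ext f
  rw [Finsupp.zero_apply]
  by_contra hcf
  have h1 := hS.comp_linearCombination_mutate hq j c (by rw [hc]; exact zero_mem _) (-f j.1)
  rw [hc, map_zero, neg_neg] at h1
  have h2 : ∑ g ∈ c.support with g j.1 = f j.1,
      (c g * zmodPow q (-S.Λ (Function.update g j.1 0) (g j.1 • S.vPos j))) •
        S.M (Function.update g j.1 0) = 0 := by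
    have hX := zpow_ne_zero (f j.1) (hS.exch_ne_zero j)
    refine (mul_eq_zero.1 (Eq.trans ?_ h1.symm)).resolve_right hX
    rw [Finset.sum_mul]
    refine Finset.sum_congr rfl fun g hg => ?_
    rw [mutate_M, ← smul_smul, smul_mul_assoc, smul_mul_assoc, (Finset.mem_filter.1 hg).2]
  have h3 := congrArg (frameProj hS.frame.linearIndependent {Function.update f j.1 0}) h2
  rw [map_sum, map_zero, Finset.sum_eq_single f] at h3
  · rw [map_smul, frameProj_M_of_mem _ (Set.mem_singleton _)] at h3
    rcases smul_eq_zero.1 h3 with h4 | h4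
    · exact mul_ne_zero hcf (zmodPow_ne_zero hq.pow_eq_one _) h4
    · exact hS.frame.M_ne_zero _ h4
  · intro g hg hgf
    rw [map_smul, frameProj_M_of_notMem, smul_zero]
    intro h4
    rw [Set.mem_singleton_iff] at h4
    apply hgf
    rw [← update_add_single g j.1, ← update_add_single f j.1, h4, (Finset.mem_filter.1 hg).2]
  · intro hf
    refine absurd (Finset.mem_filter.2 ⟨Finsupp.mem_support_iff.2 hcf, ?_⟩) hf
    rfl

omit hq [CharZero k] [NeZero ℓ] in
theorem mutate_vPos (j : ex) : (S.mutate q j).vPos j = S.vNeg j := by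
  funext a
  simp only [vPos, vNeg, mutate_B, Pi.add_apply, mutateMatrix_of_eq j S.B (j := j) (Or.inr rfl)]

omit hq [CharZero k] [NeZero ℓ] in
theorem mutate_vNeg (j : ex) : (S.mutate q j).vNeg j = S.vPos j := by
  funext a
  simp only [vPos, vNeg, mutate_B, Pi.add_apply, mutateMatrix_of_eq j S.B (j := j) (Or.inr rfl),
    neg_neg]

include hodd in
-- Multiplying by the old exchange element `X` turns each new monomial into a multiple of `M(e_j +
-- v)`, and the two scalars are exactly those in the expansion of `M(e_j) X`. This is the
-- involutivity of mutation on the variable at `j`.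
theorem exch_mutate (j : ex) : (S.mutate q j).exch j = S.M (Pi.single j.1 1) := by
  have hX := hS.exch_ne_zero j
  have key : ∀ v : Fin N → ℤ, v j.1 = -1 → (S.mutate q j).M v * S.exch j =
      zmodPow q (S.Λ (Pi.single j.1 1 + v) (S.vPos j)) • S.M (Pi.single j.1 1 + v) := by
    intro v hv
    have h1 : Function.update v j.1 0 = Pi.single j.1 1 + v := by
      funext a
      by_cases ha : a = j.1
      · subst ha; simp [hv]
      · simp [ha]
    rw [mutate_M, smul_mul_assoc, mul_assoc, ← zpow_add_one₀ hX, hv, h1]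
    simp [add_comm]
  have h0 := hS.frame.Λ_self hodd (S.vPos j)
  -- Replacing `vPos` by `vNeg + b^j` adds `-D_j` from `e_j` and `+D_j` from `vNeg`, whose entry at
  -- `j` is `-1`.
  have h2 : S.Λ (Pi.single j.1 1 + S.vNeg j) (S.vPos j) = S.Λ (Pi.single j.1 1) (S.vNeg j) := by
    have h3 := hS.frame.Λ_self hodd (S.vNeg j)
    rw [map_add, LinearMap.add_apply, vPos_eq, map_add, map_add, hS.Λ_col_right, hS.Λ_col_right,
      hS.vNeg_self, h3]
    simp
  refine mul_right_cancel₀ hX ?_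
  rw [exch, add_mul, hS.mutate_vPos, hS.mutate_vNeg, key _ (hS.vPos_self j),
    key _ (hS.vNeg_self j), h2, exch, mul_add, hS.frame.mul, hS.frame.mul, map_add,
    LinearMap.add_apply, h0, add_zero, add_comm]

omit hq [CharZero k] [NeZero ℓ] in
-- The second mutation uses `vNeg` where the first uses `vPos`, so on exponents the composite is the
-- identity only up to a multiple of `b^j`. The contributions of these multiples to `Λ` cancel.
theorem mutationMap_mutationMap (j : ex) (f : Fin N → ℤ) :
    S.mutationMap j ((S.mutate q j).mutationMap j f) = f - f j.1 • S.col j := by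
  have h1 : ((S.mutate q j).mutationMap j f) j.1 = -f j.1 := by
    rw [mutationMap_apply, hS.mutate_vPos]; simp [hS.vNeg_self]
  funext a
  rw [mutationMap_apply, h1, mutationMap_apply, hS.mutate_vPos, vPos_eq]
  by_cases ha : a = j.1
  · subst ha
    simp [hS.vNeg_self, col, hS.skew.diag]
  · simp [ha, sub_eq_add_neg]

omit hq [CharZero k] [NeZero ℓ] in
theorem mutate_mutate_Λ (j : ex) : ((S.mutate q j).mutate q j).Λ = S.Λ := by
  refine LinearMap.ext fun f => LinearMap.ext fun g => ?_
  change S.Λ (S.mutationMap j ((S.mutate q j).mutationMap j f))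
    (S.mutationMap j ((S.mutate q j).mutationMap j g)) = _
  rw [hS.mutationMap_mutationMap, hS.mutationMap_mutationMap]
  simp only [map_sub, LinearMap.sub_apply, Λ_zsmul_left, Λ_zsmul_right, hS.Λ_col,
    hS.Λ_col_right]
  have h : (f j.1 • S.col j) j.1 = 0 := by
    rw [Pi.smul_apply, show S.col j j.1 = 0 from hS.skew.diag j, smul_zero]
  rw [h]
  push_cast
  ring

include hodd in
theorem mutate_mutate (j : ex) : (S.mutate q j).mutate q j = S := by
  refine ext' ?_ (hS.mutate_mutate_Λ j) (mutateMatrix_mutateMatrix j S.B)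
  funext f
  have h0 : (Function.update f j.1 0 : Fin N → ℤ) j.1 = 0 := by simp
  have h1 : (S.mutate q j).Λ (Function.update f j.1 0) (f j.1 • (S.mutate q j).vPos j) =
      S.Λ (Function.update f j.1 0) (f j.1 • Pi.single j.1 1) := by
    change S.Λ (S.mutationMap j _) (S.mutationMap j _) = _
    have h2 : S.mutationMap j (Function.update f j.1 0) = Function.update f j.1 0 := by
      rw [mutationMap_apply, h0]; simp
    have h3 : S.mutationMap j ((S.mutate q j).vPos j) = Pi.single j.1 1 - S.col j := by
      have h4 : (S.mutate q j).vPos j = (S.mutate q j).mutationMap j (Pi.single j.1 1) := by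
        rw [mutationMap_apply]
        funext a
        by_cases ha : a = j.1
        · subst ha; simp
        · simp [ha]
      rw [h4, hS.mutationMap_mutationMap]; simp
    rw [h2, map_zsmul (S.mutationMap j), h3, map_zsmul, map_zsmul, map_sub, hS.Λ_col_right, h0]
    simp
  rw [mutate_M, hS.exch_mutate hq hodd, mutate_M_of_eq_zero S j h0, h1, ← hS.frame.M_zsmul hodd,
    ← hS.frame.M_add hq, update_add_single]

include hodd in
-- By involutivity `M(e_j)` is the exchange element of the new seed, a sum of two of its monomials.
-- Only negative powers of `M(e_j)` can leave the new torus.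
theorem M_mem_mutate (j : ex) {f : Fin N → ℤ} (hf : 0 ≤ f j.1) :
    S.M f ∈ (S.mutate q j).frameSpan k Set.univ := by
  have h0 : (Function.update f j.1 0 : Fin N → ℤ) j.1 = 0 := by simp
  obtain ⟨n, hn⟩ := Int.eq_ofNat_of_zero_le hf
  have hmul : ∀ a ∈ (S.mutate q j).frameSpan k Set.univ,
      ∀ b ∈ (S.mutate q j).frameSpan k Set.univ, a * b ∈ (S.mutate q j).frameSpan k Set.univ := by
    intro a ha b hb
    induction ha using frameSpan_induction with
    | mem f hf =>
      induction hb using frameSpan_induction with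
      | mem g hg =>
        rw [hS.mutate_mul hq hodd]
        exact Submodule.smul_mem _ _ (M_mem_frameSpan (Set.mem_univ _))
      | zero => simp
      | add a b _ _ ha hb => rw [mul_add]; exact add_mem ha hb
      | smul c a _ ha => rw [mul_smul_comm]; exact Submodule.smul_mem _ _ ha
    | zero => simp
    | add a b _ _ ha hb => rw [add_mul]; exact add_mem ha hb
    | smul c a _ ha => rw [smul_mul_assoc]; exact Submodule.smul_mem _ _ ha
  have h1 : S.M (Pi.single j.1 1) ^ n ∈ (S.mutate q j).frameSpan k Set.univ := by
    induction n generalizing f with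
    | zero => rw [pow_zero, ← (S.mutate q j).M_zero]; exact M_mem_frameSpan (Set.mem_univ _)
    | succ n ih =>
      rw [pow_succ]
      refine hmul _ (ih (f := Pi.single j.1 (n : ℤ)) (by simp) (by simp) (by simp)) _ ?_
      rw [← hS.exch_mutate hq hodd]
      exact add_mem (M_mem_frameSpan (Set.mem_univ _)) (M_mem_frameSpan (Set.mem_univ _))
  rw [← update_add_single f j.1, hS.frame.M_add hq, hS.frame.M_zsmul hodd, hn]
  refine Submodule.smul_mem _ _ (hmul _ ?_ _ (by exact_mod_cast h1))
  rw [← mutate_M_of_eq_zero (q := q) S j h0]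
  exact M_mem_frameSpan (Set.mem_univ _)

include hodd in
theorem exists_mul_pow_mem_mutate (j : ex) {a : F} (ha : a ∈ S.frameSpan k Set.univ) :
    ∃ n : ℕ, ∀ m ≥ n, a * S.M (ℓ • Pi.single j.1 1) ^ m ∈
      (S.mutate q j).frameSpan k Set.univ := by
  induction ha using frameSpan_induction with
  | mem f hf =>
    refine ⟨(f j.1).natAbs, fun m hm => ?_⟩
    rw [← hS.frame.M_nsmul hodd, smul_comm, hS.frame.M_mul_M_smul]
    refine hS.M_mem_mutate hq hodd j ?_
    have : 1 ≤ ℓ := NeZero.one_le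
    have h3 : (f + ℓ • m • (Pi.single j.1 1 : Fin N → ℤ)) j.1 = f j.1 + ℓ * m := by
      rw [Pi.add_apply, Pi.smul_apply, Pi.smul_apply, Pi.single_eq_same]
      simp
    rw [h3]
    have h2 : (m : ℤ) ≤ ℓ * m := by exact_mod_cast Nat.le_mul_of_pos_left m this
    omega
  | zero => exact ⟨0, by simp⟩
  | add a b _ _ ha hb =>
    obtain ⟨n1, h1⟩ := ha
    obtain ⟨n2, h2⟩ := hb
    refine ⟨max n1 n2, fun m hm => ?_⟩
    rw [add_mul]
    exact add_mem (h1 m (le_trans (le_max_left _ _) hm)) (h2 m (le_trans (le_max_right _ _) hm))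
  | smul c a _ ha =>
    obtain ⟨n, h⟩ := ha
    refine ⟨n, fun m hm => ?_⟩
    rw [smul_mul_assoc]
    exact Submodule.smul_mem _ _ (h m hm)

include hodd in
theorem mutate_fractions (j : ex) (z : F) :
    ∃ a ∈ Submodule.span k (Set.range (S.mutate q j).M),
    ∃ b ∈ Submodule.span k (Set.range (S.mutate q j).M), b ≠ 0 ∧ z = a * b⁻¹ := by
  obtain ⟨a, ha, b, hb, hb0, rfl⟩ := hS.frame.fractions z
  rw [← Set.image_univ] at ha hb
  obtain ⟨n1, h1⟩ := hS.exists_mul_pow_mem_mutate hq hodd j ha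
  obtain ⟨n2, h2⟩ := hS.exists_mul_pow_mem_mutate hq hodd j hb
  have hw := pow_ne_zero (max n1 n2) (hS.frame.M_ne_zero (ℓ • Pi.single j.1 1))
  rw [← Set.image_univ]
  refine ⟨_, h1 _ (le_max_left n1 n2), _, h2 _ (le_max_right n1 n2), mul_ne_zero hb0 hw, ?_⟩
  rw [mul_inv_rev, mul_assoc, ← mul_assoc _ _ b⁻¹, mul_inv_cancel₀ hw, one_mul]

omit hq [CharZero k] [NeZero ℓ] in
-- Read in the old lattice, the new columns arise from the old ones by an invertible integral change
-- of basis. Compatibility and full rank are both inherited through this formula.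
theorem mutationMap_col (j i : ex) : S.mutationMap j ((S.mutate q j).col i) =
    if i = j then -S.col j else S.col i + max (-S.B j.1 i) 0 • S.col j := by
  funext a
  rw [mutationMap_apply]
  split_ifs with hij
  · subst hij
    by_cases ha : a = i.1
    · subst ha
      simp [col, mutate_B, mutateMatrix_of_eq, hS.skew.diag]
    · simp [col, mutate_B, mutateMatrix_of_eq, hS.skew.diag, ha]
  · by_cases ha : a = j.1
    · subst ha
      simp [col, mutate_B, mutateMatrix_of_eq, hS.skew.diag, hS.vPos_self]
    · simp [col, mutate_B, mutateMatrix_of_eq, mutateMatrix_of_ne j S.B ha hij, ha,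
        S.vPos_apply j ha]
      ring

omit hq [CharZero k] [NeZero ℓ] in
theorem mutate_compatible (j : ex) (m : Fin N) (i : ex) :
    (S.mutate q j).Λ (fun a => (S.mutate q j).B a i) (Pi.single m 1) =
      if m = i.1 then (D i : ZMod ℓ) else 0 := by
  change S.Λ (S.mutationMap j ((S.mutate q j).col i)) (S.mutationMap j (Pi.single m 1)) = _
  have h1 : S.mutationMap j (Pi.single m 1) = if m = j.1 then S.vPos j else Pi.single m 1 := by
    rw [mutationMap_apply]
    funext a
    split_ifs with h
    · subst h
      by_cases ha : a = j.1
      · subst ha; simp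
      · simp [ha]
    · by_cases ha : a = j.1
      · subst ha; simp [Ne.symm h]
      · simp [ha, Ne.symm h]
  rw [hS.mutationMap_col, h1]
  by_cases hij : i = j
  · subst hij
    rw [if_pos rfl, map_neg, LinearMap.neg_apply, hS.Λ_col]
    split_ifs with h
    · simp [hS.vPos_self]
    · simp [Ne.symm h]
  · have hij' : i.1 ≠ j.1 := fun e => hij (Subtype.ext e)
    rw [if_neg hij, map_add, LinearMap.add_apply, map_zsmul, LinearMap.smul_apply, hS.Λ_col,
      hS.Λ_col]
    by_cases h : m = j.1
    · subst h
      rw [if_pos rfl, if_neg (Ne.symm hij'), hS.vPos_self, S.vPos_apply j hij', zsmul_eq_mul]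
      -- The remaining identity is `D_i max(b_ij, 0) = D_j max(-b_ji, 0)`, that is,
      -- skew-symmetrizability.
      have h2 := congrArg (Int.cast : ℤ → ZMod ℓ) (hS.skew.mul_max i j)
      push_cast at h2 ⊢
      linear_combination h2
    · rw [if_neg h]
      by_cases h' : m = i.1
      · subst h'; simp [Ne.symm h]
      · simp [Ne.symm h, h', Ne.symm h']

include hodd in
/-- Mutation preserves root of unity quantum seeds. -/
theorem mutate (j : ex) : (S.mutate q j).IsRootOfUnityQuantumSeed q D where
  frame :=
    { skew := fun f g => by rw [mutate_Λ, mutate_Λ]; exact hS.frame.skew _ _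
      mul := hS.mutate_mul hq hodd j
      linearIndependent := hS.mutate_linearIndependent hq j
      fractions := hS.mutate_fractions hq hodd j }
  pos := hS.pos
  skewSymmetrizable := (hS.skew.mutate j).2
  compatible := hS.mutate_compatible j

include hodd in
theorem mutateList (w : List ex) : (S.mutateList q w).IsRootOfUnityQuantumSeed q D := by
  induction w generalizing S with
  | nil => exact hS
  | cons j w ih => exact ih (hS.mutate hq hodd j)

include hodd in
theorem mutateList_reverse (w : List ex) : (S.mutateList q w).mutateList q w.reverse = S := by
  induction w generalizing S with
  | nil => rfl
  | cons j w ih =>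
    have h1 := ih (hS.mutate hq hodd j)
    simp only [QuantumSeed.mutateList, List.foldl_cons, List.reverse_cons, List.foldl_append,
      List.foldl_nil] at h1 ⊢
    rw [h1, hS.mutate_mutate hq hodd]

end IsRootOfUnityQuantumSeed

end QuantumSeed

/-! ### The quantum binomial formula at a root of unity -/

section QBinomial

open Polynomial

/-- The powers of `z` run through all `n`-th roots of unity, so this is the factorization of `1^n +
X^n`. For even `n` the sign of `X^n` would change. -/
theorem IsPrimitiveRoot.prod_one_add_C_mul_X {k : Type*} [Field k] {z : k} {n : ℕ}
    (hz : IsPrimitiveRoot z n) (hn : Odd n) :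
    ∏ i ∈ Finset.range n, (1 + C (z ^ i) * X) = (1 + X ^ n : k[X]) := by
  classical
  have hz' : IsPrimitiveRoot (C z) n := hz.map_of_injective (C_injective)
  have h0 : 0 < n := hn.pos
  have h1 := hz'.pow_add_pow_eq_prod_add_mul (1 : k[X]) X hn
  rw [one_pow] at h1
  have h2 : Polynomial.nthRootsFinset n (1 : k[X]) =
      (Finset.range n).image fun i => C z ^ i := by
    ext x
    rw [Polynomial.mem_nthRootsFinset h0, Finset.mem_image]
    constructor
    · intro hx
      have := NeZero.of_pos h0
      obtain ⟨i, hi, hix⟩ := hz'.eq_pow_of_pow_eq_one hx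
      exact ⟨i, Finset.mem_range.2 hi, hix⟩
    · rintro ⟨i, -, rfl⟩
      rw [← pow_mul, mul_comm, pow_mul, hz'.pow_eq_one, one_pow]
  rw [h1, h2, Finset.prod_image]
  · simp
  · intro a ha b hb hab
    exact hz'.pow_inj (by simpa using ha) (by simpa using hb) hab

theorem aeval_mul_of_mul_eq_smul {k R : Type*} [Field k] [Ring R] [Algebra k R] {a y : R} {z : k}
    (h : y * a = z • (a * y)) (p : k[X]) :
    aeval y p * a = a * aeval y (p.comp (C z * X)) := by
  induction p using Polynomial.induction_on' with
  | add p r hp hr => rw [map_add, add_mul, hp, hr, add_comp, map_add, mul_add]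
  | monomial n c =>
    have h1 : ∀ n : ℕ, y ^ n * a = z ^ n • (a * y ^ n) := by
      intro n
      induction n with
      | zero => simp
      | succ n ih =>
        rw [pow_succ, mul_assoc, h, mul_smul_comm, ← mul_assoc, ih, smul_mul_assoc, smul_smul,
          mul_assoc, ← pow_succ']
    rw [monomial_comp, mul_pow, ← C_pow, aeval_monomial, map_mul, map_mul, aeval_C, aeval_C,
      aeval_X_pow, mul_assoc, h1, ← Algebra.smul_def, ← Algebra.smul_def, ← Algebra.smul_def,
      mul_smul_comm, mul_smul_comm]

/-- Each `a` that is moved to the left past a polynomial in `y` replaces `y` by `z y` in it. -/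
theorem mul_one_add_pow_of_mul_eq_smul {k R : Type*} [Field k] [Ring R] [Algebra k R] {a y : R}
    {z : k} (h : y * a = z • (a * y)) (n : ℕ) :
    (a * (1 + y)) ^ n = a ^ n * aeval y (∏ i ∈ Finset.range n, (1 + C (z ^ i) * X)) := by
  induction n with
  | zero => simp
  | succ n ih =>
    rw [pow_succ, ih, ← mul_assoc, mul_assoc (a ^ n), aeval_mul_of_mul_eq_smul h, ← mul_assoc,
      ← pow_succ, Finset.prod_range_succ', map_mul, ← mul_assoc]
    congr 1
    · congr 2
      rw [Polynomial.prod_comp]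
      refine Finset.prod_congr rfl fun i _ => ?_
      simp only [add_comp, one_comp, mul_comp, C_comp, X_comp, pow_succ, C_mul]
      ring
    · simp

end QBinomial

/-! ### Coprime central elements and `ℓ`-th powers of exchange elements -/

namespace QuantumSeed

variable {ℓ N : ℕ} {ex : Finset (Fin N)} {F : Type u} [DivisionRing F]
variable {k : Type u} [Field k] [Algebra k F] {q : k} {S : QuantumSeed ℓ N ex F}

/-- The columns of the exchange matrix are linearly independent. -/
def FullRank (S : QuantumSeed ℓ N ex F) : Prop := ∀ v : ex → ℤ, ∑ j, v j • S.col j = 0 → v = 0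

/-- The positive and negative parts of `b^j` have disjoint supports, so one of the two monomials
does not involve the index `a`; it is called `w`. -/
theorem exists_exch_eq (S : QuantumSeed ℓ N ex F) (j : ex) {a : Fin N} (ha : a ≠ j.1) :
    ∃ w w' : Fin N → ℤ, S.exch j = S.M w + S.M w' ∧ w a = 0 ∧ w' a = |S.B a j| ∧
      ((w = S.vPos j ∧ w' = S.vNeg j ∧ S.B a j ≤ 0) ∨
        (w = S.vNeg j ∧ w' = S.vPos j ∧ 0 ≤ S.B a j)) := by
  rcases le_total (S.B a j) 0 with h | h
  · refine ⟨_, _, rfl, ?_, ?_, Or.inl ⟨rfl, rfl, h⟩⟩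
    · rw [S.vPos_apply j ha, max_eq_right h]
    · rw [S.vNeg_apply j ha, max_eq_left (by omega), abs_of_nonpos h]
  · refine ⟨_, _, add_comm _ _, ?_, ?_, Or.inr ⟨rfl, rfl, h⟩⟩
    · rw [S.vNeg_apply j ha, max_eq_right (by omega)]
    · rw [S.vPos_apply j ha, max_eq_left h, abs_of_nonneg h]

theorem exch_mem_nonneg (S : QuantumSeed ℓ N ex F) (j : ex) {a : Fin N} (ha : a ≠ j.1) :
    S.exch j ∈ S.frameSpan k {f | 0 ≤ f a} := by
  refine add_mem (M_mem_frameSpan ?_) (M_mem_frameSpan ?_)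
  · rw [Set.mem_ofPred_eq, S.vPos_apply j ha]; exact le_max_right _ _
  · rw [Set.mem_ofPred_eq, S.vNeg_apply j ha]; exact le_max_right _ _

theorem frameSpan_eq_linearCombination {z : F} (hz : z ∈ S.frameSpan k Set.univ) :
    ∃ c : (Fin N → ℤ) →₀ k, Finsupp.linearCombination k S.M c = z := by
  rw [frameSpan, Set.image_univ, ← Finsupp.range_linearCombination] at hz
  exact hz

namespace IsToricFrame

variable [NeZero ℓ] (h : S.IsToricFrame q)
include h

theorem linearCombination_mem_frameSpan_iff {P : Set (Fin N → ℤ)} {c : (Fin N → ℤ) →₀ k} :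
    Finsupp.linearCombination k S.M c ∈ S.frameSpan k P ↔ ∀ f ∈ c.support, f ∈ P := by
  constructor
  · intro hc f hf
    by_contra hfP
    have h1 := frameProj_eq_zero h.linearIndependent
      (Set.disjoint_singleton_left.2 hfP) hc
    rw [Finsupp.linearCombination_apply, Finsupp.sum, map_sum, Finset.sum_eq_single_of_mem f hf,
      map_smul, frameProj_M_of_mem _ (Set.mem_singleton _)] at h1
    · rcases smul_eq_zero.1 h1 with h2 | h2
      · exact Finsupp.mem_support_iff.1 hf h2
      · exact h.M_ne_zero _ h2
    · intro g _ hgf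
      rw [map_smul, frameProj_M_of_notMem _ (by simpa using hgf), smul_zero]
  · intro hc
    rw [Finsupp.linearCombination_apply]
    exact sum_mem fun f hf => Submodule.smul_mem _ _ (M_mem_frameSpan (hc f hf))

theorem mul_mem {a b : F} (ha : a ∈ S.frameSpan k Set.univ) (hb : b ∈ S.frameSpan k Set.univ) :
    a * b ∈ S.frameSpan k Set.univ :=
  h.mul_mem_frameSpan (fun _ _ _ _ => Set.mem_univ _) ha hb

theorem pow_mem {a : F} (ha : a ∈ S.frameSpan k Set.univ) (n : ℕ) :
    a ^ n ∈ S.frameSpan k Set.univ :=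
  h.pow_mem_frameSpan (Set.mem_univ _) (fun _ _ _ _ => Set.mem_univ _) ha n

/-- Two central binomials whose exponents are separated by a linear form are coprime in the
quantum torus. -/
theorem mem_of_mul_one_add_mem [CharZero k] (lam : (Fin N → ℤ) →+ ℤ) {b c : Fin N → ℤ}
    (hb : lam b = 0) (hc : lam c ≠ 0) {z : F}
    (h1 : z * (1 + S.M (ℓ • b)) ∈ S.frameSpan k Set.univ)
    (h2 : z * (1 + S.M (ℓ • c)) ∈ S.frameSpan k Set.univ) : z ∈ S.frameSpan k Set.univ := by
  have hℓ : (ℓ : ℤ) ≠ 0 := by exact_mod_cast NeZero.ne ℓ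
  -- Replacing `lam` by `-lam` changes the sign of the degree of `c` and keeps `lam b = 0`.
  wlog hpos : 0 < lam (ℓ • c) generalizing lam
  · refine this (-lam) (by simp [hb]) (by simpa using hc) ?_
    have h3 : lam (ℓ • c) ≠ 0 := by
      rw [map_nsmul, nsmul_eq_mul]; exact mul_ne_zero hℓ hc
    rw [AddMonoidHom.neg_apply]
    omega
  have hb0 : (1 + S.M (ℓ • b)) ≠ 0 := by
    intro h0
    by_cases hbz : ℓ • b = 0
    · rw [hbz, S.M_zero, one_add_one_eq_two] at h0
      have h3 : algebraMap k F 2 = 0 := by rw [map_ofNat]; exact h0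
      exact two_ne_zero ((map_eq_zero _).1 h3)
    · rw [← S.M_zero] at h0
      have h3 := congrArg (frameProj h.linearIndependent {0}) h0
      rw [map_add, map_zero, frameProj_M_of_mem _ (Set.mem_singleton (0 : Fin N → ℤ)),
        frameProj_M_of_notMem _ (fun e => hbz (Set.mem_singleton_iff.1 e)), add_zero] at h3
      exact h.M_ne_zero _ h3
  set s := z * (1 + S.M (ℓ • b)) with hs
  set t := z * (1 + S.M (ℓ • c)) with ht
  have hst : s + s * S.M (ℓ • c) = t * (1 + S.M (ℓ • b)) := by
    rw [hs, ht, mul_assoc, mul_assoc, ← mul_add]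
    congr 1
    simp only [mul_add, add_mul, mul_one, one_mul, (h.commute_M_smul b (S.M (ℓ • c))).eq]
    abel
  set W : Submodule k F :=
    (S.frameSpan k Set.univ).map (LinearMap.mulRight k (1 + S.M (ℓ • b))) with hW
  have hWmul : ∀ x ∈ W, x * S.M (ℓ • c) ∈ W := by
    rintro _ ⟨x, hx, rfl⟩
    refine ⟨x * S.M (ℓ • c), h.mul_mem hx (M_mem_frameSpan (Set.mem_univ _)), ?_⟩
    simp only [LinearMap.mulRight_apply]
    rw [mul_assoc, mul_assoc, (h.commute_M_smul c _).eq]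
  -- Degree `d` of the identity `s (1 + M(ℓc)) = t (1 + M(ℓb))`. As `M(ℓb)` has degree zero, it
  -- determines `s_d` modulo `W` from a component of `s` of smaller degree.
  have hcomp : ∀ d, comp h.linearIndependent lam d s +
      comp h.linearIndependent lam (d - lam (ℓ • c)) s * S.M (ℓ • c) =
      comp h.linearIndependent lam d t * (1 + S.M (ℓ • b)) := by
    intro d
    have e1 := congrArg (comp h.linearIndependent lam d) hst
    rw [map_add, h.comp_mul lam h1 (M_mem_frameSpan (f := ℓ • c) rfl), h.comp_mul lam
      (e := 0) h2 (add_mem (one_mem_frameSpan (by simp)) (M_mem_frameSpan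
      (by rw [Set.mem_ofPred_eq, map_nsmul, hb, smul_zero]))),
      sub_zero] at e1
    exact e1
  obtain ⟨m, hm⟩ := exists_comp_eq_zero_of_lt h.linearIndependent lam h1
  -- Induction upwards from the bound `m`, below which `s` has no components. Then `s` is a multiple
  -- of `1 + M(ℓb)` in the torus, and this factor can be cancelled.
  have key : ∀ n : ℕ, ∀ d < m + n, comp h.linearIndependent lam d s ∈ W := by
    intro n
    induction n with
    | zero =>
      intro d hd
      rw [hm d (by simpa using hd)]
      exact zero_mem _
    | succ n ih =>
      intro d hd
      rw [eq_sub_of_add_eq (hcomp d)]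
      refine sub_mem ⟨_, mem_frameSpan_univ (comp_mem h.linearIndependent lam d h2), rfl⟩
        (hWmul _ (ih _ ?_))
      push_cast at hd
      omega
  have hsW : s ∈ W := by
    refine mem_of_comp_mem h.linearIndependent lam h1 fun d => key (d - m + 1).toNat d ?_
    have := Int.self_le_toNat (d - m + 1)
    omega
  obtain ⟨x, hx, hxs⟩ := hsW
  rw [LinearMap.mulRight_apply, hs] at hxs
  rw [← mul_right_cancel₀ hb0 hxs]
  exact hx

/-- Coprimality of two central elements passes to their powers, by induction on one exponent and
then on the other. -/
theorem mem_of_mul_pow_mem {p r z : F} (hpc : ∀ x, Commute p x) (hrc : ∀ x, Commute r x)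
    (hp : p ∈ S.frameSpan k Set.univ) (hr : r ∈ S.frameSpan k Set.univ)
    (hcop : ∀ z, z * p ∈ S.frameSpan k Set.univ → z * r ∈ S.frameSpan k Set.univ →
      z ∈ S.frameSpan k Set.univ) {m n : ℕ} (h1 : z * p ^ m ∈ S.frameSpan k Set.univ)
    (h2 : z * r ^ n ∈ S.frameSpan k Set.univ) : z ∈ S.frameSpan k Set.univ := by
  have key : ∀ n z, z * p ∈ S.frameSpan k Set.univ → z * r ^ n ∈ S.frameSpan k Set.univ →
      z ∈ S.frameSpan k Set.univ := by
    intro n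
    induction n with
    | zero => intro z _ hz; simpa using hz
    | succ n ih =>
      intro z hz1 hz2
      refine hcop z hz1 (ih _ ?_ ?_)
      · rw [mul_assoc, (hrc p).eq, ← mul_assoc]; exact h.mul_mem hz1 hr
      · rwa [mul_assoc, ← pow_succ']
  induction m generalizing z with
  | zero => simpa using h1
  | succ m ih =>
    refine key n z (ih ?_ ?_) h2
    · rwa [mul_assoc, ← pow_succ']
    · rw [mul_assoc, (hpc (r ^ n)).eq, ← mul_assoc]; exact h.mul_mem h2 hp

end IsToricFrame

namespace IsRootOfUnityQuantumSeed

variable {D : ex → ℕ} (hS : S.IsRootOfUnityQuantumSeed q D) [NeZero ℓ]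
variable (hq : IsPrimitiveRoot q ℓ) (hodd : Odd ℓ)
include hS hq hodd

/-- Write the exchange element as `M(v)(1 + y)` with `y` a multiple of `M(-b^j)`. Compatibility
gives `y M(v) = q^(2 D_j) M(v) y`, and (Coprime) makes `q^(2 D_j)` primitive of order `ℓ`, so the
product `∏ (1 + z^i y)` collapses to `1 + y^ℓ`. -/
theorem exch_pow (hcop : ∀ i, Nat.Coprime ℓ (D i)) (j : ex) :
    S.exch j ^ ℓ = S.M (ℓ • S.vPos j) + S.M (ℓ • S.vNeg j) := by
  set c := S.Λ (S.vPos j) (-S.col j) with hc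
  set y := zmodPow q (-c) • S.M (-S.col j) with hy
  have hneg : S.vNeg j = S.vPos j + -S.col j := by rw [vPos_eq]; abel
  have h1 : S.exch j = S.M (S.vPos j) * (1 + y) := by
    rw [exch, hneg, hS.frame.M_add hq, mul_add, mul_one, hy, mul_smul_comm]
  have h2 : y * S.M (S.vPos j) =
      zmodPow q ((2 * D j : ℕ) : ZMod ℓ) • (S.M (S.vPos j) * y) := by
    rw [hy, smul_mul_assoc, hS.frame.M_mul_comm hq, mul_smul_comm, smul_comm]
    congr 2
    rw [map_neg, LinearMap.neg_apply, hS.Λ_col, hS.vPos_self]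
    push_cast
    ring
  have hz : IsPrimitiveRoot (zmodPow q ((2 * D j : ℕ) : ZMod ℓ)) ℓ := by
    rw [zmodPow_natCast hq.pow_eq_one]
    refine hq.pow_of_coprime _ (Nat.Coprime.mul_left (Nat.coprime_two_left.2 hodd) ?_)
    exact (hcop j).symm
  have h3 : y ^ ℓ = S.M (ℓ • -S.col j) := by
    rw [hy, smul_pow, ← zmodPow_natCast_mul hq.pow_eq_one, ZMod.natCast_self, zero_mul,
      zmodPow_zero, one_smul, hS.frame.M_nsmul hodd]
  rw [h1, mul_one_add_pow_of_mul_eq_smul h2, hz.prod_one_add_C_mul_X hodd, map_add, map_one,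
    map_pow, Polynomial.aeval_X, h3, mul_add, mul_one, ← hS.frame.M_nsmul hodd,
    hS.frame.M_mul_M_smul, hneg, smul_add]

theorem mutate_M_smul_single (hcop : ∀ i, Nat.Coprime ℓ (D i)) [CharZero k] (j : ex) :
    (S.mutate q j).M (ℓ • Pi.single j.1 1) = S.M (ℓ • S.vPos j) + S.M (ℓ • S.vNeg j) := by
  rw [(hS.mutate hq hodd j).frame.M_nsmul hodd, mutate_M_single, hS.exch_pow hq hodd hcop]

end IsRootOfUnityQuantumSeed

end QuantumSeed

/-! ### Full rank, and the effect of two successive mutations -/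

namespace QuantumSeed

variable {ℓ N : ℕ} {ex : Finset (Fin N)} {F : Type u} [DivisionRing F]
variable {k : Type u} [Field k] [Algebra k F] {q : k} {S : QuantumSeed ℓ N ex F}

theorem FullRank.mutate {D : ex → ℕ} (hS : S.IsRootOfUnityQuantumSeed q D) (h : S.FullRank)
    (j : ex) : (S.mutate q j).FullRank := by
  classical
  intro v hv
  have h1 := congrArg (S.mutationMap j) hv
  rw [map_sum, map_zero] at h1
  simp only [map_zsmul, hS.mutationMap_col] at h1
  -- The coefficients of the given relation after the new columns are expanded in the old ones by
  -- `mutationMap_col`: only the coefficient at `j` changes.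
  set w : ex → ℤ := Function.update v j (-v j + ∑ i ∈ Finset.univ.erase j,
    v i * max (-S.B j.1 i) 0) with hw
  have h2 : ∑ i, w i • S.col i = 0 := by
    rw [← h1, ← Finset.add_sum_erase _ _ (Finset.mem_univ j),
      ← Finset.add_sum_erase _ _ (Finset.mem_univ j), if_pos rfl]
    have h3 : ∀ i ∈ Finset.univ.erase j, w i • S.col i = v i • S.col i := by
      intro i hi
      rw [hw, Function.update_of_ne (Finset.ne_of_mem_erase hi)]
    have h4 : ∀ i ∈ Finset.univ.erase j,
        (v i • if i = j then -S.col j else S.col i + max (-S.B j.1 i) 0 • S.col j) =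
        v i • S.col i + (v i * max (-S.B j.1 i) 0) • S.col j := by
      intro i hi
      rw [if_neg (Finset.ne_of_mem_erase hi), smul_add, smul_smul]
    rw [Finset.sum_congr rfl h3, Finset.sum_congr rfl h4, Finset.sum_add_distrib,
      ← Finset.sum_smul, hw, Function.update_self, add_smul, neg_smul, smul_neg]
    abel
  have h5 := h w h2
  have h6 : ∀ i, i ≠ j → v i = 0 := by
    intro i hi
    have := congrFun h5 i
    rwa [hw, Function.update_of_ne hi] at this
  have h7 : v j = 0 := by
    have := congrFun h5 j
    rw [hw, Function.update_self, Finset.sum_eq_zero] at this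
    · simpa using this
    · intro i hi
      rw [h6 i (Finset.ne_of_mem_erase hi), zero_mul]
  funext i
  by_cases hi : i = j
  · rw [hi, h7]; rfl
  · exact h6 i hi

/-- The forms `x ↦ b_ai x_d - b_di x_a` kill `b^i`. If they all killed `b^j` as well, the `2 × 2`
minors would vanish, and each row `d` would give the linear relation `b_dj b^i - b_di b^j = 0`. -/
theorem FullRank.exists_separating (h : S.FullRank) {i j : ex} (hij : i ≠ j) :
    ∃ lam : (Fin N → ℤ) →+ ℤ, lam (S.col i) = 0 ∧ lam (S.col j) ≠ 0 := by
  classical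
  by_contra! hcon
  have h1 : ∀ a d, S.col i a * S.col j d = S.col i d * S.col j a := by
    intro a d
    have := hcon ((AddMonoidHom.mulLeft (S.col i a)).comp (deg d) -
      (AddMonoidHom.mulLeft (S.col i d)).comp (deg a)) (by simp; ring)
    simp at this
    linarith
  have key : ∀ v : ex → ℤ, (∀ m, m ≠ i → m ≠ j → v m = 0) →
      v i • S.col i + v j • S.col j = 0 → v = 0 := by
    intro v hv hv0
    refine h v ?_
    rw [← hv0, ← Finset.sum_pair (f := fun m => v m • S.col m) hij]
    refine (Finset.sum_subset (Finset.subset_univ _) fun m _ hm => ?_).symm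
    rw [hv m (fun e => hm (by simp [e])) (fun e => hm (by simp [e])), zero_smul]
  have hj0 : ∀ d, S.col j d = 0 := by
    intro d
    have := key (Function.update (Function.update 0 i (S.col j d)) j (-S.col i d))
      (fun m h1 h2 => by simp [h1, h2]) ?_
    · have := congrFun this i
      simpa [hij] using this
    · funext a
      simp [hij]
      linear_combination h1 a d
  have := congrFun (key (Pi.single j 1) (fun m _ h2 => by simp [h2]) (by
    funext a; simp [hij, hj0])) j
  simp at this

namespace IsRootOfUnityQuantumSeed

variable {D : ex → ℕ} (hS : S.IsRootOfUnityQuantumSeed q D)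

/-- Pairing a relation `∑ v_j b^j = 0` with `e_i` gives `v_i D_i = 0` modulo `ℓ`, so `ℓ` divides all
`v_i`. Dividing by `ℓ` yields another relation, and infinite descent finishes. Nothing of this
survives for `ℓ = 1`. -/
theorem fullRank (hS : S.IsRootOfUnityQuantumSeed q D) (hℓ : 1 < ℓ)
    (hcop : ∀ i, Nat.Coprime ℓ (D i)) : S.FullRank := by
  have hdvd : ∀ v : ex → ℤ, ∑ j, v j • S.col j = 0 → ∀ i, (ℓ : ℤ) ∣ v i := by
    intro v hv i
    have h1 : S.Λ (∑ j, v j • S.col j) (Pi.single i.1 1) = v i * D i := by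
      rw [map_sum, LinearMap.sum_apply, Finset.sum_eq_single i]
      · rw [Λ_zsmul_left, hS.Λ_col]; simp
      · intro j _ hj
        rw [Λ_zsmul_left, hS.Λ_col, Pi.single_eq_of_ne (fun e => hj (Subtype.ext e))]
        simp
      · simp
    rw [hv, map_zero, LinearMap.zero_apply] at h1
    have h2 : ((v i * D i : ℤ) : ZMod ℓ) = 0 := by push_cast; exact h1.symm
    rw [ZMod.intCast_zmod_eq_zero_iff_dvd] at h2
    exact IsCoprime.dvd_of_dvd_mul_right (Nat.isCoprime_iff_coprime.2 (hcop i)) h2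
  intro v hv
  have hpow : ∀ n : ℕ, ∀ v : ex → ℤ, ∑ j, v j • S.col j = 0 → ∀ i, (ℓ : ℤ) ^ n ∣ v i := by
    intro n
    induction n with
    | zero => simp
    | succ n ih =>
      intro v hv i
      choose w hw using hdvd v hv
      have h1 : ∑ j, w j • S.col j = 0 := by
        have h2 : (ℓ : ℤ) • ∑ j, w j • S.col j = 0 := by
          rw [Finset.smul_sum, ← hv]
          exact Finset.sum_congr rfl fun j _ => by rw [hw j, smul_smul]
        exact (smul_eq_zero.1 h2).resolve_left (by omega)
      obtain ⟨c, hc⟩ := ih w h1 i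
      exact ⟨c, by rw [hw i, hc, pow_succ']; ring⟩
  funext i
  by_contra hi
  have h1 := Int.le_of_dvd (abs_pos.2 hi) ((dvd_abs _ _).2 (hpow (v i).natAbs v hv i))
  have h2 : (v i).natAbs < ℓ ^ (v i).natAbs := Nat.lt_pow_self hℓ
  rw [Int.abs_eq_natAbs] at h1
  exact absurd h1 (not_le.2 (by exact_mod_cast h2))

variable [NeZero ℓ] [CharZero k] (hq : IsPrimitiveRoot q ℓ) (hodd : Odd ℓ)
include hS hq hodd

/-- For `f = a - vNeg` the sum is a scalar multiple of `M(f)` times the new variable; the scalars of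
the two terms agree because `f_j = 0`. -/
theorem M_add_M_add_col_mem (j : ex) {a : Fin N → ℤ} (ha : a j.1 = -1) :
    S.M a + S.M (a + S.col j) ∈ (S.mutate q j).frameSpan k Set.univ := by
  set f := a - S.vNeg j with hf
  have hf0 : f j.1 = 0 := by simp [hf, ha, hS.vNeg_self]
  have h1 : a = f + S.vNeg j := by simp [hf]
  have h2 : a + S.col j = f + S.vPos j := by rw [vPos_eq, hf]; abel
  rw [h2, h1, hS.frame.M_add hq, hS.frame.M_add hq, hS.Λ_vNeg_of_eq_zero j hf0, ← smul_add,
    ← mul_add, add_comm (S.M (S.vNeg j)), ← mutate_M_of_eq_zero (q := q) S j hf0]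
  refine Submodule.smul_mem _ _ ((hS.mutate hq hodd j).frame.mul_mem
    (M_mem_frameSpan (Set.mem_univ _)) ?_)
  have h3 := mutate_M_single (q := q) S j
  rw [exch] at h3
  rw [← h3]
  exact M_mem_frameSpan (Set.mem_univ _)

/-- An element of two adjacent quantum tori is a sum of an element which is polynomial in the
old variable and of an element which is polynomial in the new one. -/
theorem mem_sup_of_mem_mutate (j : ex) {z : F} (h1 : z ∈ S.frameSpan k Set.univ)
    (h2 : z ∈ (S.mutate q j).frameSpan k Set.univ) :
    z ∈ S.frameSpan k {f | 0 ≤ f j.1} ⊔ (S.mutate q j).frameSpan k {f | 0 ≤ f j.1} := by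
  classical
  refine mem_of_comp_mem hS.frame.linearIndependent (deg j.1) h1 fun d => ?_
  rcases le_or_gt 0 d with hd | hd
  · refine Submodule.mem_sup_left (frameSpan_mono ?_ (comp_mem hS.frame.linearIndependent _ d h1))
    rintro f ⟨-, hf⟩
    simp only [Set.mem_ofPred_eq, deg_apply] at hf ⊢
    omega
  · obtain ⟨c, rfl⟩ := frameSpan_eq_linearCombination h2
    rw [hS.comp_linearCombination_mutate hq j c h1]
    refine Submodule.mem_sup_right (sum_mem fun f hf => Submodule.smul_mem _ _ (M_mem_frameSpan ?_))
    have := (Finset.mem_filter.1 hf).2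
    simp only [Set.mem_ofPred_eq]
    omega

/-- Every term of the expanded power other than `M(w)^n` contains a factor `M(w')`, hence has
positive exponent at `a`. -/
theorem exch_pow_sub_mem (i : ex) {a : Fin N} (ha : a ≠ i.1) {w w' : Fin N → ℤ}
    (hw : S.exch i = S.M w + S.M w') (hw0 : w a = 0) (hw' : 0 < w' a) (n : ℕ) :
    S.exch i ^ n - S.M (n • w) ∈ S.frameSpan k {f | 1 ≤ f a} := by
  induction n with
  | zero => simp [S.M_zero]
  | succ n ih =>
    have h1 : S.exch i ^ (n + 1) - S.M ((n + 1) • w) =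
        (S.exch i ^ n - S.M (n • w)) * S.exch i + S.M (n • w) * S.M w' := by
      rw [hS.frame.M_nsmul hodd, hS.frame.M_nsmul hodd, pow_succ, sub_mul, pow_succ, hw, mul_add,
        mul_add]
      abel
    rw [h1]
    refine add_mem (hS.frame.mul_mem_frameSpan ?_ ih (S.exch_mem_nonneg i ha))
      (hS.frame.mul_mem_frameSpan (P := {n • w}) (Q := {w'}) ?_
        (M_mem_frameSpan rfl) (M_mem_frameSpan rfl))
    · intro f hf g hg
      simp only [Set.mem_ofPred_eq, Pi.add_apply] at hf hg ⊢
      omega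
    · rintro f hf g hg
      rw [Set.mem_singleton_iff] at hf hg
      rw [Set.mem_ofPred_eq, Pi.add_apply, hf, hg, Pi.smul_apply, hw0]
      simpa [Int.add_one_le_iff] using Int.add_one_le_iff.2 hw'

/-- A factor `M(w')` compensates the exponent `-1` of `f` at `a`. So modulo elements with
nonnegative exponent at `a`, only the pure power of `M(w)` matters. -/
theorem mutate_M_sub_mem (i : ex) {a : Fin N} (ha : a ≠ i.1) {w w' f : Fin N → ℤ}
    (hw : S.exch i = S.M w + S.M w') (hw0 : w a = 0) (hw' : 0 < w' a)
    (hwv : w = S.vPos i ∨ w = S.vNeg i) {n : ℕ} (hn : f i.1 = n) (hf : f a = -1) :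
    (S.mutate q i).M f - S.M (Function.update f i.1 0 + n • w) ∈
      S.frameSpan k {f | 0 ≤ f a} := by
  have h0 : (Function.update f i.1 0 : Fin N → ℤ) i.1 = 0 := by simp
  have h1 : S.Λ (Function.update f i.1 0) (f i.1 • S.vPos i) =
      S.Λ (Function.update f i.1 0) (n • w) := by
    rw [hn, natCast_zsmul, map_nsmul, map_nsmul]
    rcases hwv with rfl | rfl
    · rfl
    · rw [hS.Λ_vNeg_of_eq_zero i h0]
  rw [mutate_M, hS.frame.M_add hq, h1, ← smul_sub, ← mul_sub, hn, zpow_natCast]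
  refine Submodule.smul_mem _ _ (hS.frame.mul_mem_frameSpan (P := {Function.update f i.1 0})
    ?_ (M_mem_frameSpan rfl) (hS.exch_pow_sub_mem hq hodd i ha hw hw0 hw' n))
  intro g hg g' hg'
  rw [Set.mem_singleton_iff] at hg
  rw [Set.mem_ofPred_eq] at hg' ⊢
  rw [Pi.add_apply, hg, Function.update_of_ne ha, hf]
  omega

theorem mem_mutate_of_nonneg (j : ex) {z : F} (hz : z ∈ S.frameSpan k {f | 0 ≤ f j.1}) :
    z ∈ (S.mutate q j).frameSpan k Set.univ := by
  induction hz using frameSpan_induction with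
  | mem f hf => exact hS.M_mem_mutate hq hodd j hf
  | zero => exact zero_mem _
  | add a b _ _ ha hb => exact add_mem ha hb
  | smul c a _ ha => exact Submodule.smul_mem _ _ ha

/-- The new variable after two mutations is a Laurent polynomial in the cluster obtained by
the second mutation alone. -/
theorem exch_mutate_mem (i j : ex) (hij : i ≠ j) :
    (S.mutate q i).exch j ∈ (S.mutate q j).frameSpan k Set.univ := by
  have hSi := hS.mutate hq hodd i
  have hij' : j.1 ≠ i.1 := fun e => hij (Subtype.ext e.symm)
  have hBi : (S.mutate q i).B i.1 j = -S.B i.1 j := mutateMatrix_of_eq i S.B (Or.inl rfl)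
  have hB : ∀ a, a ≠ i.1 → (S.mutate q i).B a j =
      S.B a j + max (S.B a i) 0 * S.B i.1 j + S.B a i * max (-S.B i.1 j) 0 :=
    fun a ha => mutateMatrix_of_ne i S.B ha (Ne.symm hij)
  have hPi : (S.mutate q i).vPos j i.1 = max (-S.B i.1 j) 0 := by
    rw [vPos_apply _ _ (Ne.symm hij'), hBi]
  have hNi : (S.mutate q i).vNeg j i.1 = max (S.B i.1 j) 0 := by
    rw [vNeg_apply _ _ (Ne.symm hij'), hBi, neg_neg]
  have hPN : ∀ a, (S.mutate q i).vPos j a = (S.mutate q i).vNeg j a + (S.mutate q i).B a j :=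
    fun a => congrFun (vPos_eq (S.mutate q i) j) a
  have hNj := hSi.vNeg_self j
  have hPj := hSi.vPos_self j
  -- If `b_ij ≠ 0`, exactly one of the two monomials of the exchange element involves the variable
  -- mutated at `i`. Modulo elements already known to lie in the target torus it is one old
  -- monomial, which together with the other summand has the form `M(a) + M(a + b^j)`. If `b_ij =
  -- 0`, neither involves it and the sum has this form at once.
  rcases lt_trichotomy (S.B i.1 j) 0 with hb | hb | hb
  · have hb' : 0 < S.B j.1 i := (hS.skew.pos_iff j i).2 hb
    obtain ⟨n, hn⟩ := Int.eq_ofNat_of_zero_le (show 0 ≤ -S.B i.1 j by omega)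
    rw [max_eq_left (by omega), hn] at hPi
    rw [max_eq_right hb.le] at hNi
    have hw0 : S.vNeg i j.1 = 0 := by rw [vNeg_apply _ _ hij', max_eq_right (by omega)]
    have hw' : 0 < S.vPos i j.1 := by rw [vPos_apply _ _ hij', max_eq_left hb'.le]; exact hb'
    have h1 := hS.mutate_M_sub_mem hq hodd i hij' (add_comm _ _) hw0 hw' (Or.inr rfl) hPi hPj
    have h2 := hS.mem_mutate_of_nonneg hq hodd j h1
    have h3 : Function.update ((S.mutate q i).vPos j) i.1 0 + n • S.vNeg i =
        (S.mutate q i).vNeg j + S.col j := by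
      funext a
      by_cases ha : a = i.1
      · subst ha
        simp [hS.vNeg_self, hNi, col, ← hn]
      · rw [Pi.add_apply, Pi.add_apply, Function.update_of_ne ha, hPN, hB a ha, Pi.smul_apply,
          vNeg_apply _ _ ha, max_eq_left (a := -S.B i.1 j) (by omega), nsmul_eq_mul]
        have h5 : max (S.B a i) 0 = S.B a i + max (-S.B a i) 0 := by
          rcases le_total 0 (S.B a i) with h | h <;> simp [h]
        have h6 : (n : ℤ) = -S.B i.1 j := hn.symm
        rw [h5, col, h6]
        ring
    rw [h3] at h2
    have h4 := hS.M_add_M_add_col_mem hq hodd j hNj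
    have h5 := add_mem h2 h4
    rw [exch]
    rw [← mutate_M_of_eq_zero (q := q) S i hNi] at h5
    convert h5 using 1
    abel
  · have h1 : (S.mutate q i).vPos j i.1 = 0 := by rw [hPi, hb]; simp
    have h2 : (S.mutate q i).vNeg j i.1 = 0 := by rw [hNi, hb]; simp
    have h3 : (S.mutate q i).vPos j = (S.mutate q i).vNeg j + S.col j := by
      funext a
      by_cases ha : a = i.1
      · subst ha; rw [Pi.add_apply, h1, h2, col, hb, add_zero]
      · rw [hPN, hB a ha, hb, Pi.add_apply, col]; simp
    rw [exch, mutate_M_of_eq_zero S i h1, mutate_M_of_eq_zero S i h2, h3, add_comm]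
    exact hS.M_add_M_add_col_mem hq hodd j hNj
  · have hb' : S.B j.1 i < 0 := (hS.skew.pos_iff i j).1 hb
    obtain ⟨n, hn⟩ := Int.eq_ofNat_of_zero_le hb.le
    rw [max_eq_left hb.le, hn] at hNi
    rw [max_eq_right (by omega)] at hPi
    have hw0 : S.vPos i j.1 = 0 := by rw [vPos_apply _ _ hij', max_eq_right hb'.le]
    have hw' : 0 < S.vNeg i j.1 := by
      rw [vNeg_apply _ _ hij', max_eq_left (by omega)]; omega
    have h1 := hS.mutate_M_sub_mem hq hodd i hij' rfl hw0 hw' (Or.inl rfl) hNi hNj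
    have h2 := hS.mem_mutate_of_nonneg hq hodd j h1
    set g := Function.update ((S.mutate q i).vNeg j) i.1 0 + n • S.vPos i with hg
    have hgj : g j.1 = -1 := by
      rw [hg, Pi.add_apply, Function.update_of_ne hij', hNj, Pi.smul_apply, hw0]; simp
    have h3 : (S.mutate q i).vPos j = g + S.col j := by
      funext a
      by_cases ha : a = i.1
      · subst ha
        simp [hg, hS.vPos_self, hPi, col, hn]
      · rw [hg, Pi.add_apply, Pi.add_apply, Function.update_of_ne ha, hPN, hB a ha, Pi.smul_apply,
          vPos_apply _ _ ha, max_eq_right (a := -S.B i.1 j) (by omega), nsmul_eq_mul, col]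
        have h6 : (n : ℤ) = S.B i.1 j := hn.symm
        rw [h6]
        ring
    have h4 := hS.M_add_M_add_col_mem hq hodd j hgj
    have h5 := add_mem h2 h4
    rw [exch, mutate_M_of_eq_zero S i hPi, h3]
    convert h5 using 1
    abel

end IsRootOfUnityQuantumSeed

end QuantumSeed

/-! ### Upper bounds and the Laurent phenomenon in full rank -/

namespace QuantumSeed

variable {ℓ N : ℕ} {ex : Finset (Fin N)} {F : Type u} [DivisionRing F]
variable {k : Type u} [Field k] [Algebra k F] {q : k} {S : QuantumSeed ℓ N ex F}

variable (k) in
/-- The elements which are Laurent polynomials in the cluster of `S` and in all adjacent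
clusters. -/
noncomputable def upperBound (q : k) (S : QuantumSeed ℓ N ex F) : Submodule k F :=
  S.frameSpan k Set.univ ⊓ ⨅ j : ex, (S.mutate q j).frameSpan k Set.univ

theorem mem_upperBound {z : F} : z ∈ upperBound k q S ↔
    z ∈ S.frameSpan k Set.univ ∧ ∀ j, z ∈ (S.mutate q j).frameSpan k Set.univ := by
  simp [upperBound]

namespace IsRootOfUnityQuantumSeed

variable {D : ex → ℕ} (hS : S.IsRootOfUnityQuantumSeed q D)
variable [NeZero ℓ] [CharZero k] (hq : IsPrimitiveRoot q ℓ) (hodd : Odd ℓ)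
include hS hq hodd

theorem exch_mem_mutate_of_ne (i j : ex) (hij : i ≠ j) :
    S.exch i ∈ (S.mutate q j).frameSpan k Set.univ :=
  hS.mem_mutate_of_nonneg hq hodd j
    (S.exch_mem_nonneg i (fun e => hij (Subtype.ext e.symm)))

theorem mutate_M_mul_pow_mem (i j : ex) (hij : i ≠ j) {f : Fin N → ℤ} (hf : 0 ≤ f j.1) (n : ℕ)
    (hn : 0 ≤ f i.1 + n) :
    (S.mutate q i).M f * S.exch i ^ n ∈ (S.mutate q j).frameSpan k Set.univ := by
  obtain ⟨m, hm⟩ := Int.eq_ofNat_of_zero_le hn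
  have hij' : j.1 ≠ i.1 := fun e => hij (Subtype.ext e.symm)
  have hSj := (hS.mutate hq hodd j).frame
  rw [mutate_M, smul_mul_assoc, mul_assoc, ← zpow_natCast, ← zpow_add₀ (hS.exch_ne_zero i), hm,
    zpow_natCast]
  refine Submodule.smul_mem _ _ (hSj.mul_mem (hS.M_mem_mutate hq hodd j ?_)
    (hSj.pow_mem (hS.exch_mem_mutate_of_ne hq hodd i j hij) m))
  rwa [Function.update_of_ne hij']

/-- The summands are polynomial in the variable at `j` before, respectively after, the second
mutation, and both of these variables lie in the torus of `μ_j S`. What remains are negative powers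
of the variable mutated at `i`, which the central element `X_i^{ℓm}` clears. -/
theorem mul_exch_pow_mem (hcop : ∀ i, Nat.Coprime ℓ (D i)) (i j : ex) (hij : i ≠ j) {z : F}
    (hz : z ∈ (S.mutate q i).frameSpan k {f | 0 ≤ f j.1} ⊔
      ((S.mutate q i).mutate q j).frameSpan k {f | 0 ≤ f j.1}) :
    ∃ n : ℕ, ∀ m ≥ n, z * (S.exch i ^ ℓ) ^ m ∈ (S.mutate q j).frameSpan k Set.univ := by
  have hij' : j.1 ≠ i.1 := fun e => hij (Subtype.ext e.symm)
  have hSj := (hS.mutate hq hodd j).frame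
  have hle : ∀ m : ℕ, (m : ℤ) ≤ (ℓ * m : ℕ) := fun m => by
    exact_mod_cast Nat.le_mul_of_pos_left m NeZero.one_le
  have hcomm : ∀ m x, Commute ((S.exch i ^ ℓ) ^ m) x := by
    intro m x
    rw [hS.exch_pow hq hodd hcop]
    exact ((hS.frame.commute_M_smul _ x).add_left (hS.frame.commute_M_smul _ x)).pow_left m
  obtain ⟨a, ha, b, hb, rfl⟩ := Submodule.mem_sup.1 hz
  have h1 : ∃ n : ℕ, ∀ m ≥ n, a * (S.exch i ^ ℓ) ^ m ∈
      (S.mutate q j).frameSpan k Set.univ := by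
    clear hz
    induction ha using frameSpan_induction with
    | mem f hf =>
      refine ⟨(f i.1).natAbs, fun m hm => ?_⟩
      rw [← pow_mul]
      refine hS.mutate_M_mul_pow_mem hq hodd i j hij hf _ ?_
      have := hle m
      omega
    | zero => exact ⟨0, by simp⟩
    | add a b _ _ ha hb =>
      obtain ⟨n1, h1⟩ := ha
      obtain ⟨n2, h2⟩ := hb
      refine ⟨max n1 n2, fun m hm => ?_⟩
      rw [add_mul]
      exact add_mem (h1 m (le_trans (le_max_left _ _) hm)) (h2 m (le_trans (le_max_right _ _) hm))
    | smul c a _ ha =>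
      obtain ⟨n, h⟩ := ha
      refine ⟨n, fun m hm => ?_⟩
      rw [smul_mul_assoc]
      exact Submodule.smul_mem _ _ (h m hm)
  have h2 : ∃ n : ℕ, ∀ m ≥ n, b * (S.exch i ^ ℓ) ^ m ∈
      (S.mutate q j).frameSpan k Set.univ := by
    clear hz
    induction hb using frameSpan_induction with
    | mem f hf =>
      refine ⟨(f i.1).natAbs, fun m hm => ?_⟩
      obtain ⟨n, hn⟩ := Int.eq_ofNat_of_zero_le hf
      have h0 : (Function.update f j.1 0 : Fin N → ℤ) j.1 = 0 := by simp
      rw [mutate_M, smul_mul_assoc, mul_assoc, ← (hcomm m _).eq, ← mul_assoc, hn, zpow_natCast,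
        ← pow_mul]
      refine Submodule.smul_mem _ _ (hSj.mul_mem ?_
        (hSj.pow_mem (hS.exch_mutate_mem hq hodd i j hij) n))
      refine hS.mutate_M_mul_pow_mem hq hodd i j hij h0.ge _ ?_
      rw [Function.update_of_ne (Ne.symm hij')]
      have := hle m
      omega
    | zero => exact ⟨0, by simp⟩
    | add a b _ _ ha hb =>
      obtain ⟨n1, h1⟩ := ha
      obtain ⟨n2, h2⟩ := hb
      refine ⟨max n1 n2, fun m hm => ?_⟩
      rw [add_mul]
      exact add_mem (h1 m (le_trans (le_max_left _ _) hm)) (h2 m (le_trans (le_max_right _ _) hm))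
    | smul c a _ ha =>
      obtain ⟨n, h⟩ := ha
      refine ⟨n, fun m hm => ?_⟩
      rw [smul_mul_assoc]
      exact Submodule.smul_mem _ _ (h m hm)
  obtain ⟨n1, h1⟩ := h1
  obtain ⟨n2, h2⟩ := h2
  refine ⟨max n1 n2, fun m hm => ?_⟩
  rw [add_mul]
  exact add_mem (h1 m (le_trans (le_max_left _ _) hm)) (h2 m (le_trans (le_max_right _ _) hm))

/-- Up to a unit of the torus of `μ_j S`, `M(e_j)^ℓ` is the binomial `1 + M'(ℓ b^j)`. If `b_ji = 0`,
`X_i^ℓ` is likewise a binomial in `b^i`, and full rank separates the two directions. If `b_ji ≠ 0`,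
`X_i^ℓ` is congruent to a unit modulo `M(e_j)^ℓ`. -/
theorem coprime_exch (hcop : ∀ i, Nat.Coprime ℓ (D i)) (hfull : S.FullRank) (i j : ex)
    (hij : i ≠ j) {z : F} (h1 : z * S.exch i ^ ℓ ∈ (S.mutate q j).frameSpan k Set.univ)
    (h2 : z * S.M (ℓ • Pi.single j.1 1) ∈ (S.mutate q j).frameSpan k Set.univ) :
    z ∈ (S.mutate q j).frameSpan k Set.univ := by
  have hij' : j.1 ≠ i.1 := fun e => hij (Subtype.ext e.symm)
  have hSj' := hS.mutate hq hodd j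
  have hSj := hSj'.frame
  obtain ⟨w, w', hw, hw0, hw', hww⟩ := S.exists_exch_eq i hij'
  have hexch : S.exch i ^ ℓ = S.M (ℓ • w) + S.M (ℓ • w') := by
    rw [hS.exch_pow hq hodd hcop]
    rcases hww with ⟨rfl, rfl, -⟩ | ⟨rfl, rfl, -⟩
    · rfl
    · exact add_comm _ _
  have hunit : ∀ f g : Fin N → ℤ, z * S.M (ℓ • f) * S.M (ℓ • g) = z * S.M (ℓ • (f + g)) := by
    intro f g
    rw [mul_assoc, hS.frame.M_mul_M_smul, smul_add]
  rw [hexch] at h1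
  by_cases hb : S.B j.1 i = 0
  · -- both exchange polynomials live in the common part of the cluster
    have hb2 : S.B i.1 j = 0 := (hS.skew.eq_zero_iff i j).2 hb
    obtain ⟨lam, hl1, hl2⟩ := hfull.exists_separating hij
    have hcolj : ((S.mutate q j).col i) j.1 = 0 := by
      change mutateMatrix j S.B j.1 i = 0
      rw [mutateMatrix_of_eq j S.B (Or.inl rfl), hb, neg_zero]
    refine hSj.mem_of_mul_one_add_mem lam hl1 hl2 ?_ ?_
    · have hPj : (-S.vNeg i) j.1 = 0 := by
        rw [Pi.neg_apply, vNeg_apply _ _ hij', hb]; simp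
      have h3 : z * (1 + (S.mutate q j).M (ℓ • S.col i)) =
          z * (S.M (ℓ • w) + S.M (ℓ • w')) * (S.mutate q j).M (ℓ • -S.vNeg i) := by
        rw [mutate_M_of_eq_zero S j, mutate_M_of_eq_zero S j, mul_add, mul_add, add_mul, hunit,
          hunit, ← mul_add, ← mul_add]
        · congr 1
          rcases hww with ⟨rfl, rfl, -⟩ | ⟨rfl, rfl, -⟩
          · rw [vPos_eq, add_neg_cancel, smul_zero, S.M_zero, add_comm]
            congr 3
            abel
          · rw [vPos_eq, add_neg_cancel, smul_zero, S.M_zero]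
            congr 3
            abel
        · rw [Pi.smul_apply, hPj, smul_zero]
        · rw [Pi.smul_apply, col, hb, smul_zero]
      rw [h3]
      exact hSj.mul_mem h1 (M_mem_frameSpan (Set.mem_univ _))
    · have h4 : S.M (ℓ • Pi.single j.1 1) = (S.mutate q j).M (ℓ • S.vNeg j) +
          (S.mutate q j).M (ℓ • S.vPos j) := by
        have := hSj'.mutate_M_smul_single hq hodd hcop j
        rw [hS.mutate_mutate hq hodd, hS.mutate_vPos, hS.mutate_vNeg] at this
        exact this
      have h3 : z * (1 + (S.mutate q j).M (ℓ • S.col j)) =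
          z * S.M (ℓ • Pi.single j.1 1) * (S.mutate q j).M (ℓ • -S.vNeg j) := by
        rw [h4, mul_assoc, add_mul, hSj.M_mul_M_smul, hSj.M_mul_M_smul, ← smul_add, ← smul_add,
          vPos_eq, add_neg_cancel, smul_zero, M_zero]
        congr 4
        abel
      rw [h3]
      exact hSj.mul_mem h2 (M_mem_frameSpan (Set.mem_univ _))
  · -- one of the two exchange monomials is divisible by the variable at `j`
    have hmem : z * S.M (ℓ • w') ∈ (S.mutate q j).frameSpan k Set.univ := by
      have h3 : z * S.M (ℓ • w') = z * S.M (ℓ • Pi.single j.1 1) *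
          S.M (ℓ • (w' - Pi.single j.1 1)) := by
        rw [hunit]; congr 3; abel
      rw [h3]
      refine hSj.mul_mem h2 (hS.M_mem_mutate hq hodd j ?_)
      have h5 : 0 < |S.B j.1 i| := abs_pos.2 hb
      rw [Pi.smul_apply, Pi.sub_apply, hw', Pi.single_eq_same]
      exact nsmul_nonneg (by omega) _
    have hzw : z * S.M (ℓ • w) ∈ (S.mutate q j).frameSpan k Set.univ := by
      have := sub_mem h1 hmem
      rwa [mul_add, add_sub_cancel_right] at this
    have h3 : z = z * S.M (ℓ • w) * S.M (ℓ • -w) := by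
      rw [hunit, add_neg_cancel, smul_zero, S.M_zero, mul_one]
    rw [h3]
    refine hSj.mul_mem hzw (hS.M_mem_mutate hq hodd j ?_)
    rw [Pi.smul_apply, Pi.neg_apply, hw0]
    simp

/-- The rank two case of the invariance of the upper bound. -/
theorem mem_mutate_of_mem (hcop : ∀ i, Nat.Coprime ℓ (D i)) (hfull : S.FullRank) (i j : ex)
    (hij : i ≠ j) {z : F} (h1 : z ∈ S.frameSpan k Set.univ)
    (h2 : z ∈ (S.mutate q i).frameSpan k Set.univ)
    (h3 : z ∈ ((S.mutate q i).mutate q j).frameSpan k Set.univ) :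
    z ∈ (S.mutate q j).frameSpan k Set.univ := by
  have hSi := hS.mutate hq hodd i
  have hSj := (hS.mutate hq hodd j).frame
  -- The last two hypotheses bound the denominator of `z` by a power of `X_i^ℓ`, the first one by a
  -- power of `M(e_j)^ℓ`; these are coprime.
  obtain ⟨m, hm⟩ := hS.mul_exch_pow_mem hq hodd hcop i j hij
    (hSi.mem_sup_of_mem_mutate hq hodd j h2 h3)
  obtain ⟨n, hn⟩ := hS.exists_mul_pow_mem_mutate hq hodd j h1
  refine hSj.mem_of_mul_pow_mem (p := S.exch i ^ ℓ) (r := S.M (ℓ • Pi.single j.1 1)) ?_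
    (hS.frame.commute_M_smul _) ?_ ?_ ?_ (hm m le_rfl) (hn n le_rfl)
  · intro x
    rw [hS.exch_pow hq hodd hcop]
    exact (hS.frame.commute_M_smul _ x).add_left (hS.frame.commute_M_smul _ x)
  · exact hSj.pow_mem (hS.exch_mem_mutate_of_ne hq hodd i j hij) ℓ
  · refine hS.M_mem_mutate hq hodd j ?_
    rw [Pi.smul_apply, Pi.single_eq_same]
    exact nsmul_nonneg zero_le_one _
  · intro z hz1 hz2
    exact hS.coprime_exch hq hodd hcop hfull i j hij hz1 hz2

/-- The rank two statement is applied to `μ_i S` in the role of `S`: mutating it back at `i` gives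
`S`, and then at `j` gives `μ_j S`. -/
theorem upperBound_le_mutate (hcop : ∀ i, Nat.Coprime ℓ (D i)) (hfull : S.FullRank) (i : ex) :
    upperBound k q S ≤ upperBound k q (S.mutate q i) := by
  intro z hz
  rw [mem_upperBound] at hz ⊢
  refine ⟨hz.2 i, fun j => ?_⟩
  by_cases hij : i = j
  · subst hij
    rw [hS.mutate_mutate hq hodd]
    exact hz.1
  · refine (hS.mutate hq hodd i).mem_mutate_of_mem hq hodd hcop (hfull.mutate hS i) i j hij
      (hz.2 i) ?_ ?_
    · rw [hS.mutate_mutate hq hodd]; exact hz.1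
    · rw [hS.mutate_mutate hq hodd]; exact hz.2 j

/-- The Laurent phenomenon for seeds of full rank. -/
theorem laurent_of_fullRank (hcop : ∀ i, Nat.Coprime ℓ (D i)) (hfull : S.FullRank)
    (w : List ex) (a : Fin N) :
    S.M (Pi.single a 1) ∈ (S.mutateList q w).frameSpan k Set.univ := by
  have h1 : S.M (Pi.single a 1) ∈ upperBound k q S := by
    rw [mem_upperBound]
    refine ⟨M_mem_frameSpan (Set.mem_univ _), fun j => hS.M_mem_mutate hq hodd j ?_⟩
    by_cases h : j.1 = a <;> simp [h]
  generalize S.M (Pi.single a 1) = z at h1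
  induction w generalizing S with
  | nil => exact (mem_upperBound.1 h1).1
  | cons j w ih =>
    exact ih (hS.mutate hq hodd j) (hfull.mutate hS j)
      (hS.upperBound_le_mutate hq hodd hcop hfull j h1)

omit hq hodd in
-- The part of the exchange element of degree zero at `a` is nonzero. Hence a lowest component of
-- `z` of negative degree at `a` would survive in the product.
theorem mem_nonneg_of_mul_exch_mem (j : ex) {a : Fin N} (ha : a ≠ j.1) {z : F}
    (hz : z ∈ S.frameSpan k Set.univ) (h1 : z * S.exch j ∈ S.frameSpan k {f | 0 ≤ f a}) :
    z ∈ S.frameSpan k {f | 0 ≤ f a} := by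
  obtain ⟨w, w', hw, hw0, hw', -⟩ := S.exists_exch_eq j ha
  have hX := hS.exch_ne_zero j
  have hli := hS.frame.linearIndependent
  have hcomp : ∀ d < 0, comp hli (deg a) d z * S.M w +
      comp hli (deg a) (d - |S.B a j|) z * S.M w' = 0 := by
    intro d hd
    have e1 := hS.frame.comp_mul (deg a) hz (M_mem_frameSpan (f := w) hw0) d
    have e2 := hS.frame.comp_mul (deg a) hz (M_mem_frameSpan (f := w') hw') d
    rw [sub_zero] at e1
    rw [← e1, ← e2, ← map_add, ← mul_add, ← hw]
    refine frameProj_eq_zero hli ?_ h1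
    rw [Set.disjoint_left]
    intro f hf hf'
    simp only [Set.mem_ofPred_eq, deg_apply] at hf hf'
    omega
  obtain ⟨m, hm⟩ := exists_comp_eq_zero_of_lt hli (deg a) hz
  have key : ∀ n : ℕ, ∀ d < 0, d < m + n → comp hli (deg a) d z = 0 := by
    intro n
    induction n with
    | zero => intro d _ hd; exact hm d (by simpa using hd)
    | succ n ih =>
      intro d hd0 hd
      have h2 := hcomp d hd0
      by_cases hb : |S.B a j| = 0
      · rw [hb, sub_zero, ← mul_add, ← hw] at h2
        exact (mul_eq_zero.1 h2).resolve_right hX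
      · have h3 : 0 < |S.B a j| := lt_of_le_of_ne (abs_nonneg _) (Ne.symm hb)
        push_cast at hd
        rw [ih (d - |S.B a j|) (by omega) (by omega), zero_mul, add_zero] at h2
        exact (mul_eq_zero.1 h2).resolve_right (hS.frame.M_ne_zero _)
  refine mem_of_comp_mem hli (deg a) hz fun d => ?_
  rcases lt_or_ge d 0 with hd | hd
  · rw [key (d - m + 1).toNat d hd (by have := Int.self_le_toNat (d - m + 1); omega)]
    exact zero_mem _
  · refine frameSpan_mono ?_ (comp_mem hli (deg a) d hz)
    rintro f ⟨-, hf⟩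
    simp only [Set.mem_ofPred_eq, deg_apply] at hf ⊢
    omega

omit hodd in
theorem mem_mutate_nonneg (j : ex) {a : Fin N} (ha : a ≠ j.1) {c : (Fin N → ℤ) →₀ k}
    (hz : Finsupp.linearCombination k (S.mutate q j).M c ∈ S.frameSpan k {f | 0 ≤ f a}) :
    ∀ f ∈ c.support, 0 ≤ f a := by
  classical
  intro f hf
  have hli := hS.frame.linearIndependent
  have h1 := hS.comp_linearCombination_mutate hq j c (mem_frameSpan_univ hz) (-f j.1)
  rw [neg_neg] at h1
  set W := ∑ g ∈ c.support with g j.1 = f j.1,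
      (c g * zmodPow q (-S.Λ (Function.update g j.1 0) (g j.1 • S.vPos j))) •
        S.M (Function.update g j.1 0) with hW
  have h2 : comp hli (deg j.1) (-f j.1) (Finsupp.linearCombination k (S.mutate q j).M c) =
      W * S.exch j ^ f j.1 := by
    rw [h1, hW, Finset.sum_mul]
    refine Finset.sum_congr rfl fun g hg => ?_
    rw [mutate_M, ← smul_smul, smul_mul_assoc, smul_mul_assoc, (Finset.mem_filter.1 hg).2]
  have h3 : W * S.exch j ^ f j.1 ∈ S.frameSpan k {f | 0 ≤ f a} := by
    rw [← h2]; exact frameProj_mem_right hli hz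
  have hWT : W ∈ S.frameSpan k Set.univ :=
    sum_mem fun g _ => Submodule.smul_mem _ _ (M_mem_frameSpan (Set.mem_univ _))
  have hexch : S.exch j ∈ S.frameSpan k {f | 0 ≤ f a} := S.exch_mem_nonneg j ha
  have hadd : ∀ f ∈ {f : Fin N → ℤ | 0 ≤ f a}, ∀ g ∈ {f : Fin N → ℤ | 0 ≤ f a},
      f + g ∈ {f : Fin N → ℤ | 0 ≤ f a} := by
    intro f hf g hg
    simp only [Set.mem_ofPred_eq, Pi.add_apply] at hf hg ⊢
    omega
  have hX := hS.exch_ne_zero j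
  -- The power `X^{f_j}` is removed one factor at a time by the preceding divisibility statement if
  -- `f_j ≥ 0`, and by multiplication if `f_j ≤ 0`.
  have h4 : W ∈ S.frameSpan k {f | 0 ≤ f a} := by
    obtain ⟨n, hn | hn⟩ := (f j.1).eq_nat_or_neg
    · rw [hn, zpow_natCast] at h3
      clear_value W
      clear h2 hn hW
      induction n with
      | zero => simpa using h3
      | succ n ih =>
        refine ih (hS.mem_nonneg_of_mul_exch_mem j ha ?_ ?_)
        · exact hS.frame.mul_mem hWT (hS.frame.pow_mem (mem_frameSpan_univ hexch) n)
        · rwa [mul_assoc, ← pow_succ]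
    · have h5 : W = W * S.exch j ^ f j.1 * S.exch j ^ n := by
        rw [hn, mul_assoc, zpow_neg, zpow_natCast, inv_mul_cancel₀ (pow_ne_zero n hX), mul_one]
      rw [h5]
      exact hS.frame.mul_mem_frameSpan hadd h3
        (hS.frame.pow_mem_frameSpan (by simp) hadd hexch n)
  by_contra hfa
  have h5 := frameProj_eq_zero hli (P := {Function.update f j.1 0}) (by
    rw [Set.disjoint_singleton_left, Set.mem_ofPred_eq, Function.update_of_ne ha]
    exact hfa) h4
  rw [hW, map_sum, Finset.sum_eq_single f] at h5
  · rw [map_smul, frameProj_M_of_mem _ (Set.mem_singleton _)] at h5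
    rcases smul_eq_zero.1 h5 with h6 | h6
    · exact mul_ne_zero (Finsupp.mem_support_iff.1 hf) (zmodPow_ne_zero hq.pow_eq_one _) h6
    · exact hS.frame.M_ne_zero _ h6
  · intro g hg hgf
    rw [map_smul, frameProj_M_of_notMem, smul_zero]
    intro h4
    rw [Set.mem_singleton_iff] at h4
    apply hgf
    rw [← update_add_single g j.1, ← update_add_single f j.1, h4, (Finset.mem_filter.1 hg).2]
  · intro hf'
    refine absurd (Finset.mem_filter.2 ⟨hf, ?_⟩) hf'
    rfl

/-- Nonnegativity of the exponents of the frozen variables is preserved by mutation. -/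
theorem mem_mutate_of_nonneg_frozen (j : ex) {A : Set (Fin N)} (hA : j.1 ∉ A) {z : F}
    (h1 : z ∈ S.frameSpan k {f | ∀ a ∈ A, 0 ≤ f a})
    (h2 : z ∈ (S.mutate q j).frameSpan k Set.univ) :
    z ∈ (S.mutate q j).frameSpan k {f | ∀ a ∈ A, 0 ≤ f a} := by
  obtain ⟨c, rfl⟩ := frameSpan_eq_linearCombination h2
  rw [(hS.mutate hq hodd j).frame.linearCombination_mem_frameSpan_iff]
  intro f hf a ha
  exact hS.mem_mutate_nonneg hq j (fun e => hA (e ▸ ha))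
    (frameSpan_mono (fun f (hf : ∀ a ∈ A, 0 ≤ f a) => hf a ha) h1) f hf

end IsRootOfUnityQuantumSeed

end QuantumSeed

/-! ### Comparison with classical seeds -/

namespace QuantumSeed

variable {ℓ N : ℕ} {ex : Finset (Fin N)} {F : Type u} [DivisionRing F]
variable {k : Type u} [Field k] [Algebra k F] {q : k} {S : QuantumSeed ℓ N ex F}

theorem mutateList_append (S : QuantumSeed ℓ N ex F) (w w' : List ex) :
    S.mutateList q (w ++ w') = (S.mutateList q w).mutateList q w' :=
  List.foldl_append

/-- The homomorphism `Ψ` maps the cluster of a classical seed to the `ℓ`-th powers of the cluster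
variables of a quantum seed with the same exchange matrix. -/
structure Intertwines {K : Type u} [Field K] [Algebra k K] (Ψ : K →ₐ[k] F)
    (s : ClusterSeed N ex K) (S : QuantumSeed ℓ N ex F) : Prop where
  B_eq : s.B = S.B
  map_x : ∀ i, Ψ (s.x i) = S.M (ℓ • Pi.single i 1)

namespace IsToricFrame

variable [NeZero ℓ] (h : S.IsToricFrame q)
include h

theorem map_prod_pow {K : Type u} [Field K] [Algebra k K] (Ψ : K →ₐ[k] F) {x : Fin N → K}
    (hx : ∀ i, Ψ (x i) = S.M (ℓ • Pi.single i 1)) (hodd : Odd ℓ) (n : Fin N → ℕ) :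
    Ψ (∏ i, x i ^ n i) = S.M (ℓ • fun i => (n i : ℤ)) := by
  classical
  have key : ∀ s : Finset (Fin N), Ψ (∏ i ∈ s, x i ^ n i) =
      S.M (ℓ • ∑ i ∈ s, n i • Pi.single i 1) := by
    intro s
    induction s using Finset.induction_on with
    | empty => simp [S.M_zero]
    | insert i s hi ih =>
      rw [Finset.prod_insert hi, map_mul, ih, map_pow, hx, ← h.M_nsmul hodd, h.M_mul_M_smul,
        Finset.sum_insert hi, smul_add, smul_comm]
  rw [key]
  congr 2
  funext a
  simp [Finset.sum_apply, Pi.single_apply]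

end IsToricFrame

/-- By `exch_pow` the `ℓ`-th power of the new variable is the sum of the `ℓ`-th powers of the two
exchange monomials, which is the classical exchange relation among `ℓ`-th powers. -/
theorem Intertwines.mutate {K : Type u} [Field K] [Algebra k K] {Ψ : K →ₐ[k] F}
    {s : ClusterSeed N ex K} (h : Intertwines Ψ s S) {D : ex → ℕ}
    (hS : S.IsRootOfUnityQuantumSeed q D) [NeZero ℓ] [CharZero k] (hq : IsPrimitiveRoot q ℓ)
    (hodd : Odd ℓ) (hcop : ∀ i, Nat.Coprime ℓ (D i)) (j : ex) :
    Intertwines Ψ (s.mutate j) (S.mutate q j) where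
  B_eq := by
    change mutateMatrix j s.B = mutateMatrix j S.B
    rw [h.B_eq]
  map_x := by
    intro i
    by_cases hi : i = j.1
    · subst hi
      have h1 : ∀ n : Fin N → ℕ, S.M (ℓ • fun i => (n i : ℤ)) / S.M (ℓ • Pi.single j.1 1) =
          S.M (ℓ • (-Pi.single j.1 1 + fun i => (n i : ℤ))) := by
        intro n
        rw [div_eq_mul_inv, ← hS.frame.M_neg hodd, ← smul_neg, hS.frame.M_mul_M_smul, ← smul_add,
          add_comm]
      rw [hS.mutate_M_smul_single hq hodd hcop, ClusterSeed.mutate]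
      dsimp only
      rw [Function.update_self, map_div₀, map_add, hS.frame.map_prod_pow Ψ h.map_x hodd,
        hS.frame.map_prod_pow Ψ h.map_x hodd, h.map_x, add_div, h1, h1, h.B_eq]
      congr 3
      · simp only [Int.toNat_eq_max]; rfl
      · simp only [Int.toNat_eq_max]; rfl
    · rw [mutate_M_of_eq_zero S j (by simp [Ne.symm hi]), ← h.map_x]
      simp [ClusterSeed.mutate, hi]

theorem Intertwines.mutateList {K : Type u} [Field K] [Algebra k K] {Ψ : K →ₐ[k] F}
    {s : ClusterSeed N ex K} (h : Intertwines Ψ s S) {D : ex → ℕ}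
    (hS : S.IsRootOfUnityQuantumSeed q D) [NeZero ℓ] [CharZero k] (hq : IsPrimitiveRoot q ℓ)
    (hodd : Odd ℓ) (hcop : ∀ i, Nat.Coprime ℓ (D i)) (w : List ex) :
    Intertwines Ψ (s.mutateList w) (S.mutateList q w) := by
  induction w generalizing s S with
  | nil => exact h
  | cons j w ih => exact ih (h.mutate hS hq hodd hcop j) (hS.mutate hq hodd j)

section ClusterHom

variable [NeZero ℓ] (h : S.IsToricFrame q)

/-- The homomorphism from polynomials to the centre which maps the `i`-th variable to
`M(e_i)^ℓ`. -/
noncomputable def polyHom : MvPolynomial (Fin N) k →ₐ[k] Subalgebra.center k F :=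
  MvPolynomial.aeval fun i => ⟨S.M (ℓ • Pi.single i 1), h.M_smul_mem_center _⟩

theorem polyHom_eq_sum (hodd : Odd ℓ) (p : MvPolynomial (Fin N) k) :
    (polyHom h p : F) = ∑ d ∈ p.support, p.coeff d • S.M (ℓ • fun i => (d i : ℤ)) := by
  rw [polyHom, MvPolynomial.aeval_def, MvPolynomial.eval₂_eq', AddSubmonoidClass.coe_finsetSum]
  refine Finset.sum_congr rfl fun d _ => ?_
  rw [← Algebra.smul_def, Subalgebra.coe_smul]
  congr 1
  have key : ∀ s : Finset (Fin N),
      ((∏ i ∈ s, (⟨S.M (ℓ • Pi.single i 1), h.M_smul_mem_center _⟩ :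
        Subalgebra.center k F) ^ d i : Subalgebra.center k F) : F) =
      S.M (ℓ • ∑ i ∈ s, d i • Pi.single i 1) := by
    classical
    intro s
    induction s using Finset.induction_on with
    | empty => simp [S.M_zero]
    | insert i s hi ih =>
      rw [Finset.prod_insert hi, Subalgebra.coe_mul, ih, Subalgebra.coe_pow,
        ← h.M_nsmul hodd, h.M_mul_M_smul, Finset.sum_insert hi, smul_add, smul_comm]
  rw [key]
  congr 2
  funext a
  simp [Finset.sum_apply, Pi.single_apply]

theorem polyHom_injective (hodd : Odd ℓ) : Function.Injective (polyHom h) := by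
  rw [injective_iff_map_eq_zero]
  intro p hp
  have h1 := polyHom_eq_sum h hodd p
  rw [hp] at h1
  have hinj : Function.Injective fun d : Fin N →₀ ℕ => (ℓ • fun i => (d i : ℤ) : Fin N → ℤ) := by
    intro d e hde
    ext i
    have h2 := congrFun hde i
    have h3 : (ℓ : ℤ) ≠ 0 := by exact_mod_cast NeZero.ne ℓ
    simp only [Pi.smul_apply, nsmul_eq_mul] at h2
    exact_mod_cast mul_left_cancel₀ h3 h2
  have h2 := linearIndependent_iff'.1 (h.linearIndependent.comp _ hinj) p.support
    (fun d => p.coeff d) h1.symm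
  ext d
  by_cases hd : d ∈ p.support
  · simpa using h2 d hd
  · simpa using hd

theorem isUnit_of_mem_center {z : Subalgebra.center k F} (hz : z ≠ 0) : IsUnit z := by
  have hz' : (z : F) ≠ 0 := fun e => hz (Subtype.ext e)
  have h1 : (z : F)⁻¹ ∈ Subalgebra.center k F :=
    Subalgebra.mem_center_iff.2 fun b =>
      (Commute.inv_right₀ (Subalgebra.mem_center_iff.1 z.2 b)).eq
  exact IsUnit.of_mul_eq_one ⟨_, h1⟩ (Subtype.ext (mul_inv_cancel₀ hz'))

/-- The homomorphism from the field of rational functions to the centre which maps the `i`-th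
variable to `M(e_i)^ℓ`. -/
noncomputable def centerHom (hodd : Odd ℓ) : ClusterField k N →ₐ[k] Subalgebra.center k F :=
  IsLocalization.liftAlgHom (M := nonZeroDivisors (MvPolynomial (Fin N) k)) (f := polyHom h)
    fun y => isUnit_of_mem_center fun e => nonZeroDivisors.ne_zero y.2
      (polyHom_injective h hodd (by rw [e, map_zero]))

theorem centerHom_algebraMap (hodd : Odd ℓ) (p : MvPolynomial (Fin N) k) :
    centerHom h hodd (algebraMap _ (ClusterField k N) p) = polyHom h p := by
  rw [centerHom, IsLocalization.liftAlgHom_apply, IsLocalization.lift_eq]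
  rfl

theorem centerHom_injective (hodd : Odd ℓ) : Function.Injective (centerHom h hodd) :=
  (centerHom h hodd).toRingHom.injective

/-- The composition of `centerHom` with the inclusion of the centre. -/
noncomputable def clusterHom (hodd : Odd ℓ) : ClusterField k N →ₐ[k] F :=
  (Subalgebra.center k F).val.comp (centerHom h hodd)

theorem intertwines_clusterHom (hodd : Odd ℓ) :
    Intertwines (clusterHom h hodd) (initialSeed k S.B) S where
  B_eq := rfl
  map_x := by
    intro i
    change ((centerHom h hodd (algebraMap _ (ClusterField k N) (MvPolynomial.X i)) :
      Subalgebra.center k F) : F) = _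
    rw [centerHom_algebraMap, polyHom, MvPolynomial.aeval_X]

/-- The exponents which are divisible by `ℓ`. -/
def multiples (ℓ N : ℕ) : Set (Fin N → ℤ) := Set.range fun f : Fin N → ℤ => ℓ • f

theorem clusterHom_algebraMap_mem (hodd : Odd ℓ) (p : MvPolynomial (Fin N) k) :
    clusterHom h hodd (algebraMap _ (ClusterField k N) p) ∈
      S.frameSpan k (multiples ℓ N) := by
  change ((centerHom h hodd _ : Subalgebra.center k F) : F) ∈ _
  rw [centerHom_algebraMap, polyHom_eq_sum h hodd]
  exact sum_mem fun d _ => Submodule.smul_mem _ _ (M_mem_frameSpan ⟨_, rfl⟩)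

/-- The elements of the quantum torus which are rational functions of the `ℓ`-th powers of the
cluster variables are Laurent polynomials in these powers. -/
theorem clusterHom_mem_multiples (hodd : Odd ℓ) {P : Set (Fin N → ℤ)} {x : ClusterField k N}
    (hx : clusterHom h hodd x ∈ S.frameSpan k P) :
    clusterHom h hodd x ∈ S.frameSpan k (multiples ℓ N ∩ P) := by
  obtain ⟨a, b, hb, rfl⟩ := IsFractionRing.div_surjective (A := MvPolynomial (Fin N) k) x
  have hb0 : clusterHom h hodd (algebraMap _ _ b) ≠ 0 := by
    rw [Ne, map_eq_zero,
      IsFractionRing.to_map_eq_zero_iff]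
    exact nonZeroDivisors.ne_zero hb
  set z := clusterHom h hodd (algebraMap _ (ClusterField k N) a / algebraMap _ _ b) with hz
  have h1 : z * clusterHom h hodd (algebraMap _ _ b) = clusterHom h hodd (algebraMap _ _ a) := by
    rw [hz, map_div₀, div_mul_cancel₀ _ hb0]
  -- The projection to `ℓℤ^N` commutes with multiplication by the denominator, so `z` and its
  -- projection have the same product with it.
  have h2 := h.frameProj_mul (P := multiples ℓ N) (P' := multiples ℓ N) (Q := multiples ℓ N) ?_ hx
    (clusterHom_algebraMap_mem h hodd b)
  · rw [h1, frameProj_eq_self _ (clusterHom_algebraMap_mem h hodd a), ← h1] at h2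
    rw [mul_right_cancel₀ hb0 h2]
    exact frameProj_mem_inter _ hx
  · rintro f _ ⟨g, rfl⟩
    constructor
    · rintro ⟨e, he⟩
      exact ⟨e - g, by dsimp only at he ⊢; rw [smul_sub, he, add_sub_cancel_right]⟩
    · rintro ⟨e, rfl⟩
      exact ⟨e + g, smul_add _ _ _⟩

end ClusterHom

/-! ### Classical seeds as quantum seeds with `ℓ = 1` -/

section Standard

variable (k)

/-- The seed of rational functions, with trivial bicharacter modulo `1`. -/
noncomputable def standard (B : Matrix (Fin N) ex ℤ) :
    QuantumSeed 1 N ex (ClusterField k N) where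
  M := fun f => ∏ i, (initialSeed k B).x i ^ f i
  Λ := 0
  B := B
  M_zero := by simp
  M_single := by
    classical
    intro i n
    rw [Finset.prod_eq_single i, Finset.prod_eq_single i]
    · simp
    all_goals simp +contextual

variable {k}

theorem standard_M (B : Matrix (Fin N) ex ℤ) (f : Fin N → ℤ) :
    (standard k B).M f = ∏ i, (initialSeed k B).x i ^ f i := rfl

theorem initialSeed_x_ne_zero (B : Matrix (Fin N) ex ℤ) (i : Fin N) :
    (initialSeed k B).x i ≠ 0 := by
  change algebraMap _ (ClusterField k N) (MvPolynomial.X i) ≠ 0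
  rw [Ne, IsFractionRing.to_map_eq_zero_iff]
  exact MvPolynomial.X_ne_zero i

theorem standard_M_natCast (B : Matrix (Fin N) ex ℤ) (d : Fin N →₀ ℕ) :
    (standard k B).M (fun i => (d i : ℤ)) =
      algebraMap _ (ClusterField k N) (MvPolynomial.monomial d (1 : k)) := by
  rw [MvPolynomial.monomial_eq, map_one, one_mul, Finsupp.prod_fintype _ _ (by simp), map_prod,
    standard_M]
  refine Finset.prod_congr rfl fun i _ => ?_
  rw [zpow_natCast, map_pow]
  rfl

theorem standard_M_add (B : Matrix (Fin N) ex ℤ) (f g : Fin N → ℤ) :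
    (standard k B).M (f + g) = (standard k B).M f * (standard k B).M g := by
  rw [standard_M, standard_M, standard_M, ← Finset.prod_mul_distrib]
  exact Finset.prod_congr rfl fun i _ => zpow_add₀ (initialSeed_x_ne_zero B i) _ _

theorem standard_linearIndependent (B : Matrix (Fin N) ex ℤ) :
    LinearIndependent k (standard k B).M := by
  classical
  rw [linearIndependent_iff']
  intro s c hc
  obtain ⟨m, hm⟩ : ∃ m : ℕ, ∀ f ∈ s, ∀ i, 0 ≤ f i + m := by
    refine ⟨∑ f ∈ s, ∑ i, (f i).natAbs, fun f hf i => ?_⟩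
    have h1 := Finset.single_le_sum (f := fun f : Fin N → ℤ => ∑ i, (f i).natAbs)
      (fun _ _ => Nat.zero_le _) hf
    have h2 := Finset.single_le_sum (f := fun i => (f i).natAbs)
      (fun _ _ => Nat.zero_le _) (Finset.mem_univ i)
    have h3 : (f i).natAbs ≤ ∑ f ∈ s, ∑ i, (f i).natAbs := h2.trans h1
    omega
  set d : (Fin N → ℤ) → Fin N →₀ ℕ := fun f =>
    Finsupp.equivFunOnFinite.symm fun i => (f i + m).toNat with hd
  have hdf : ∀ f ∈ s, (fun i => (d f i : ℤ)) = f + fun _ => (m : ℤ) := by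
    intro f hf
    funext i
    simp only [hd, Finsupp.equivFunOnFinite_symm_apply_apply, Pi.add_apply]
    exact Int.toNat_of_nonneg (hm f hf i)
  have h1 : (∑ f ∈ s, c f • MvPolynomial.monomial (d f) (1 : k)) = 0 := by
    refine (IsFractionRing.to_map_eq_zero_iff (K := ClusterField k N)).1 ?_
    rw [map_sum, ← zero_mul ((standard k B).M fun _ => (m : ℤ)), ← hc, Finset.sum_mul]
    refine Finset.sum_congr rfl fun f hf => ?_
    rw [Algebra.smul_def, map_mul, ← IsScalarTower.algebraMap_apply, ← Algebra.smul_def,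
      ← standard_M_natCast B, hdf f hf, standard_M_add, smul_mul_assoc]
  intro f hf
  have h2 := congrArg (MvPolynomial.coeff (d f)) h1
  rw [MvPolynomial.coeff_sum, Finset.sum_eq_single_of_mem f hf] at h2
  · simpa using h2
  · intro g hg hgf
    rw [MvPolynomial.coeff_smul, MvPolynomial.coeff_monomial, if_neg, smul_zero]
    intro e
    apply hgf
    have h3 := hdf g hg
    rw [e, hdf f hf] at h3
    exact (add_right_cancel h3).symm

/-- Modulo `1` both `Λ` and compatibility are void, so every skew-symmetrizable matrix is allowed,
and results on quantum seeds apply to classical ones with `q = 1`. -/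
theorem standard_isRootOfUnityQuantumSeed {D : ex → ℕ} {B : Matrix (Fin N) ex ℤ}
    (hB : IsSkewSymmetrizer D B) :
    (standard k B).IsRootOfUnityQuantumSeed (1 : k) D where
  frame :=
    { skew := fun _ _ => Subsingleton.elim _ _
      mul := fun f g => by simp [zmodPow, standard_M_add]
      linearIndependent := standard_linearIndependent B
      fractions := by
        have hmem : ∀ p : MvPolynomial (Fin N) k, algebraMap _ (ClusterField k N) p ∈
            Submodule.span k (Set.range (standard k B).M) := by
          intro p
          induction p using MvPolynomial.induction_on' with
          | monomial d c =>
            rw [← mul_one c, ← smul_eq_mul, ← MvPolynomial.smul_monomial, Algebra.smul_def,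
              map_mul, ← IsScalarTower.algebraMap_apply, ← Algebra.smul_def,
              ← standard_M_natCast B]
            exact Submodule.smul_mem _ _ (Submodule.subset_span ⟨_, rfl⟩)
          | add p r hp hr => rw [map_add]; exact add_mem hp hr
        intro z
        obtain ⟨a, b, hb, rfl⟩ := IsFractionRing.div_surjective (A := MvPolynomial (Fin N) k) z
        refine ⟨_, hmem a, _, hmem b, ?_, div_eq_mul_inv _ _⟩
        rw [Ne, IsFractionRing.to_map_eq_zero_iff]
        exact nonZeroDivisors.ne_zero hb }
  pos := hB.1
  skewSymmetrizable := hB.2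
  compatible := fun _ _ => Subsingleton.elim _ _

theorem intertwines_standard (B : Matrix (Fin N) ex ℤ) :
    Intertwines (AlgHom.id k (ClusterField k N)) (initialSeed k B) (standard k B) where
  B_eq := rfl
  map_x := by
    classical
    intro i
    rw [standard_M, Finset.prod_eq_single i]
    · simp
    all_goals simp +contextual

end Standard

end QuantumSeed

/-! ### The Laurent phenomenon -/

section Specialization

variable {A K L : Type*} [CommRing A] [Field K] [Algebra A K] [IsFractionRing A K] [Field L]

/-- The element `x` is the value at the point `ev` of the fraction `z`, which is defined there. -/
def SpecializesTo (K : Type*) [Field K] [Algebra A K] (ev : A →+* L) (z : K) (x : L) : Prop :=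
  ∃ a b, ev b ≠ 0 ∧ z * algebraMap A K b = algebraMap A K a ∧ x * ev b = ev a

namespace SpecializesTo

variable {ev : A →+* L}

theorem of_algebraMap (a : A) : SpecializesTo K ev (algebraMap A K a) (ev a) :=
  ⟨a, 1, by simp, by simp, by simp⟩

theorem one : SpecializesTo K ev 1 1 := by
  simpa using of_algebraMap (K := K) (ev := ev) 1

theorem add {z z' : K} {x x' : L} (h : SpecializesTo K ev z x) (h' : SpecializesTo K ev z' x') :
    SpecializesTo K ev (z + z') (x + x') := by
  obtain ⟨a, b, hb, h1, h2⟩ := h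
  obtain ⟨a', b', hb', h1', h2'⟩ := h'
  refine ⟨a * b' + a' * b, b * b', by rw [map_mul]; exact mul_ne_zero hb hb', ?_, ?_⟩
  · rw [map_add, map_mul, map_mul, map_mul, ← h1, ← h1']; ring
  · rw [map_add, map_mul, map_mul, map_mul, ← h2, ← h2']; ring

theorem mul {z z' : K} {x x' : L} (h : SpecializesTo K ev z x) (h' : SpecializesTo K ev z' x') :
    SpecializesTo K ev (z * z') (x * x') := by
  obtain ⟨a, b, hb, h1, h2⟩ := h
  obtain ⟨a', b', hb', h1', h2'⟩ := h'
  refine ⟨a * a', b * b', by rw [map_mul]; exact mul_ne_zero hb hb', ?_, ?_⟩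
  · rw [map_mul, map_mul, ← h1, ← h1']; ring
  · rw [map_mul, map_mul, ← h2, ← h2']; ring

theorem inv {z : K} {x : L} (h : SpecializesTo K ev z x) (hx : x ≠ 0) :
    SpecializesTo K ev z⁻¹ x⁻¹ := by
  obtain ⟨a, b, hb, h1, h2⟩ := h
  have ha : ev a ≠ 0 := by rw [← h2]; exact mul_ne_zero hx hb
  have ha' : algebraMap A K a ≠ 0 := by
    rw [Ne, IsFractionRing.to_map_eq_zero_iff]
    rintro rfl
    simp at ha
  have hz : z ≠ 0 := by
    rintro rfl
    rw [zero_mul] at h1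
    exact ha' h1.symm
  refine ⟨b, a, ha, ?_, ?_⟩
  · rw [← h1, inv_mul_cancel_left₀ hz]
  · rw [← h2, inv_mul_cancel_left₀ hx]

theorem pow {z : K} {x : L} (h : SpecializesTo K ev z x) (n : ℕ) :
    SpecializesTo K ev (z ^ n) (x ^ n) := by
  induction n with
  | zero => simpa using one
  | succ n ih => rw [pow_succ, pow_succ]; exact ih.mul h

theorem zpow {z : K} {x : L} (h : SpecializesTo K ev z x) (hx : x ≠ 0) (n : ℤ) :
    SpecializesTo K ev (z ^ n) (x ^ n) := by
  obtain ⟨n, rfl | rfl⟩ := n.eq_nat_or_neg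
  · simpa using h.pow n
  · simpa using (h.pow n).inv (pow_ne_zero n hx)

theorem prod {ι : Type*} {s : Finset ι} {z : ι → K} {x : ι → L}
    (h : ∀ i ∈ s, SpecializesTo K ev (z i) (x i)) :
    SpecializesTo K ev (∏ i ∈ s, z i) (∏ i ∈ s, x i) := by
  classical
  induction s using Finset.induction_on with
  | empty => simpa using one
  | insert i s hi ih =>
    rw [Finset.prod_insert hi, Finset.prod_insert hi]
    exact (h i (by simp)).mul (ih fun j hj => h j (by simp [hj]))

theorem unique {z : K} {x x' : L} (h : SpecializesTo K ev z x) (h' : SpecializesTo K ev z x') :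
    x = x' := by
  obtain ⟨a, b, hb, h1, h2⟩ := h
  obtain ⟨a', b', hb', h1', h2'⟩ := h'
  have h3 : a * b' = a' * b := by
    refine IsFractionRing.injective A K ?_
    rw [map_mul, map_mul, ← h1, ← h1']; ring
  have h4 := congrArg ev h3
  rw [map_mul, map_mul, ← h2, ← h2'] at h4
  exact mul_right_cancel₀ (mul_ne_zero hb hb') (by linear_combination h4)

end SpecializesTo

end Specialization

namespace QuantumSeed

/-! ### Principal coefficients and the classical Laurent phenomenon -/

section PrincipalCoefficients

variable {N : ℕ} {ex : Finset (Fin N)} {k : Type u} [Field k]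

/-- The exchangeable indices of a seed with principal coefficients. -/
abbrev exPrin (ex : Finset (Fin N)) : Finset (Fin (N + N)) := ex.map (Fin.castAddEmb N)

/-- The bijection between the exchangeable indices of a seed and those of the seed with principal
coefficients. -/
noncomputable def exEquiv (ex : Finset (Fin N)) : ex ≃ exPrin ex :=
  Equiv.ofBijective (fun j => ⟨Fin.castAdd N j.1, Finset.mem_map_of_mem (Fin.castAddEmb N) j.2⟩)
    ⟨fun i j h => Subtype.ext (Fin.castAdd_injective N N (congrArg Subtype.val h)), by
      rintro ⟨j, hj⟩
      obtain ⟨i, hi, rfl⟩ := Finset.mem_map.1 hj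
      exact ⟨⟨i, hi⟩, rfl⟩⟩

theorem exEquiv_coe (j : ex) : (exEquiv ex j).1 = Fin.castAdd N j.1 := rfl

/-- The exchange matrix with principal coefficients. -/
noncomputable def prinMatrix (B : Matrix (Fin N) ex ℤ) : Matrix (Fin (N + N)) (exPrin ex) ℤ :=
  fun p j => Fin.append (fun i => B i ((exEquiv ex).symm j))
    (fun i => if i = ((exEquiv ex).symm j).1 then 1 else 0) p

theorem prinMatrix_castAdd (B : Matrix (Fin N) ex ℤ) (i : Fin N) (j : ex) :
    prinMatrix B (Fin.castAdd N i) (exEquiv ex j) = B i j := by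
  rw [prinMatrix, Fin.append_left, Equiv.symm_apply_apply]

theorem prinMatrix_natAdd (B : Matrix (Fin N) ex ℤ) (i : Fin N) (j : exPrin ex) :
    prinMatrix B (Fin.natAdd N i) j = if i = ((exEquiv ex).symm j).1 then 1 else 0 := by
  rw [prinMatrix, Fin.append_right]

theorem isSkewSymmetrizer_prinMatrix {D : ex → ℕ} {B : Matrix (Fin N) ex ℤ}
    (hB : IsSkewSymmetrizer D B) :
    IsSkewSymmetrizer (fun j => D ((exEquiv ex).symm j)) (prinMatrix B) := by
  refine ⟨fun i => hB.1 _, fun i j => ?_⟩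
  obtain ⟨i, rfl⟩ := (exEquiv ex).surjective i
  obtain ⟨j, rfl⟩ := (exEquiv ex).surjective j
  rw [exEquiv_coe, exEquiv_coe, prinMatrix_castAdd, prinMatrix_castAdd]
  simpa using hB.2 i j

/-- The added rows indexed by `ex` form an identity matrix. -/
theorem fullRank_prinMatrix (B : Matrix (Fin N) ex ℤ) : (standard k (prinMatrix B)).FullRank := by
  classical
  intro v hv
  funext j
  have h1 := congrFun hv (Fin.natAdd N ((exEquiv ex).symm j).1)
  have h2 : ∀ i : exPrin ex, (standard k (prinMatrix B)).col i
      (Fin.natAdd N ((exEquiv ex).symm j).1) =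
      if ((exEquiv ex).symm j).1 = ((exEquiv ex).symm i).1 then 1 else 0 :=
    fun i => prinMatrix_natAdd B _ i
  rw [Finset.sum_apply, Finset.sum_eq_single j] at h1
  · rw [Pi.smul_apply, h2, if_pos rfl, smul_eq_mul, mul_one] at h1
    exact h1
  · intro i _ hij
    have : ((exEquiv ex).symm j).1 ≠ ((exEquiv ex).symm i).1 := fun e =>
      hij ((exEquiv ex).symm.injective (Subtype.ext e)).symm
    rw [Pi.smul_apply, h2, if_neg this, smul_zero]
  · simp

/-- The evaluation at the point where all coefficients are equal to `1`. -/
noncomputable def prinEval (k : Type u) [Field k] (N : ℕ) :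
    MvPolynomial (Fin (N + N)) k →+* ClusterField k N :=
  (MvPolynomial.aeval (Fin.append (fun i => algebraMap (MvPolynomial (Fin N) k)
    (ClusterField k N) (MvPolynomial.X i)) fun _ => 1) :
    MvPolynomial (Fin (N + N)) k →ₐ[k] ClusterField k N).toRingHom

/-- The seed `s` is obtained from a seed with principal coefficients by specializing the
coefficients. -/
structure PrinSpecializes (t : ClusterSeed (N + N) (exPrin ex) (ClusterField k (N + N)))
    (s : ClusterSeed N ex (ClusterField k N)) : Prop where
  B_eq : ∀ i j, t.B (Fin.castAdd N i) (exEquiv ex j) = s.B i j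
  x_castAdd : ∀ i, SpecializesTo (ClusterField k (N + N)) (prinEval k N) (t.x (Fin.castAdd N i))
    (s.x i)
  x_natAdd : ∀ i, SpecializesTo (ClusterField k (N + N)) (prinEval k N) (t.x (Fin.natAdd N i)) 1

theorem prinSpecializes_initialSeed (B : Matrix (Fin N) ex ℤ) :
    PrinSpecializes (initialSeed k (prinMatrix B)) (initialSeed k B) where
  B_eq := prinMatrix_castAdd B
  x_castAdd := by
    intro i
    have := SpecializesTo.of_algebraMap (K := ClusterField k (N + N)) (ev := prinEval k N)
      (MvPolynomial.X (Fin.castAdd N i))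
    have h1 : prinEval k N (MvPolynomial.X (Fin.castAdd N i)) = (initialSeed k B).x i := by
      change MvPolynomial.aeval _ _ = _
      rw [MvPolynomial.aeval_X, Fin.append_left]
      rfl
    rw [h1] at this
    exact this
  x_natAdd := by
    intro i
    have := SpecializesTo.of_algebraMap (K := ClusterField k (N + N)) (ev := prinEval k N)
      (MvPolynomial.X (Fin.natAdd N i))
    have h1 : prinEval k N (MvPolynomial.X (Fin.natAdd N i)) = 1 := by
      change MvPolynomial.aeval _ _ = _
      rw [MvPolynomial.aeval_X, Fin.append_right]
    rw [h1] at this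
    exact this

/-- The coefficients in the exchange relation take the value `1`, and division by the old variable
is allowed because its value `s.x j` is nonzero. -/
theorem PrinSpecializes.mutate {t : ClusterSeed (N + N) (exPrin ex) (ClusterField k (N + N))}
    {s : ClusterSeed N ex (ClusterField k N)} (h : PrinSpecializes t s) (j : ex)
    (hx : s.x j.1 ≠ 0) : PrinSpecializes (t.mutate (exEquiv ex j)) (s.mutate j) where
  B_eq := by
    intro i m
    change mutateMatrix _ t.B _ _ = mutateMatrix _ s.B _ _
    have h1 : (Fin.castAdd N i = Fin.castAdd N j.1 ∨ exEquiv ex m = exEquiv ex j) ↔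
        (i = j.1 ∨ m = j) := by
      rw [(Fin.castAdd_injective N N).eq_iff, (exEquiv ex).injective.eq_iff]
    simp only [mutateMatrix, exEquiv_coe, h1, h.B_eq]
  x_castAdd := by
    intro i
    change SpecializesTo _ _ (Function.update t.x _ _ _) (Function.update s.x _ _ _)
    by_cases hi : i = j.1
    · subst hi
      have key : ∀ n : ℤ → ℕ, SpecializesTo (ClusterField k (N + N)) (prinEval k N)
          (∏ p, t.x p ^ n (t.B p (exEquiv ex j))) (∏ i, s.x i ^ n (s.B i j)) := by
        intro n
        rw [Fin.prod_univ_add, ← mul_one (∏ i, s.x i ^ n (s.B i j))]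
        refine SpecializesTo.mul (SpecializesTo.prod fun i _ => ?_) ?_
        · rw [h.B_eq]; exact (h.x_castAdd i).pow _
        · rw [← Finset.prod_const_one (s := (Finset.univ : Finset (Fin N)))]
          refine SpecializesTo.prod fun i _ => ?_
          simpa using (h.x_natAdd i).pow (n (t.B (Fin.natAdd N i) (exEquiv ex j)))
      rw [exEquiv_coe, Function.update_self, Function.update_self, div_eq_mul_inv, div_eq_mul_inv]
      exact ((key Int.toNat).add (key fun z => (-z).toNat)).mul ((h.x_castAdd _).inv hx)
    · rw [Function.update_of_ne hi, Function.update_of_ne]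
      · exact h.x_castAdd i
      · rw [exEquiv_coe, Ne, (Fin.castAdd_injective N N).eq_iff]; exact hi
  x_natAdd := by
    intro i
    change SpecializesTo _ _ (Function.update t.x _ _ _) _
    rw [Function.update_of_ne]
    · exact h.x_natAdd i
    · rw [exEquiv_coe]
      intro e
      have := congrArg Fin.val e
      simp at this
      omega

theorem mutateList_x_ne_zero [CharZero k] {D : ex → ℕ} {B : Matrix (Fin N) ex ℤ}
    (hB : IsSkewSymmetrizer D B) (w : List ex) (i : Fin N) :
    ((initialSeed k B).mutateList w).x i ≠ 0 := by
  have h1 := standard_isRootOfUnityQuantumSeed (k := k) hB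
  have h2 := ((intertwines_standard (k := k) B).mutateList h1 IsPrimitiveRoot.one odd_one
    (fun _ => Nat.coprime_one_left _) w).map_x i
  rw [AlgHom.id_apply] at h2
  rw [h2]
  exact (h1.mutateList IsPrimitiveRoot.one odd_one w).frame.M_ne_zero _

theorem PrinSpecializes.mutateList [CharZero k] {D : ex → ℕ} {B : Matrix (Fin N) ex ℤ}
    (hB : IsSkewSymmetrizer D B) (w : List ex) :
    PrinSpecializes ((initialSeed k (prinMatrix B)).mutateList (w.map (exEquiv ex)))
      ((initialSeed k B).mutateList w) := by
  induction w using List.reverseRecOn with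
  | nil => exact prinSpecializes_initialSeed B
  | append_singleton w j ih =>
    have h1 : (initialSeed k B).mutateList (w ++ [j]) =
        ((initialSeed k B).mutateList w).mutate j := List.foldl_append
    have h2 : (initialSeed k (prinMatrix B)).mutateList ((w ++ [j]).map (exEquiv ex)) =
        ((initialSeed k (prinMatrix B)).mutateList (w.map (exEquiv ex))).mutate
          (exEquiv ex j) := by
      rw [List.map_append]
      exact List.foldl_append
    rw [h1, h2]
    exact ih.mutate j (mutateList_x_ne_zero hB w j.1)

/-- The classical Laurent phenomenon. -/
theorem mutateList_x_mem_torus [CharZero k] {D : ex → ℕ} {B : Matrix (Fin N) ex ℤ}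
    (hB : IsSkewSymmetrizer D B) (w : List ex) (i : Fin N) :
    ((initialSeed k B).mutateList w).x i ∈ (initialSeed k B).torus k := by
  have hB' := isSkewSymmetrizer_prinMatrix hB
  have h1 := standard_isRootOfUnityQuantumSeed (k := k) hB'
  have hcop : ∀ i, Nat.Coprime 1 (D ((exEquiv ex).symm i)) := fun _ => Nat.coprime_one_left _
  set W := w.map (exEquiv ex) with hW
  have h2 := ((intertwines_standard (k := k) (prinMatrix B)).mutateList h1 IsPrimitiveRoot.one
    odd_one hcop W).map_x (Fin.castAdd N i)
  have h3 := h1.mutateList IsPrimitiveRoot.one odd_one W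
  have h4 : ((standard k (prinMatrix B)).mutateList (1 : k) W).FullRank := by
    have key : ∀ (W : List (exPrin ex))
        (S : QuantumSeed 1 (N + N) (exPrin ex) (ClusterField k (N + N))),
        S.IsRootOfUnityQuantumSeed (1 : k) (fun j => D ((exEquiv ex).symm j)) → S.FullRank →
        (S.mutateList (1 : k) W).FullRank := by
      intro W
      induction W with
      | nil => exact fun S _ h => h
      | cons j W ih =>
        exact fun S hS h => ih _ (hS.mutate IsPrimitiveRoot.one odd_one j) (h.mutate hS j)
    exact key W _ h1 (fullRank_prinMatrix B)
  -- Reversing the word leads from the mutated seed to the initial one, so the mutated variable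
  -- becomes a Laurent polynomial in the initial cluster.
  have h5 := h3.laurent_of_fullRank IsPrimitiveRoot.one odd_one hcop h4 W.reverse
    (Fin.castAdd N i)
  rw [h1.mutateList_reverse IsPrimitiveRoot.one odd_one] at h5
  rw [one_smul, AlgHom.id_apply] at h2
  rw [← h2] at h5
  have h6 := PrinSpecializes.mutateList (k := k) hB w
  have h7 := prinSpecializes_initialSeed (k := k) B
  -- A Laurent polynomial in the initial cluster specializes to a Laurent polynomial, since the
  -- initial variables have nonzero values. Uniqueness of values identifies the result with the
  -- classical cluster variable.
  have key : ∀ z ∈ (standard k (prinMatrix B)).frameSpan k Set.univ,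
      ∃ x ∈ (initialSeed k B).torus k,
        SpecializesTo (ClusterField k (N + N)) (prinEval k N) z x := by
    intro z hz
    have hC : ∀ c : k, SpecializesTo (ClusterField k (N + N)) (prinEval k N)
        (algebraMap k _ c) (algebraMap k _ c) := by
      intro c
      have := SpecializesTo.of_algebraMap (K := ClusterField k (N + N)) (ev := prinEval k N)
        (MvPolynomial.C c)
      have e1 : prinEval k N (MvPolynomial.C c) = algebraMap k _ c := MvPolynomial.aeval_C _ c
      rwa [e1, ← MvPolynomial.algebraMap_eq, ← IsScalarTower.algebraMap_apply] at this
    have hx : ∀ a, (initialSeed k B).x a ∈ (initialSeed k B).torus k := fun a =>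
      Algebra.subset_adjoin (Or.inl ⟨a, rfl⟩)
    have hxi : ∀ a, ((initialSeed k B).x a)⁻¹ ∈ (initialSeed k B).torus k := fun a =>
      Algebra.subset_adjoin (Or.inr ⟨a, rfl⟩)
    have hxz : ∀ a (n : ℤ), (initialSeed k B).x a ^ n ∈ (initialSeed k B).torus k := by
      intro a n
      obtain ⟨n, rfl | rfl⟩ := n.eq_nat_or_neg
      · rw [zpow_natCast]; exact pow_mem (hx a) n
      · rw [zpow_neg, zpow_natCast, ← inv_pow]; exact pow_mem (hxi a) n
    induction hz using frameSpan_induction with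
    | mem f hf =>
      rw [standard_M, Fin.prod_univ_add]
      refine ⟨(∏ a, (initialSeed k B).x a ^ f (Fin.castAdd N a)) * ∏ a : Fin N, 1,
        mul_mem (prod_mem fun a _ => hxz a _) (prod_mem fun a _ => one_mem _), ?_⟩
      refine SpecializesTo.mul (SpecializesTo.prod fun a _ => ?_)
        (SpecializesTo.prod fun a _ => ?_)
      · exact (h7.x_castAdd a).zpow (initialSeed_x_ne_zero B a) _
      · simpa using (h7.x_natAdd a).zpow one_ne_zero (f (Fin.natAdd N a))
    | zero => exact ⟨0, zero_mem _, by simpa using hC 0⟩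
    | add a b _ _ ha hb =>
      obtain ⟨x, hx, hax⟩ := ha
      obtain ⟨y, hy, hby⟩ := hb
      exact ⟨x + y, add_mem hx hy, hax.add hby⟩
    | smul c a _ ha =>
      obtain ⟨x, hx, hax⟩ := ha
      refine ⟨c • x, Subalgebra.smul_mem _ hx c, ?_⟩
      rw [Algebra.smul_def, Algebra.smul_def]
      exact (hC c).mul hax
  obtain ⟨x, hx, hzx⟩ := key _ h5
  rw [(h6.x_castAdd i).unique hzx]
  exact hx

end PrincipalCoefficients

variable {ℓ N : ℕ} {ex : Finset (Fin N)} {F : Type u} [DivisionRing F]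
variable {k : Type u} [Field k] [Algebra k F] {q : k} {S : QuantumSeed ℓ N ex F}

theorem clusterHom_torus_mem [NeZero ℓ] (h : S.IsToricFrame q) (hodd : Odd ℓ)
    {s : ClusterSeed N ex (ClusterField k N)}
    (hs : Intertwines (clusterHom h hodd) s S)
    {x : ClusterField k N} (hx : x ∈ s.torus k) :
    clusterHom h hodd x ∈ S.frameSpan k (multiples ℓ N) := by
  have h0 : (0 : Fin N → ℤ) ∈ multiples ℓ N := ⟨0, smul_zero _⟩
  have hadd : ∀ f ∈ multiples ℓ N, ∀ g ∈ multiples ℓ N, f + g ∈ multiples ℓ N := by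
    rintro _ ⟨f, rfl⟩ _ ⟨g, rfl⟩
    exact ⟨f + g, smul_add _ _ _⟩
  induction hx using Algebra.adjoin_induction with
  | mem x hx =>
    rcases hx with ⟨i, rfl⟩ | ⟨i, rfl⟩
    · rw [hs.map_x]; exact M_mem_frameSpan ⟨_, rfl⟩
    · dsimp only
      rw [map_inv₀, hs.map_x, ← h.M_neg hodd, ← smul_neg]; exact M_mem_frameSpan ⟨_, rfl⟩
  | algebraMap r =>
    rw [AlgHom.commutes, Algebra.algebraMap_eq_smul_one]
    exact Submodule.smul_mem _ _ (one_mem_frameSpan h0)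
  | add x y _ _ hx hy => rw [map_add]; exact add_mem hx hy
  | mul x y _ _ hx hy => rw [map_mul]; exact h.mul_mem_frameSpan hadd hx hy

/-! ### The Laurent phenomenon for root of unity quantum seeds -/

namespace IsRootOfUnityQuantumSeed

variable {D : ex → ℕ} (hS : S.IsRootOfUnityQuantumSeed q D) [NeZero ℓ] [CharZero k]
variable (hq : IsPrimitiveRoot q ℓ) (hodd : Odd ℓ) (hcop : ∀ i, Nat.Coprime ℓ (D i))
include hS hq hodd hcop

theorem clusterHom_mutateList (w : List ex) (a : Fin N) :
    clusterHom hS.frame hodd (((initialSeed k S.B).mutateList w).x a) =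
      (S.mutateList q w).M (ℓ • Pi.single a 1) :=
  ((intertwines_clusterHom hS.frame hodd).mutateList hS hq hodd hcop w).map_x a

/-- For `ℓ > 1` full rank is automatic. For `ℓ = 1` the variable equals its own `ℓ`-th power, hence
is the image of a classical cluster variable. -/
theorem M_mutateList_mem_univ (w : List ex) (a : Fin N) :
    (S.mutateList q w).M (Pi.single a 1) ∈ S.frameSpan k Set.univ := by
  rcases Nat.lt_or_ge 1 ℓ with hℓ | hℓ
  · have h1 := hS.mutateList hq hodd w
    have h2 := h1.laurent_of_fullRank hq hodd hcop (h1.fullRank hℓ hcop) w.reverse a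
    rwa [hS.mutateList_reverse hq hodd] at h2
  · have h1 : ℓ = 1 := le_antisymm hℓ NeZero.one_le
    have h2 := hS.clusterHom_mutateList hq hodd hcop w a
    have h3 : (S.mutateList q w).M (ℓ • Pi.single a 1) =
        (S.mutateList q w).M (Pi.single a 1) := by
      have h4 : ℓ • (Pi.single a 1 : Fin N → ℤ) = Pi.single a 1 := by
        generalize (Pi.single a 1 : Fin N → ℤ) = v
        rw [h1, one_smul]
      rw [h4]
    rw [← h3, ← h2]
    exact mem_frameSpan_univ (clusterHom_torus_mem hS.frame hodd
      (intertwines_clusterHom hS.frame hodd) (mutateList_x_mem_torus hS.skew w a))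

theorem M_mutateList_mem_mutateList (w w' : List ex) (a : Fin N) :
    (S.mutateList q w).M (Pi.single a 1) ∈ (S.mutateList q w').frameSpan k Set.univ := by
  have h1 := (hS.mutateList hq hodd w').M_mutateList_mem_univ hq hodd hcop (w'.reverse ++ w) a
  rwa [mutateList_append, hS.mutateList_reverse hq hodd] at h1

/-- The Laurent phenomenon: every quantum cluster variable is, in every cluster, a Laurent
polynomial without negative exponents at frozen variables. -/
theorem M_mutateList_mem {A : Set (Fin N)} (hA : ∀ j ∈ ex, j ∉ A) (w w' : List ex) (a : Fin N) :
    (S.mutateList q w).M (Pi.single a 1) ∈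
      (S.mutateList q w').frameSpan k {f | ∀ a ∈ A, 0 ≤ f a} := by
  -- The induction starts at the seed containing the variable, where it is a monomial with
  -- nonnegative exponents, and follows a path to the target. Laurentness at each stage lets
  -- nonnegativity at frozen indices propagate.
  have key : ∀ v : List ex, (S.mutateList q w).M (Pi.single a 1) ∈
      ((S.mutateList q w).mutateList q v).frameSpan k {f | ∀ a ∈ A, 0 ≤ f a} := by
    intro v
    induction v using List.reverseRecOn with
    | nil =>
      refine M_mem_frameSpan fun b _ => ?_
      by_cases hb : b = a
      · subst hb; simp
      · simp [hb]
    | append_singleton v j ih =>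
      have h1 := ((hS.mutateList hq hodd w).mutateList hq hodd v).mem_mutate_of_nonneg_frozen hq
        hodd j (hA j.1 j.2) ih
      rw [mutateList_append]
      refine h1 ?_
      have h2 := hS.M_mutateList_mem_mutateList hq hodd hcop w (w ++ (v ++ [j])) a
      rwa [mutateList_append, mutateList_append] at h2
  have h1 := key (w.reverse ++ w')
  rwa [mutateList_append, hS.mutateList_reverse hq hodd] at h1

/-- The `ℓ`-th power is a rational function of the initial `ℓ`-th powers and also lies in the
quantum torus, so only exponents divisible by `ℓ` occur. -/
theorem M_smul_mutateList_mem {A : Set (Fin N)} (hA : ∀ j ∈ ex, j ∉ A) (w : List ex)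
    (a : Fin N) : (S.mutateList q w).M (ℓ • Pi.single a 1) ∈
      S.frameSpan k (multiples ℓ N ∩ {f | ∀ a ∈ A, 0 ≤ f a}) := by
  rw [← hS.clusterHom_mutateList hq hodd hcop]
  refine clusterHom_mem_multiples hS.frame hodd ?_
  rw [hS.clusterHom_mutateList hq hodd hcop, (hS.mutateList hq hodd w).frame.M_nsmul hodd]
  refine hS.frame.pow_mem_frameSpan (P := {f | ∀ a ∈ A, 0 ≤ f a}) (fun _ _ => le_rfl)
    (fun f hf g hg b hb => add_nonneg (hf b hb) (hg b hb)) ?_ ℓ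
  exact hS.M_mutateList_mem hq hodd hcop hA w [] a

end IsRootOfUnityQuantumSeed

end QuantumSeed

/-! ### Finite dimensional quotients of quantum tori -/

section TwistedGenerators

variable {k : Type*} [Field k] {ℓ N : ℕ} {A : Type*} [Ring A] [Algebra k A]

/-- The elements `u f` span the algebra `A`, they are multiplied according to the bicharacter
`q ^ Λ`, and the `u (ℓ • f)` are scalars. -/
structure IsTwistedSpanning (q : k) (Λ : LinearMap.BilinMap ℤ (Fin N → ℤ) (ZMod ℓ))
    (u : (Fin N → ℤ) → A) : Prop where
  zero : u 0 = 1
  mul : ∀ f g, u f * u g = zmodPow q (Λ f g) • u (f + g)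
  alt : ∀ f, Λ f f = 0
  scalar : ∀ f, ∃ c : k, u (ℓ • f) = algebraMap k A c
  span : Submodule.span k (Set.range u) = ⊤

namespace IsTwistedSpanning

variable {q : k} {Λ : LinearMap.BilinMap ℤ (Fin N → ℤ) (ZMod ℓ)} {u : (Fin N → ℤ) → A}
variable (h : IsTwistedSpanning q Λ u)
include h

theorem skew (f g : Fin N → ℤ) : Λ f g = -Λ g f := by
  have h1 := h.alt (f + g)
  rw [map_add, map_add, LinearMap.add_apply, LinearMap.add_apply, h.alt, h.alt] at h1
  linear_combination h1

theorem mul_neg (f : Fin N → ℤ) : u f * u (-f) = 1 := by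
  rw [h.mul, map_neg, h.alt, neg_zero, zmodPow_zero, one_smul, add_neg_cancel, h.zero]

theorem of_surjective {A' : Type*} [Ring A'] [Algebra k A'] (φ : A →ₐ[k] A')
    (hφ : Function.Surjective φ) : IsTwistedSpanning q Λ fun f => φ (u f) where
  zero := by rw [h.zero, map_one]
  mul f g := by rw [← map_mul, h.mul, map_smul]
  alt := h.alt
  scalar f := by
    obtain ⟨c, hc⟩ := h.scalar f
    exact ⟨c, by rw [hc, AlgHom.commutes]⟩
  span := by
    rw [Set.range_comp' φ u]
    have := Submodule.map_span φ.toLinearMap (Set.range u)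
    rw [h.span, Submodule.map_top, LinearMap.range_eq_top.2 hφ] at this
    exact this.symm

variable [NeZero ℓ] (hq : IsPrimitiveRoot q ℓ)

theorem add_smul (f g : Fin N → ℤ) : ∃ c : k, c ≠ 0 ∧ u (f + ℓ • g) = c • u f ∧
    u (-(f + ℓ • g)) = c⁻¹ • u (-f) := by
  have h0 : ∀ f g, Λ f (ℓ • g) = 0 := by
    intro f g
    rw [map_nsmul, nsmul_eq_mul, ZMod.natCast_self, zero_mul]
  obtain ⟨c, hc⟩ := h.scalar g
  obtain ⟨c', hc'⟩ := h.scalar (-g)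
  rcases subsingleton_or_nontrivial A with hA | hA
  · exact ⟨1, one_ne_zero, Subsingleton.elim _ _, Subsingleton.elim _ _⟩
  have hcc : c * c' = 1 := by
    have h1 := h.mul_neg (ℓ • g)
    rw [← smul_neg, hc, hc', ← map_mul, ← (algebraMap k A).map_one] at h1
    exact (algebraMap k A).injective h1
  have h2 : u (f + ℓ • g) = c • u f := by
    have := h.mul f (ℓ • g)
    rw [h0, zmodPow_zero, one_smul, hc, ← Algebra.commutes, ← Algebra.smul_def] at this
    exact this.symm
  refine ⟨c, left_ne_zero_of_mul_eq_one hcc, h2, ?_⟩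
  have := h.mul (-f) (ℓ • -g)
  rw [h0, zmodPow_zero, one_smul, hc', ← Algebra.commutes, ← Algebra.smul_def] at this
  rw [← eq_inv_of_mul_eq_one_right hcc, this, smul_neg, neg_add]

section Averaging

variable {V : Type*} [AddCommGroup V] [Module k V] [Module A V] [IsScalarTower k A V]

/-- The conjugate of a linear map by `u f`. -/
def conj (u : (Fin N → ℤ) → A) (P : V →ₗ[k] V) (f : Fin N → ℤ) : V →ₗ[k] V :=
  Algebra.lsmul k k V (u f) ∘ₗ P ∘ₗ Algebra.lsmul k k V (u (-f))

omit h in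
theorem conj_apply (P : V →ₗ[k] V) (f : Fin N → ℤ) (v : V) :
    conj u P f v = u f • P (u (-f) • v) := rfl

theorem conj_add_smul (P : V →ₗ[k] V) (f g : Fin N → ℤ) :
    conj u P (f + ℓ • g) = conj u P f := by
  obtain ⟨c, hc, h1, h2⟩ := h.add_smul f g
  ext v
  rw [conj_apply, conj_apply, h1, h2, smul_assoc, smul_assoc, P.map_smul, smul_comm (u f),
    smul_smul, mul_inv_cancel₀ hc, one_smul]

theorem smul_conj (P : V →ₗ[k] V) (f g : Fin N → ℤ) (v : V) :
    u g • conj u P f v = conj u P (g + f) (u g • v) := by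
  rw [conj_apply, conj_apply, ← mul_smul, ← mul_smul, h.mul, h.mul]
  have h1 : Λ (-(g + f)) g = Λ g f := by
    rw [map_neg, LinearMap.neg_apply, map_add, LinearMap.add_apply, h.alt, zero_add, h.skew g f]
  rw [h1, show -(g + f) + g = -f by abel, smul_assoc, smul_assoc, P.map_smul, smul_comm (u (g + f))]

/-- The representative of a class modulo `ℓ` with entries in `[0, ℓ)`. -/
def residueRepr (ℓ : ℕ) {N : ℕ} (x : Fin N → ZMod ℓ) : Fin N → ℤ := fun i => (x i).val

omit h in
theorem exists_eq_repr_add (f : Fin N → ℤ) :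
    ∃ g : Fin N → ℤ, f = residueRepr ℓ (fun i => (f i : ZMod ℓ)) + ℓ • g := by
  refine ⟨fun i => f i / ℓ, funext fun i => ?_⟩
  rw [Pi.add_apply, Pi.smul_apply, residueRepr, ZMod.val_intCast, nsmul_eq_mul]
  exact (Int.emod_add_mul_ediv _ _).symm

/-- Maschke's argument: conjugation by `u f` depends only on `f` modulo `ℓ`, so a linear projection
can be averaged over `(ℤ/ℓ)^N`, whose order is invertible in characteristic `0`. -/
theorem isSemisimpleModule [CharZero k] : IsSemisimpleModule A V := by
  refine (isSemisimpleModule_iff A V).2 ⟨fun p => ?_⟩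
  obtain ⟨r, hr⟩ := (p.restrictScalars k).subtype.exists_leftInverse_of_injective
    (LinearMap.ker_eq_bot.2 Subtype.val_injective)
  set P : V →ₗ[k] V := (p.restrictScalars k).subtype ∘ₗ r with hP
  have hPmem : ∀ v, P v ∈ p := fun v => (r v).2
  have hPid : ∀ v ∈ p, P v = v := fun v hv =>
    congrArg Subtype.val (LinearMap.congr_fun hr ⟨v, hv⟩)
  set Q : V →ₗ[k] V := (Fintype.card (Fin N → ZMod ℓ) : k)⁻¹ •
    ∑ x : Fin N → ZMod ℓ, conj u P (residueRepr ℓ x) with hQ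
  have hcard : (Fintype.card (Fin N → ZMod ℓ) : k) ≠ 0 := by
    exact_mod_cast Fintype.card_ne_zero
  have hQmem : ∀ v, Q v ∈ p := by
    intro v
    rw [hQ, LinearMap.smul_apply, LinearMap.sum_apply]
    refine (p.restrictScalars k).smul_mem _ (sum_mem fun x _ => ?_)
    exact p.smul_mem _ (hPmem _)
  have hQid : ∀ v ∈ p, Q v = v := by
    intro v hv
    have : ∀ x ∈ (Finset.univ : Finset (Fin N → ZMod ℓ)), conj u P (residueRepr ℓ x) v = v := by
      intro x _
      rw [conj_apply, hPid _ (p.smul_mem _ hv), ← mul_smul, h.mul_neg, one_smul]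
    rw [hQ, LinearMap.smul_apply, LinearMap.sum_apply, Finset.sum_congr rfl this,
      Finset.sum_const, Finset.card_univ, ← Nat.cast_smul_eq_nsmul k, smul_smul,
      inv_mul_cancel₀ hcard, one_smul]
  have hQu : ∀ g v, Q (u g • v) = u g • Q v := by
    intro g v
    -- Multiplication by `u g` permutes the conjugates through translation by the class of `g`.
    have key : ∀ x : Fin N → ZMod ℓ, u g • conj u P (residueRepr ℓ x) v =
        conj u P (residueRepr ℓ ((fun i => (g i : ZMod ℓ)) + x)) (u g • v) := by
      intro x
      rw [h.smul_conj]
      obtain ⟨e, he⟩ := exists_eq_repr_add (ℓ := ℓ) (g + residueRepr ℓ x)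
      have h1 : (fun i => ((g + residueRepr ℓ x) i : ZMod ℓ)) = (fun i => (g i : ZMod ℓ)) + x := by
        funext i
        simp [residueRepr]
      rw [h1] at he
      rw [he, h.conj_add_smul]
    rw [hQ, LinearMap.smul_apply, LinearMap.sum_apply, LinearMap.smul_apply, LinearMap.sum_apply,
      smul_comm (u g), Finset.smul_sum (r := u g), Finset.sum_congr rfl fun x _ => key x]
    congr 1
    exact (Equiv.sum_comp (Equiv.addLeft fun i => (g i : ZMod ℓ))
      fun x => conj u P (residueRepr ℓ x) (u g • v)).symm
  have hQA : ∀ (a : A) v, Q (a • v) = a • Q v := by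
    intro a v
    have ha : a ∈ Submodule.span k (Set.range u) := by rw [h.span]; trivial
    induction ha using Submodule.span_induction with
    | mem a ha => obtain ⟨g, rfl⟩ := ha; exact hQu g v
    | zero => simp
    | add a b _ _ ha hb => rw [_root_.add_smul, map_add, ha, hb, _root_.add_smul]
    | smul c a _ ha => rw [smul_assoc, map_smul, ha, smul_assoc]
  let Q' : V →ₗ[A] p :=
    { toFun := fun v => ⟨Q v, hQmem v⟩
      map_add' := fun v w => Subtype.ext (map_add Q v w)
      map_smul' := fun a v => Subtype.ext (hQA a v) }
  exact ⟨LinearMap.ker Q', LinearMap.isCompl_of_proj fun x => Subtype.ext (hQid x.1 x.2)⟩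

end Averaging

include hq in
-- Conjugation by `u g` multiplies `u f` by `q^(2Λ(g,f))`. Since `ℓ` is odd and `q` primitive, these
-- characters separate the classes modulo `Ker Λ`, so one `u f` per class gives an independent
-- family. It spans because `u f` is central, hence scalar, for `f ∈ Ker Λ`.
theorem finrank_eq_index (hodd : Odd ℓ) [Nontrivial A] [Algebra.IsCentral k A] :
    Module.finrank k A = (LinearMap.ker Λ).toAddSubgroup.index := by
  set K := (LinearMap.ker Λ).toAddSubgroup with hK
  have hu : ∀ f, u f ≠ 0 := fun f e => by
    have := h.mul_neg f
    rw [e, zero_mul] at this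
    exact zero_ne_one this
  have hcomm : ∀ f g, u g * u f * u (-g) = zmodPow q (2 * Λ g f) • u f := by
    intro f g
    have e : Λ (g + f) (-g) = Λ g f := by
      rw [map_neg, map_add, LinearMap.add_apply, h.alt, zero_add, h.skew g f]
    rw [h.mul, smul_mul_assoc, h.mul, smul_smul, ← zmodPow_add hq.pow_eq_one, e, two_mul]
    congr 2
    abel
  have h2 : IsUnit (2 : ZMod ℓ) := by
    have := (ZMod.isUnit_iff_coprime 2 ℓ).2 (Nat.coprime_two_left.2 hodd)
    simpa using this
  let v : (Fin N → ℤ) ⧸ K → A := fun x => u x.out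
  have hmem : ∀ f, f ∈ K ↔ ∀ g, Λ g f = 0 := by
    intro f
    rw [hK, Submodule.mem_toAddSubgroup, LinearMap.mem_ker]
    constructor
    · intro h1 g
      rw [h.skew, h1, LinearMap.zero_apply, neg_zero]
    · intro h1
      refine LinearMap.ext fun g => ?_
      rw [h.skew, h1, LinearMap.zero_apply, neg_zero]
  have hli : LinearIndependent k v := by
    classical
    rw [linearIndependent_iff']
    intro s
    induction s using Finset.induction_on with
    | empty => simp
    | insert y s hy ih =>
      intro a ha
      have key : ∀ x ∈ s, a x = 0 := by
        intro x hx
        have hxy : x ≠ y := fun e => hy (e ▸ hx)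
        have hxy' : ¬ (-y.out + x.out ∈ K) := by
          intro e
          rw [← QuotientAddGroup.eq, QuotientAddGroup.out_eq', QuotientAddGroup.out_eq'] at e
          exact hxy e.symm
        rw [hmem] at hxy'
        push Not at hxy'
        obtain ⟨g, hg⟩ := hxy'
        -- Conjugate the relation by `u g` and subtract the multiple that cancels the term at `y`;
        -- `g` is chosen so that the term at `x` survives.
        have h3 : ∑ z ∈ s, (a z * (zmodPow q (2 * Λ g z.out) - zmodPow q (2 * Λ g y.out))) • v z
            = 0 := by
          have e1 : ∑ z ∈ insert y s, (a z * zmodPow q (2 * Λ g z.out)) • v z = 0 := by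
            have : ∀ z ∈ insert y s, (a z * zmodPow q (2 * Λ g z.out)) • v z =
                u g * (a z • v z) * u (-g) := by
              intro z _
              rw [mul_smul_comm, smul_mul_assoc, hcomm, smul_smul]
            rw [Finset.sum_congr rfl this, ← Finset.sum_mul, ← Finset.mul_sum, ha, mul_zero,
              zero_mul]
          have e2 : ∑ z ∈ insert y s, (a z * zmodPow q (2 * Λ g y.out)) • v z = 0 := by
            simp_rw [mul_comm (a _), mul_smul]
            rw [← Finset.smul_sum, ha, smul_zero]
          rw [Finset.sum_insert hy] at e1 e2
          simp_rw [mul_sub, sub_smul]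
          rw [Finset.sum_sub_distrib, eq_neg_of_add_eq_zero_right e1,
            eq_neg_of_add_eq_zero_right e2, sub_self]
        have h4 := ih _ h3 x hx
        refine (mul_eq_zero.1 h4).resolve_right fun e => hg ?_
        have h5 := zmodPow_injective hq (sub_eq_zero.1 e)
        have h6 := h2.mul_left_cancel h5
        rw [map_add, map_neg, h6, neg_add_cancel]
      intro x hx
      rcases Finset.mem_insert.1 hx with rfl | hx
      · rw [Finset.sum_insert hy, Finset.sum_eq_zero fun z hz => by rw [key z hz, zero_smul],
          add_zero] at ha
        exact (smul_eq_zero.1 ha).resolve_right (hu _)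
      · exact key x hx
  have hcentral : ∀ f ∈ K, ∃ c : k, u f = algebraMap k A c := by
    intro f hf
    have hfc : u f ∈ Subalgebra.center k A := by
      rw [Subalgebra.mem_center_iff]
      intro a
      have ha : a ∈ Submodule.span k (Set.range u) := by rw [h.span]; trivial
      induction ha using Submodule.span_induction with
      | mem a ha =>
        obtain ⟨g, rfl⟩ := ha
        rw [h.mul, h.mul, h.skew f g, (hmem f).1 hf g, neg_zero, add_comm]
      | zero => simp
      | add a b _ _ ha hb => rw [add_mul, ha, hb, mul_add]
      | smul c a _ ha => rw [smul_mul_assoc, ha, mul_smul_comm]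
    have := Algebra.IsCentral.out hfc
    obtain ⟨c, hc⟩ := Algebra.mem_bot.1 this
    exact ⟨c, hc.symm⟩
  have hspan : ⊤ ≤ Submodule.span k (Set.range v) := by
    rw [← h.span, Submodule.span_le]
    rintro _ ⟨f, rfl⟩
    let x : (Fin N → ℤ) ⧸ K := QuotientAddGroup.mk f
    have hx : -x.out + f ∈ K := by
      rw [← QuotientAddGroup.eq, QuotientAddGroup.out_eq']
    obtain ⟨c, hc⟩ := hcentral _ hx
    have h1 := h.mul x.out (-x.out + f)
    rw [hc, add_neg_cancel_left, ← Algebra.commutes, ← Algebra.smul_def] at h1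
    have h3 : u f = (zmodPow q (Λ x.out (-x.out + f)))⁻¹ • c • v x := by
      rw [h1, smul_smul, inv_mul_cancel₀ (zmodPow_ne_zero hq.pow_eq_one _), one_smul]
    rw [h3]
    exact Submodule.smul_mem _ _ (Submodule.smul_mem _ _ (Submodule.subset_span ⟨x, rfl⟩))
  rw [Module.finrank_eq_nat_card_basis (Module.Basis.mk hli hspan)]
  rfl

include hq in
-- Each Wedderburn block is a central quotient which is again spanned by twisted generators, so its
-- dimension is the index of `Ker Λ`. Hence all blocks have the same size.
theorem exists_algEquiv_pi_matrix [IsAlgClosed k] [CharZero k] (hodd : Odd ℓ)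
    [Nontrivial A]
    [FiniteDimensional k A] : ∃ n d : ℕ,
      Nonempty (A ≃ₐ[k] (Fin n → Matrix (Fin d) (Fin d) k)) ∧
      d ^ 2 = (LinearMap.ker Λ).toAddSubgroup.index ∧ 0 < d := by
  have : IsSemisimpleRing A := h.isSemisimpleModule
  obtain ⟨n, d, hd, ⟨e⟩⟩ := IsSemisimpleRing.exists_algEquiv_pi_matrix_of_isAlgClosed k A
  have key : ∀ i, d i ^ 2 = (LinearMap.ker Λ).toAddSubgroup.index := by
    intro i
    have := hd i
    have h1 := (h.of_surjective ((Pi.evalAlgHom k _ i).comp e.toAlgHom) (by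
      intro x
      obtain ⟨y, hy⟩ := e.surjective (Pi.single i x)
      refine ⟨y, ?_⟩
      change (e y) i = x
      rw [hy, Pi.single_eq_same])).finrank_eq_index hq hodd
    rw [← h1, Module.finrank_matrix, Fintype.card_fin, Module.finrank_self, mul_one, sq]
  rcases n.eq_zero_or_pos with rfl | hn
  · exact absurd (e.injective (Subsingleton.elim (e 0) (e 1))) zero_ne_one
  · have h2 : d = fun _ => d ⟨0, hn⟩ := funext fun i =>
      Nat.pow_left_injective two_ne_zero ((key i).trans (key ⟨0, hn⟩).symm)
    refine ⟨n, d ⟨0, hn⟩, ?_, key _, Nat.pos_of_ne_zero (hd _).out⟩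
    rw [h2] at e
    exact ⟨e⟩

end IsTwistedSpanning

end TwistedGenerators

/-! ### Modules over products of matrix algebras -/

section Blocks

variable {k : Type u} [Field k] {R : Type u} [Ring R] [Algebra k R] {n d : ℕ}
variable (ρ : R →ₐ[k] (Fin n → Matrix (Fin d) (Fin d) k))

/-- The `i`-th standard module of an algebra which acts through a product of matrix algebras. -/
def BlockModule (_ : R →ₐ[k] (Fin n → Matrix (Fin d) (Fin d) k)) (_ : Fin n) : Type u :=
  Fin d → k

namespace BlockModule

variable (i : Fin n)

instance : AddCommGroup (BlockModule ρ i) := inferInstanceAs (AddCommGroup (Fin d → k))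

instance : Module k (BlockModule ρ i) := inferInstanceAs (Module k (Fin d → k))

instance : Module R (BlockModule ρ i) :=
  Module.compHom (Fin d → k) (((Matrix.toLinAlgEquiv' (R := k) (n := Fin d)).toAlgHom.comp
    ((Pi.evalAlgHom k _ i).comp ρ)).toRingHom : R →+* Module.End k (Fin d → k))

theorem smul_def (r : R) (x : BlockModule ρ i) : r • x = (ρ r i).mulVec (x : Fin d → k) := rfl

instance : IsScalarTower k R (BlockModule ρ i) where
  smul_assoc c r x := by
    rw [smul_def, smul_def, map_smul, Pi.smul_apply]
    exact Matrix.smul_mulVec c _ _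

theorem finrank_eq : Module.finrank k (BlockModule ρ i) = d :=
  (Module.finrank_fin_fun k : Module.finrank k (Fin d → k) = d)

instance [NeZero d] : Nontrivial (BlockModule ρ i) :=
  inferInstanceAs (Nontrivial (Fin d → k))

variable {ρ} (hρ : Function.Surjective ρ)
include hρ

theorem isSimpleModule [NeZero d] : IsSimpleModule R (BlockModule ρ i) := by
  classical
  refine isSimpleModule_iff_toSpanSingleton_surjective.2 ⟨inferInstance, fun x hx y => ?_⟩
  obtain ⟨b, hb⟩ : ∃ b, (x : Fin d → k) b ≠ 0 := Function.ne_iff.1 hx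
  obtain ⟨r, hr⟩ := hρ (Pi.single i (Matrix.of fun a c => if c = b then (y : Fin d → k) a * (x b)⁻¹
    else 0))
  refine ⟨r, ?_⟩
  rw [LinearMap.toSpanSingleton_apply, smul_def, hr, Pi.single_eq_same]
  funext a
  change ∑ c, (if c = b then (y : Fin d → k) a * (x b)⁻¹ else 0) * x c = y a
  rw [Finset.sum_eq_single b]
  · rw [if_pos rfl]
    exact inv_mul_cancel_right₀ hb _
  · intro c _ hc
    rw [if_neg hc, zero_mul]
  · simp

theorem eq_of_linearEquiv [NeZero d] {i j : Fin n}
    (e : BlockModule ρ i ≃ₗ[R] BlockModule ρ j) : i = j := by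
  classical
  by_contra hij
  obtain ⟨r, hr⟩ := hρ (Pi.single i 1)
  obtain ⟨x, hx⟩ := exists_ne (0 : BlockModule ρ i)
  have h1 : r • x = x := by
    rw [smul_def, hr, Pi.single_eq_same]
    exact Matrix.one_mulVec _
  have h2 : r • e x = 0 := by
    rw [smul_def, hr, Pi.single_eq_of_ne (Ne.symm hij)]
    exact Matrix.zero_mulVec _
  rw [← map_smul, h1] at h2
  exact hx (e.map_eq_zero_iff.1 h2)

/-- Some diagonal matrix unit of some block does not kill `w`. Sending a vector to the matrix with
that vector as its only nonzero column, applied to `w`, is a nonzero map from a standard module to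
`W`; Schur's lemma applies. -/
theorem exists_linearEquiv [NeZero d] {W : Type*} [AddCommGroup W] [Module R W]
    [IsSimpleModule R W] (hW : ∀ r, ρ r = 0 → ∀ w : W, r • w = 0) :
    ∃ i, Nonempty (W ≃ₗ[R] BlockModule ρ i) := by
  classical
  have : Nontrivial W := IsSimpleModule.nontrivial R W
  obtain ⟨w, hw⟩ := exists_ne (0 : W)
  have hext : ∀ r s, ρ r = ρ s → ∀ w : W, r • w = s • w := by
    intro r s hrs w
    rw [← sub_eq_zero, ← sub_smul]
    exact hW _ (by rw [map_sub, hrs, sub_self]) w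
  choose σ hσ using hρ
  have h1 : ∃ i b, σ (Pi.single i (Matrix.single b b 1)) • w ≠ 0 := by
    by_contra! hcon
    refine hw ?_
    have : (1 : R) • w = (∑ i, ∑ b, σ (Pi.single i (Matrix.single b b 1))) • w := by
      refine hext _ _ ?_ w
      rw [map_one, map_sum]
      funext i
      rw [Finset.sum_apply, Finset.sum_eq_single i]
      · rw [map_sum, Finset.sum_apply]
        simp_rw [hσ, Pi.single_eq_same]
        rw [Pi.one_apply, Matrix.sum_single_one]
      · intro j _ hj
        rw [map_sum, Finset.sum_apply]
        simp_rw [hσ, Pi.single_eq_of_ne hj.symm]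
        simp
      · simp
    rw [← one_smul R w, this, Finset.sum_smul]
    refine Finset.sum_eq_zero fun i _ => ?_
    rw [Finset.sum_smul]
    exact Finset.sum_eq_zero fun b _ => hcon i b
  obtain ⟨i, b, hib⟩ := h1
  let c : BlockModule ρ i → R := fun x =>
    σ (Pi.single i (Matrix.of fun a a' => if a' = b then (x : Fin d → k) a else 0))
  have hc : ∀ x, ρ (c x) = Pi.single i (Matrix.of fun a a' => if a' = b then (x : Fin d → k) a
    else 0) := fun x => hσ _
  let L : BlockModule ρ i →ₗ[R] W :=
    { toFun := fun x => c x • w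
      map_add' := by
        intro x y
        rw [← add_smul]
        refine hext _ _ ?_ w
        rw [map_add, hc, hc, hc, ← Pi.single_add]
        congr 1
        ext a a'
        by_cases h : a' = b
        · simp only [Matrix.add_apply, Matrix.of_apply, if_pos h]; rfl
        · simp [h]
      map_smul' := by
        intro r x
        rw [RingHom.id_apply, ← mul_smul]
        refine hext _ _ ?_ w
        rw [map_mul, hc, hc]
        funext j
        by_cases hj : j = i
        · subst hj
          rw [Pi.mul_apply, Pi.single_eq_same, Pi.single_eq_same]
          ext a a'
          rw [Matrix.mul_apply]
          by_cases h : a' = b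
          · simp only [Matrix.of_apply, if_pos h]; rfl
          · simp [h]
        · rw [Pi.mul_apply, Pi.single_eq_of_ne hj, Pi.single_eq_of_ne hj, mul_zero] }
  have : IsSimpleModule R (BlockModule ρ i) := isSimpleModule i fun y => ⟨σ y, hσ y⟩
  have hL : L ≠ 0 := by
    intro e
    refine hib ?_
    have h2 : L (Pi.single b 1 : Fin d → k) = 0 := LinearMap.congr_fun e _
    rw [← h2]
    refine hext _ _ ?_ w
    refine (hσ _).trans (Eq.trans ?_ (hc _).symm)
    congr 1
    ext a a'
    by_cases h : a' = b
    · subst h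
      by_cases h' : a = a'
      · subst h'; simp
      · simp [h', Matrix.single, Ne.symm h']
    · simp [h, Matrix.single, Ne.symm h]
  exact ⟨i, ⟨(LinearEquiv.ofBijective L (L.bijective_of_ne_zero hL)).symm⟩⟩

/-- As a left module a matrix algebra is the sum of its `d` columns, each a copy of the standard
module. -/
theorem nonempty_quotient_linearEquiv {I : Ideal R} (hI : ∀ r, ρ r = 0 ↔ r ∈ I) :
    Nonempty ((R ⧸ I) ≃ₗ[R] (∀ i : Fin n, Fin d → BlockModule ρ i)) := by
  classical
  let x : ∀ i : Fin n, Fin d → BlockModule ρ i := fun i b => (Pi.single b 1 : Fin d → k)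
  let L := LinearMap.toSpanSingleton R _ x
  have hL : ∀ r i b a, (L r i b : Fin d → k) a = ρ r i a b := by
    intro r i b a
    change (ρ r i).mulVec (Pi.single b 1) a = _
    rw [Matrix.mulVec_single_one, Matrix.col_apply]
  have h1 : LinearMap.ker L = I := by
    ext r
    rw [LinearMap.mem_ker, ← hI]
    constructor
    · intro h
      funext i
      ext a b
      rw [← hL, h]
      rfl
    · intro h
      funext i b a
      exact (hL r i b a).trans (by rw [h]; rfl)
  have h2 : Function.Surjective L := by
    intro y
    obtain ⟨r, hr⟩ := hρ fun i => Matrix.of fun a b => (y i b : Fin d → k) a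
    refine ⟨r, ?_⟩
    funext i b a
    exact (hL r i b a).trans (by rw [hr]; rfl)
  rw [← h1]
  exact ⟨L.quotKerEquivOfSurjective h2⟩

theorem isSemisimpleModule_quotient [NeZero d] {I : Ideal R} (hI : ∀ r, ρ r = 0 ↔ r ∈ I) :
    IsSemisimpleModule R (R ⧸ I) := by
  obtain ⟨e⟩ := nonempty_quotient_linearEquiv hρ hI
  have : ∀ i, IsSimpleModule R (BlockModule ρ i) := fun i => isSimpleModule i hρ
  exact IsSemisimpleModule.congr e

theorem length_quotient [NeZero d] {I : Ideal R} (hI : ∀ r, ρ r = 0 ↔ r ∈ I) :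
    Module.length R (R ⧸ I) = (n * d : ℕ) := by
  obtain ⟨e⟩ := nonempty_quotient_linearEquiv hρ hI
  have : ∀ i, IsSimpleModule R (BlockModule ρ i) := fun i => isSimpleModule i hρ
  rw [e.length_eq, Module.length_pi_of_fintype]
  simp_rw [Module.length_pi_of_fintype, Module.length_eq_one]
  simp

omit hρ in
theorem annihilatedBy {C : Type u} [CommRing C] {ι : C →+* R} {m : Ideal C}
    (hI : ∀ r, ρ r = 0 ↔ r ∈ extendedIdeal ι m) : AnnihilatedBy ι m (BlockModule ρ i) := by
  intro a ha v
  rw [smul_def, (hI a).2 ha]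
  exact Matrix.zero_mulVec _

theorem hasExactlyIrreps [NeZero d] {C : Type u} [CommRing C] {ι : C →+* R} {m : Ideal C}
    (hI : ∀ r, ρ r = 0 ↔ r ∈ extendedIdeal ι m) : HasExactlyIrreps ι m n := by
  refine ⟨fun i => ModuleCat.of R (BlockModule ρ i), fun i => ⟨isSimpleModule i hρ,
    annihilatedBy i hI⟩, fun i j e => eq_of_linearEquiv hρ e.some, fun W _ _ hW hm => ?_⟩
  exact exists_linearEquiv hρ fun r hr w => hm r ((hI r).1 hr) w

theorem finrank_of_annihilatedBy [NeZero d] {C : Type u} [CommRing C] {ι : C →+* R} {m : Ideal C}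
    (hI : ∀ r, ρ r = 0 ↔ r ∈ extendedIdeal ι m) {V : Type u} [AddCommGroup V] [Module k V]
    [Module R V] [IsScalarTower k R V] (hV : IsSimpleModule R V) (hm : AnnihilatedBy ι m V) :
    FiniteDimensional k V ∧ Module.finrank k V = d := by
  obtain ⟨i, ⟨e⟩⟩ := exists_linearEquiv hρ (W := V) fun r hr w => hm r ((hI r).1 hr) w
  have e' : V ≃ₗ[k] BlockModule ρ i := e.restrictScalars k
  have : FiniteDimensional k (BlockModule ρ i) :=
    inferInstanceAs (FiniteDimensional k (Fin d → k))
  exact ⟨e'.symm.finiteDimensional, by rw [e'.finrank_eq, finrank_eq]⟩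

end BlockModule

end Blocks

/-! ### Dimensions of irreducible representations of an order -/

section PolynomialIdentity

open Equiv in
/-- The Capelli polynomials vanish on algebras of small rank. -/
theorem sum_sign_smul_prod_eq_zero {Z E : Type*} [Field Z] [Ring E]
    [Algebra Z E] [FiniteDimensional Z E]
    {m : ℕ} (hm : Module.finrank Z E < m) (x y y' : Fin m → E) :
    ∑ σ : Perm (Fin m), Perm.sign σ • (List.ofFn fun i => y i * x (σ i) * y' i).prod = 0 := by
  let f : MultilinearMap Z (fun _ : Fin m => E) E :=
    (MultilinearMap.mkPiAlgebraFin Z m E).compLinearMap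
      fun i => LinearMap.mulRight Z (y' i) ∘ₗ LinearMap.mulLeft Z (y i)
  have h1 : MultilinearMap.alternatization f x = 0 := by
    refine AlternatingMap.map_linearDependent _ _ fun h => ?_
    have := h.fintype_card_le_finrank
    rw [Fintype.card_fin] at this
    omega
  rw [MultilinearMap.alternatization_apply] at h1
  rw [← h1]
  refine Finset.sum_congr rfl fun σ _ => ?_
  rfl

open Equiv in
-- If the rank were below `n^2`, the Capelli identity of degree `n^2` would hold in `E`, hence in
-- `R` and in its image. Substituting all matrix units, flanked by matrix units that only the
-- identity permutation fits, gives a nonzero value.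
theorem sq_le_finrank_of_surjective {Z E R K : Type*} [Field Z] [Ring E]
    [Algebra Z E] [FiniteDimensional Z E] [Ring R] [CommRing K] [Nontrivial K] (j : R →+* E)
    (hj : Function.Injective j) {n : ℕ}
    (π : R →+* Matrix (Fin n) (Fin n) K) (hπ : Function.Surjective π) :
    n ^ 2 ≤ Module.finrank Z E := by
  classical
  by_contra! hn
  rcases n.eq_zero_or_pos with rfl | hn0
  · simp at hn
  let z : Fin n := ⟨0, hn0⟩
  set m := n ^ 2 with hm
  have e : Fin m ≃ Fin n × Fin n := (Fintype.equivFinOfCardEq (by simp [hm, sq])).symm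
  choose s hs using hπ
  let x : Fin m → R := fun i => s (Matrix.single (e i).1 (e i).2 1)
  let y : Fin m → R := fun i => s (Matrix.single z (e i).1 1)
  let y' : Fin m → R := fun i => s (Matrix.single (e i).2 z 1)
  have h1 : ∑ σ : Perm (Fin m), Perm.sign σ • (List.ofFn fun i => y i * x (σ i) * y' i).prod
      = 0 := by
    refine hj ?_
    rw [map_zero, ← sum_sign_smul_prod_eq_zero hn (j ∘ x) (j ∘ y) (j ∘ y'), map_sum]
    refine Finset.sum_congr rfl fun σ _ => ?_
    rw [Units.smul_def, Units.smul_def, map_zsmul, map_list_prod, List.map_ofFn]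
    congr 3
    funext i
    simp
  have h2 := congrArg π h1
  rw [map_zero, map_sum, Finset.sum_eq_single 1] at h2
  · have h3 : ∀ i, π (y i * x i * y' i) = Matrix.single z z 1 := by
      intro i
      simp only [x, y, y', map_mul, hs, Matrix.single_mul_single_same, mul_one]
    rw [Perm.sign_one, one_smul, map_list_prod, List.map_ofFn] at h2
    have h4 : (π ∘ fun i => y i * x ((1 : Perm (Fin m)) i) * y' i) =
        fun _ => Matrix.single z z (1 : K) := funext h3
    have h5 : ∀ t : ℕ, (Matrix.single z z (1 : K)) ^ (t + 1) = Matrix.single z z 1 := by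
      intro t
      induction t with
      | zero => rw [zero_add, pow_one]
      | succ t ih => rw [pow_succ, ih, Matrix.single_mul_single_same, mul_one]
    obtain ⟨t, ht⟩ : ∃ t, m = t + 1 := ⟨m - 1, by have := pow_pos hn0 2; omega⟩
    rw [h4, List.ofFn_const, List.prod_replicate, ht, h5] at h2
    have := congrFun (congrFun h2 z) z
    simp at this
  · intro σ _ hσ
    obtain ⟨i, hi⟩ : ∃ i, σ i ≠ i := by
      by_contra! hcon
      exact hσ (Perm.ext hcon)
    have h3 : π (y i * x (σ i) * y' i) = 0 := by
      simp only [x, y, y', map_mul, hs]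
      by_cases ha : (e i).1 = (e (σ i)).1
      · have hb : (e (σ i)).2 ≠ (e i).2 := fun hb => hi (e.injective (Prod.ext ha.symm hb))
        rw [mul_assoc, Matrix.single_mul_single_of_ne (h := hb), mul_zero]
      · rw [Matrix.single_mul_single_of_ne (h := ha), zero_mul]
    rw [Units.smul_def, map_zsmul, map_list_prod, List.map_ofFn, List.prod_eq_zero, smul_zero]
    rw [List.mem_ofFn]
    exact ⟨i, h3⟩
  · simp

/-- Irreducible finite dimensional representations of an order have bounded dimension. -/
theorem finrank_sq_le_of_isSimpleModule {k Z E R W : Type*} [Field k] [IsAlgClosed k]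
    [Field Z] [Ring E] [Algebra Z E] [FiniteDimensional Z E] [Ring R] [Algebra k R] (j : R →+* E)
    (hj : Function.Injective j)
    [AddCommGroup W] [Module k W] [Module R W] [IsScalarTower k R W] [IsSimpleModule R W]
    [FiniteDimensional k W] : Module.finrank k W ^ 2 ≤ Module.finrank Z E := by
  classical
  have hschur : ∀ φ : Module.End R W, ∃ c : k, ∀ w, φ w = c • w := by
    intro φ
    have : Nontrivial W := IsSimpleModule.nontrivial R W
    let φ' : Module.End k W := φ.restrictScalars k
    obtain ⟨c, hc⟩ := Module.End.exists_eigenvalue φ'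
    obtain ⟨w, hw⟩ := hc.exists_hasEigenvector
    let L : Module.End R W := φ - algebraMap k (Module.End R W) c
    have h1 : L w = 0 := sub_eq_zero.2 hw.apply_eq_smul
    refine ⟨c, fun v => ?_⟩
    have h2 : L = 0 := (L.bijective_or_eq_zero).resolve_left fun hb =>
      hw.2 (hb.1 (h1.trans (map_zero L).symm))
    exact sub_eq_zero.1 (LinearMap.congr_fun h2 v)
  let b := Module.finBasis k W
  let π : R →+* Matrix (Fin (Module.finrank k W)) (Fin (Module.finrank k W)) k :=
    (LinearMap.toMatrixAlgEquiv b).toRingEquiv.toRingHom.comp (Algebra.lsmul k k W).toRingHom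
  refine sq_le_finrank_of_surjective j hj π ?_
  refine (LinearMap.toMatrixAlgEquiv b).surjective.comp fun T => ?_
  -- By Schur's lemma the commutant consists of scalars, so every `k`-linear `T` commutes with it.
  -- Density on a finite basis then realizes `T` by an element of `R`.
  let T' : Module.End (Module.End R W) W :=
    { toFun := T
      map_add' := T.map_add
      map_smul' := by
        intro φ w
        obtain ⟨c, hc⟩ := hschur φ
        rw [Module.End.smul_def, hc, map_smul, RingHom.id_apply, Module.End.smul_def, hc] }
  obtain ⟨r, hr⟩ := jacobson_density T' (Finset.univ.image b)
  refine ⟨r, b.ext fun i => ?_⟩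
  exact (hr (b i) (Finset.mem_image_of_mem _ (Finset.mem_univ i))).symm

end PolynomialIdentity

/-! ### Central subalgebras and orders attached to sets of seeds -/

namespace QuantumSeed

variable {ℓ N : ℕ} {ex inv : Finset (Fin N)} {F : Type u} [DivisionRing F]
variable {k : Type u} [Field k] [Algebra k F] {q : k} {S : QuantumSeed ℓ N ex F}

/-- A function which is multiplicative up to scalars has values in a subalgebra if its values at
multiples of basis vectors are in the subalgebra. -/
theorem mem_of_smul_single_mem {A : Type*} [Ring A] [Algebra k A] {B : Subalgebra k A}
    {u : (Fin N → ℤ) → A} (h0 : u 0 ∈ B) (hu : ∀ f g, ∃ c : k, u (f + g) = c • (u f * u g))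
    {f : Fin N → ℤ} (hf : ∀ i, u (f i • Pi.single i 1) ∈ B) : u f ∈ B := by
  classical
  have key : ∀ s : Finset (Fin N), u (∑ i ∈ s, f i • Pi.single i 1) ∈ B := by
    intro s
    induction s using Finset.induction_on with
    | empty => exact h0
    | insert i s hi ih =>
      rw [Finset.sum_insert hi]
      obtain ⟨c, hc⟩ := hu (f i • Pi.single i 1) (∑ i ∈ s, f i • Pi.single i 1)
      rw [hc]
      exact B.smul_mem (mul_mem (hf i) ih) c
  have h1 : f = ∑ i, f i • Pi.single i 1 := by
    funext a
    rw [Finset.sum_apply, Finset.sum_eq_single a]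
    · simp
    · intro b _ hb
      simp [hb]
    · simp
  rw [h1]
  exact key _

/-- The set of exponents which are nonnegative on a set of indices. -/
def nonnegOn (A : Set (Fin N)) : Set (Fin N → ℤ) := {f | ∀ a ∈ A, 0 ≤ f a}

/-- The frozen indices which are not inverted. -/
def nonInverted (ex inv : Finset (Fin N)) : Set (Fin N) := {j | j ∉ ex ∪ inv}

theorem not_mem_nonInverted : ∀ j ∈ ex, j ∉ nonInverted ex inv :=
  fun _ hj h => h (Finset.mem_union_left _ hj)

namespace IsToricFrame

variable [NeZero ℓ] (h : S.IsToricFrame q)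
include h

theorem mem_mixedTorus_iff {z : F} :
    z ∈ S.mixedTorus k inv ↔ z ∈ S.frameSpan k (nonnegOn (nonInverted ex inv)) := by
  rw [← h.adjoin_eq_frameSpan (P := nonnegOn (nonInverted ex inv)) (fun _ _ => le_rfl)
    (fun f hf g hg a ha => add_nonneg (hf a ha) (hg a ha)), mixedTorus]
  have : {z | ∃ f : Fin N → ℤ, (∀ j, j ∉ ex ∪ inv → 0 ≤ f j) ∧ z = S.M f} =
      S.M '' nonnegOn (nonInverted ex inv) := by
    ext z
    constructor
    · rintro ⟨f, hf, rfl⟩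
      exact ⟨f, hf, rfl⟩
    · rintro ⟨f, hf, rfl⟩
      exact ⟨f, hf, rfl⟩
  rw [this]

variable (hodd : Odd ℓ)

theorem M_smul_add (f g : Fin N → ℤ) :
    S.M (ℓ • (f + g)) = S.M (ℓ • f) * S.M (ℓ • g) := by
  rw [h.M_mul_M_smul, smul_add]

/-- The central element `M(ℓ f)`. -/
def centralM (f : Fin N → ℤ) : Subalgebra.center k F := ⟨S.M (ℓ • f), h.M_smul_mem_center f⟩

theorem centralM_zero : h.centralM 0 = 1 := Subtype.ext (by
  change S.M (ℓ • 0) = 1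
  rw [smul_zero, S.M_zero])

theorem centralM_add (f g : Fin N → ℤ) : h.centralM (f + g) = h.centralM f * h.centralM g :=
  Subtype.ext (h.M_smul_add f g)

theorem centralM_nsmul (n : ℕ) (f : Fin N → ℤ) : h.centralM (n • f) = h.centralM f ^ n := by
  induction n with
  | zero => rw [zero_smul, pow_zero, h.centralM_zero]
  | succ n ih => rw [succ_nsmul, h.centralM_add, ih, pow_succ]

theorem centralM_mem {B : Subalgebra k (Subalgebra.center k F)} {f : Fin N → ℤ}
    (hB : ∀ i, h.centralM (Pi.single i 1) ∈ B)
    (hB' : ∀ i, f i < 0 → h.centralM (-Pi.single i 1) ∈ B) : h.centralM f ∈ B := by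
  refine mem_of_smul_single_mem (u := h.centralM) (by rw [h.centralM_zero]; exact one_mem _)
    (fun f g => ⟨1, by rw [one_smul, h.centralM_add]⟩) fun i => ?_
  rcases le_or_gt 0 (f i) with hi | hi
  · obtain ⟨n, hn⟩ := Int.eq_ofNat_of_zero_le hi
    rw [hn, natCast_zsmul, h.centralM_nsmul]
    exact _root_.pow_mem (hB i) n
  · obtain ⟨n, hn⟩ := Int.eq_ofNat_of_zero_le (neg_nonneg.2 hi.le)
    rw [← neg_neg (f i), hn, neg_smul, natCast_zsmul, ← smul_neg, h.centralM_nsmul]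
    exact _root_.pow_mem (hB' i hi) n

theorem centralM_single_iff (z : Subalgebra.center k F) (i : Fin N) :
    (z : F) = S.M (Pi.single i 1) ^ ℓ ↔ z = h.centralM (Pi.single i 1) := by
  have h1 : S.M (ℓ • Pi.single i 1) = S.M (Pi.single i 1) ^ ℓ := by
    rw [← zpow_natCast, ← S.M_single]
    congr 1
    funext a
    by_cases ha : a = i
    · subst ha; simp
    · simp [ha]
  rw [← h1, Subtype.ext_iff]
  rfl

include hodd in
theorem centralM_neg_single_iff (z : Subalgebra.center k F) (i : Fin N) :
    (z : F) = (S.M (Pi.single i 1) ^ ℓ)⁻¹ ↔ z = h.centralM (-Pi.single i 1) := by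
  rw [← h.M_nsmul hodd, ← h.M_neg hodd, ← smul_neg, Subtype.ext_iff]
  rfl

theorem mem_of_mem_frameSpan_multiples {B : Subalgebra k (Subalgebra.center k F)}
    {P : Set (Fin N → ℤ)} (hB : ∀ f, ℓ • f ∈ P → h.centralM f ∈ B) {z : Subalgebra.center k F}
    (hz : (z : F) ∈ S.frameSpan k (multiples ℓ N ∩ P)) : z ∈ B := by
  have key : ∀ x ∈ S.frameSpan k (multiples ℓ N ∩ P), ∃ y ∈ B, (y : F) = x := by
    intro x hx
    induction hx using frameSpan_induction with
    | mem f hf =>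
      obtain ⟨⟨f, rfl⟩, hf⟩ := hf
      exact ⟨_, hB f hf, rfl⟩
    | zero => exact ⟨0, zero_mem _, rfl⟩
    | add a b _ _ ha hb =>
      obtain ⟨x, hx, rfl⟩ := ha
      obtain ⟨y, hy, rfl⟩ := hb
      exact ⟨x + y, add_mem hx hy, rfl⟩
    | smul c a _ ha =>
      obtain ⟨x, hx, rfl⟩ := ha
      exact ⟨c • x, B.smul_mem hx c, rfl⟩
  obtain ⟨y, hy, hyz⟩ := key z hz
  rwa [← Subtype.ext hyz]

theorem mem_frameSpan_of_mem_adjoin {G : Set (Subalgebra.center k F)} {P : Set (Fin N → ℤ)}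
    (h0 : 0 ∈ P) (hP : ∀ f ∈ P, ∀ g ∈ P, f + g ∈ P)
    (hG : ∀ z ∈ G, (z : F) ∈ S.frameSpan k P) {z : Subalgebra.center k F}
    (hz : z ∈ Algebra.adjoin k G) : (z : F) ∈ S.frameSpan k P := by
  induction hz using Algebra.adjoin_induction with
  | mem z hz => exact hG z hz
  | algebraMap c =>
    rw [Algebra.algebraMap_eq_smul_one]
    exact Submodule.smul_mem _ c (one_mem_frameSpan h0)
  | add x y _ _ hx hy => exact add_mem hx hy
  | mul x y _ _ hx hy => exact h.mul_mem_frameSpan hP hx hy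

include hodd in
theorem mem_centralMixedTorus_iff {z : Subalgebra.center k F} :
    z ∈ S.centralMixedTorus k inv ↔
      (z : F) ∈ S.frameSpan k (multiples ℓ N ∩ nonnegOn (nonInverted ex inv)) := by
  have hℓ : 0 < ℓ := Nat.pos_of_ne_zero (NeZero.ne ℓ)
  constructor
  · refine h.mem_frameSpan_of_mem_adjoin
      (P := multiples ℓ N ∩ nonnegOn (nonInverted ex inv))
      ⟨⟨0, smul_zero _⟩, fun _ _ => le_rfl⟩ ?_ ?_
    · rintro _ ⟨⟨f, rfl⟩, hf⟩ _ ⟨⟨g, rfl⟩, hg⟩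
      exact ⟨⟨f + g, smul_add _ _ _⟩, fun a ha => add_nonneg (hf a ha) (hg a ha)⟩
    · rintro z (⟨i, hz⟩ | ⟨i, hi, hz⟩)
      · rw [h.centralM_single_iff] at hz
        rw [hz]
        refine M_mem_frameSpan ⟨⟨_, rfl⟩, fun a _ => ?_⟩
        by_cases ha : a = i
        · subst ha; simp
        · simp [ha]
      · rw [h.centralM_neg_single_iff hodd] at hz
        rw [hz]
        refine M_mem_frameSpan ⟨⟨_, rfl⟩, fun a ha => ?_⟩
        have ha : a ≠ i := by rintro rfl; exact ha hi
        simp [ha]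
  · refine h.mem_of_mem_frameSpan_multiples fun f hf => ?_
    refine h.centralM_mem (fun i => Algebra.subset_adjoin (Or.inl ⟨i, ?_⟩))
      fun i hi => Algebra.subset_adjoin (Or.inr ⟨i, ?_, ?_⟩)
    · rw [h.centralM_single_iff]
    · by_contra hi'
      have := hf i hi'
      rw [Pi.smul_apply, nsmul_eq_mul] at this
      have h2 : (0 : ℤ) < ℓ := by exact_mod_cast hℓ
      nlinarith
    · rw [h.centralM_neg_single_iff hodd]

/-- Denominators are cleared by a central monomial with nonnegative exponents, so a common
multiplier for a sum is the product of two. Used for both `CU(Θ)` and `U(Θ)`. -/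
theorem exists_M_smul_mul_mem {B : Subalgebra k F} (hB : ∀ f, 0 ≤ f → S.M (ℓ • f) ∈ B)
    {P : Set (Fin N → ℤ)} (hP : ∀ f ∈ P, ∃ g, 0 ≤ g ∧ S.M (ℓ • g + f) ∈ B) {z : F}
    (hz : z ∈ S.frameSpan k P) : ∃ g, 0 ≤ g ∧ S.M (ℓ • g) * z ∈ B := by
  induction hz using frameSpan_induction with
  | mem f hf =>
    obtain ⟨g, hg, hgB⟩ := hP f hf
    exact ⟨g, hg, by rwa [h.M_smul_mul_M]⟩
  | zero => exact ⟨0, le_rfl, by rw [mul_zero]; exact zero_mem _⟩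
  | add a b _ _ ha hb =>
    obtain ⟨f, hf, hfB⟩ := ha
    obtain ⟨g, hg, hgB⟩ := hb
    refine ⟨f + g, add_nonneg hf hg, ?_⟩
    rw [mul_add, h.M_smul_add]
    nth_rewrite 1 [← h.M_smul_add]
    rw [add_comm f g, h.M_smul_add, mul_assoc, mul_assoc]
    exact add_mem (B.mul_mem (hB g hg) hfB) (B.mul_mem (hB f hf) hgB)
  | smul c a _ ha =>
    obtain ⟨g, hg, hgB⟩ := ha
    exact ⟨g, hg, by rw [mul_smul_comm]; exact B.smul_mem hgB c⟩

end IsToricFrame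

theorem mutationClass_trans {T : QuantumSeed ℓ N ex F} (hT : T ∈ S.mutationClass q) :
    T.mutationClass q ⊆ S.mutationClass q := by
  obtain ⟨w, rfl⟩ := hT
  rintro _ ⟨v, rfl⟩
  exact ⟨w ++ v, mutateList_append _ _ _⟩

theorem self_mem_mutationClass : S ∈ S.mutationClass q := ⟨[], rfl⟩

namespace IsRootOfUnityQuantumSeed

variable {D : ex → ℕ} (hS : S.IsRootOfUnityQuantumSeed q D) [NeZero ℓ] [CharZero k]
variable (hq : IsPrimitiveRoot q ℓ) (hodd : Odd ℓ) 
include hS hq hodd 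

theorem of_mem_mutationClass {T : QuantumSeed ℓ N ex F} (hT : T ∈ S.mutationClass q) :
    T.IsRootOfUnityQuantumSeed q D := by
  obtain ⟨w, rfl⟩ := hT
  exact hS.mutateList hq hodd w

theorem mem_mutationClass_symm {T : QuantumSeed ℓ N ex F} (hT : T ∈ S.mutationClass q) :
    S ∈ T.mutationClass q := by
  obtain ⟨w, rfl⟩ := hT
  exact ⟨w.reverse, hS.mutateList_reverse hq hodd w⟩

theorem mutationClass_eq {T : QuantumSeed ℓ N ex F} (hT : T ∈ S.mutationClass q) :
    T.mutationClass q = S.mutationClass q :=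
  (mutationClass_trans hT).antisymm (mutationClass_trans (hS.mem_mutationClass_symm hq hodd hT))

variable (hcop : ∀ i, Nat.Coprime ℓ (D i))
variable {Θ : Set (QuantumSeed ℓ N ex F)} (hΘ : Θ ⊆ S.mutationClass q)
include hcop hΘ

/-- The Laurent phenomenon, applied at each seed of `Θ` to a path leading back to `S`. -/
theorem centralM_single_mem_interCU (i : Fin N) :
    hS.frame.centralM (Pi.single i 1) ∈ interCU k inv Θ := by
  simp only [interCU, Algebra.mem_iInf]
  intro T hT
  have hT' := hS.of_mem_mutationClass hq hodd (hΘ hT)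
  rw [hT'.frame.mem_centralMixedTorus_iff hodd]
  obtain ⟨w, hw⟩ := hS.mem_mutationClass_symm hq hodd (hΘ hT)
  change S.M (ℓ • Pi.single i 1) ∈ _
  rw [← hw]
  exact hT'.M_smul_mutateList_mem hq hodd hcop not_mem_nonInverted w i

theorem centralM_mem_interCU {f : Fin N → ℤ} (hf : 0 ≤ f) :
    hS.frame.centralM f ∈ interCU k inv Θ :=
  hS.frame.centralM_mem (fun i => hS.centralM_single_mem_interCU hq hodd hcop hΘ i)
    fun i hi => absurd (hf i) (not_le.2 hi)

theorem M_mem_interU {f : Fin N → ℤ} (hf : 0 ≤ f) : S.M f ∈ interU k inv Θ := by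
  refine mem_of_smul_single_mem (u := S.M) (by rw [S.M_zero]; exact one_mem _)
    (fun f g => ⟨_, hS.frame.M_add hq f g⟩) fun i => ?_
  obtain ⟨n, hn⟩ := Int.eq_ofNat_of_zero_le (hf i)
  rw [hn, natCast_zsmul, hS.frame.M_nsmul hodd]
  refine pow_mem ?_ n
  simp only [interU, Algebra.mem_iInf]
  intro T hT
  have hT' := hS.of_mem_mutationClass hq hodd (hΘ hT)
  rw [hT'.frame.mem_mixedTorus_iff]
  obtain ⟨w, hw⟩ := hS.mem_mutationClass_symm hq hodd (hΘ hT)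
  rw [← hw]
  exact hT'.M_mutateList_mem hq hodd hcop not_mem_nonInverted w [] i

omit hcop hΘ hq in
theorem mem_frameSpan_of_mem_interCU (hST : S ∈ Θ) {z : Subalgebra.center k F}
    (hz : z ∈ interCU k inv Θ) : (z : F) ∈ S.frameSpan k (multiples ℓ N) := by
  simp only [interCU, Algebra.mem_iInf] at hz
  exact frameSpan_mono Set.inter_subset_left
    ((hS.frame.mem_centralMixedTorus_iff hodd).1 (hz S hST))

omit hcop hΘ hq hodd in
theorem mem_frameSpan_of_mem_interU (hST : S ∈ Θ) {z : F}
    (hz : z ∈ interU k inv Θ) : z ∈ S.frameSpan k Set.univ := by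
  simp only [interU, Algebra.mem_iInf] at hz
  exact mem_frameSpan_univ (hS.frame.mem_mixedTorus_iff.1 (hz S hST))

theorem centralM_mem_locCU (f : Fin N → ℤ) : hS.frame.centralM f ∈ locCU k inv Θ S := by
  refine hS.frame.centralM_mem (fun i => ?_) fun i hi => ?_
  · exact (le_sup_left : _ ≤ locCU k inv Θ S)
      (hS.centralM_single_mem_interCU hq hodd hcop hΘ i)
  · refine (le_sup_right : _ ≤ locCU k inv Θ S) (Algebra.subset_adjoin ⟨i, ?_⟩)
    rw [hS.frame.centralM_neg_single_iff hodd]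

/-- `CU(Θ)` lies in the Laurent ring of `S` because `S ∈ Θ`, and it contains all `M(e_i)^ℓ` by the
Laurent phenomenon. Inverting these leaves exactly the Laurent ring. -/
theorem mem_locCU_iff (hST : S ∈ Θ) {z : Subalgebra.center k F} :
    z ∈ locCU k inv Θ S ↔ (z : F) ∈ S.frameSpan k (multiples ℓ N) := by
  constructor
  · rw [locCU, ← Algebra.adjoin_eq (interCU k inv Θ), ← Algebra.adjoin_union]
    refine hS.frame.mem_frameSpan_of_mem_adjoin (P := multiples ℓ N) ⟨0, smul_zero _⟩ ?_ ?_
    · rintro _ ⟨f, rfl⟩ _ ⟨g, rfl⟩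
      exact ⟨f + g, smul_add _ _ _⟩
    · rintro z (hz | ⟨i, hz⟩)
      · exact hS.mem_frameSpan_of_mem_interCU hodd hST hz
      · rw [hS.frame.centralM_neg_single_iff hodd] at hz
        rw [hz]
        exact M_mem_frameSpan ⟨_, rfl⟩
  · intro hz
    rw [← Set.inter_univ (multiples ℓ N)] at hz
    exact hS.frame.mem_of_mem_frameSpan_multiples
      (fun f _ => hS.centralM_mem_locCU hq hodd hcop hΘ f) hz

theorem exists_centralM_mul_mem_interCU (hST : S ∈ Θ) {z : Subalgebra.center k F}
    (hz : z ∈ locCU k inv Θ S) :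
    ∃ g, 0 ≤ g ∧ hS.frame.centralM g * z ∈ interCU k inv Θ := by
  rw [hS.mem_locCU_iff hq hodd hcop hΘ hST] at hz
  obtain ⟨g, hg, y, hy, hyz⟩ := hS.frame.exists_M_smul_mul_mem
    (B := (interCU k inv Θ).map (Subalgebra.center k F).val)
    (fun f hf => ⟨_, hS.centralM_mem_interCU hq hodd hcop hΘ hf, rfl⟩)
    (P := multiples ℓ N) (by
      rintro _ ⟨f, rfl⟩
      refine ⟨fun i => |f i|, fun i => abs_nonneg _, hS.frame.centralM ((fun i => |f i|) + f),
        hS.centralM_mem_interCU hq hodd hcop hΘ fun i => ?_, ?_⟩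
      · have := neg_abs_le (f i)
        change 0 ≤ |f i| + f i
        omega
      · dsimp only
        rw [← smul_add]
        rfl) hz
  refine ⟨g, hg, ?_⟩
  have : hS.frame.centralM g * z = y := Subtype.ext hyz.symm
  rwa [this]

end IsRootOfUnityQuantumSeed

end QuantumSeed

/-! ### Fibres of an order over the points of a torus -/

section Fibre

variable {k : Type*} [Field k] {ℓ N : ℕ} [NeZero ℓ]

namespace IsTwistedSpanning

variable {A : Type*} [Ring A] [Algebra k A]
variable {q : k} {Λ : LinearMap.BilinMap ℤ (Fin N → ℤ) (ZMod ℓ)} {u : (Fin N → ℤ) → A}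

theorem span_repr (h : IsTwistedSpanning q Λ u) :
    Submodule.span k (Set.range fun x : Fin N → ZMod ℓ => u (residueRepr ℓ x)) = ⊤ := by
  rw [eq_top_iff, ← h.span, Submodule.span_le]
  rintro _ ⟨f, rfl⟩
  obtain ⟨g, hg⟩ := exists_eq_repr_add (ℓ := ℓ) f
  obtain ⟨c, -, hc, -⟩ := h.add_smul (residueRepr ℓ fun i => (f i : ZMod ℓ)) g
  rw [← hg] at hc
  rw [hc]
  exact Submodule.smul_mem _ _ (Submodule.subset_span ⟨_, rfl⟩)

theorem finiteDimensional (h : IsTwistedSpanning q Λ u) : FiniteDimensional k A :=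
  ⟨⟨(Set.finite_range fun x : Fin N → ZMod ℓ => u (residueRepr ℓ x)).toFinset, by
    rw [Set.Finite.coe_toFinset]; exact h.span_repr⟩⟩

theorem finrank_le (h : IsTwistedSpanning q Λ u) : Module.finrank k A ≤ ℓ ^ N := by
  have h1 := finrank_range_le_card (R := k) fun x : Fin N → ZMod ℓ => u (residueRepr ℓ x)
  rw [Set.finrank, h.span_repr, finrank_top, Fintype.card_fun, ZMod.card, Fintype.card_fin] at h1
  exact h1

/-- A point of a quantum torus defines a quotient of each order in the torus which contains
sufficiently many elements. -/
theorem of_order {R : Type*} [Ring R] [Algebra k R] (π : R →ₐ[k] A) (hπ : Function.Surjective π)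
    (halt : ∀ f, Λ f f = 0) (v : (Fin N → ℤ) → R) (h0 : v 0 = 1)
    (hmul : ∀ f g, 0 ≤ f → 0 ≤ g → v f * v g = zmodPow q (Λ f g) • v (f + g))
    (χ : (Fin N → ℤ) → k) (hχ0 : χ 0 = 1) (hχ : ∀ f g, χ (f + g) = χ f * χ g)
    (hvχ : ∀ f, 0 ≤ f → π (v (ℓ • f)) = algebraMap k A (χ f))
    (hspan : ∀ r, ∃ g, 0 ≤ g ∧ v (ℓ • g) * r ∈ Submodule.span k (v '' {f | 0 ≤ f})) :
    ∃ u : (Fin N → ℤ) → A, IsTwistedSpanning q Λ u ∧ ∀ f, 0 ≤ f → u f = π (v f) := by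
  have hχne : ∀ f, χ f ≠ 0 := by
    intro f e
    have h1 := hχ f (-f)
    rw [add_neg_cancel, hχ0, e, zero_mul] at h1
    exact one_ne_zero h1
  have hΛl : ∀ f g, Λ (ℓ • f) g = 0 := by
    intro f g
    rw [map_nsmul, LinearMap.smul_apply, nsmul_eq_mul, ZMod.natCast_self, zero_mul]
  have hΛr : ∀ f g, Λ f (ℓ • g) = 0 := by
    intro f g
    rw [map_nsmul, nsmul_eq_mul, ZMod.natCast_self, zero_mul]
  have hℓ : ∀ f : Fin N → ℤ, 0 ≤ f → 0 ≤ ℓ • f := fun f hf => smul_nonneg (Nat.zero_le ℓ) hf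
  have hℓ1 : (1 : ℤ) ≤ ℓ := by exact_mod_cast (NeZero.one_le : 1 ≤ ℓ)
  have habs : ∀ f : Fin N → ℤ, 0 ≤ |f| := fun f => abs_nonneg f
  have habs' : ∀ f : Fin N → ℤ, 0 ≤ ℓ • |f| + f := by
    intro f i
    have := neg_abs_le (f i)
    rw [Pi.add_apply, Pi.smul_apply, nsmul_eq_mul, Pi.abs_apply]
    change 0 ≤ (ℓ : ℤ) * |f i| + f i
    nlinarith [abs_nonneg (f i)]
  -- The order is only known to contain monomials with nonnegative exponents, so `f` is shifted by
  -- `ℓ|f|` into the positive orthant and the value `χ |f|` of the shift is divided out.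
  let u : (Fin N → ℤ) → A := fun f => (χ |f|)⁻¹ • π (v (ℓ • |f| + f))
  -- Any other admissible shift gives the same element; all required properties of `u` follow from
  -- this independence.
  have key : ∀ f a, 0 ≤ a → 0 ≤ ℓ • a + f → π (v (ℓ • a + f)) = χ a • u f := by
    intro f a ha haf
    have h1 := congrArg π (hmul (ℓ • |f|) (ℓ • a + f) (hℓ _ (habs f)) haf)
    have h2 := congrArg π (hmul (ℓ • a) (ℓ • |f| + f) (hℓ _ ha) (habs' f))
    rw [hΛl, zmodPow_zero, one_smul, map_mul, hvχ _ (habs f), ← Algebra.smul_def] at h1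
    rw [hΛl, zmodPow_zero, one_smul, map_mul, hvχ _ ha, ← Algebra.smul_def, add_left_comm,
      ← h1] at h2
    change _ = χ a • (χ |f|)⁻¹ • _
    rw [smul_comm, h2, smul_smul, inv_mul_cancel₀ (hχne _), one_smul]
  have key0 : ∀ f, 0 ≤ f → u f = π (v f) := by
    intro f hf
    have := key f 0 le_rfl (by rw [smul_zero, zero_add]; exact hf)
    rw [smul_zero, zero_add, hχ0, one_smul] at this
    exact this.symm
  refine ⟨u, ⟨?_, fun f g => ?_, halt, fun f => ⟨χ f, ?_⟩, ?_⟩, key0⟩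
  · rw [key0 0 le_rfl, h0, map_one]
  · have h1 := congrArg π (hmul _ _ (habs' f) (habs' g))
    have h2 : ℓ • |f| + f + (ℓ • |g| + g) = ℓ • (|f| + |g|) + (f + g) := by
      rw [smul_add]; abel
    have h3 : Λ (ℓ • |f| + f) (ℓ • |g| + g) = Λ f g := by
      rw [map_add, map_add, LinearMap.add_apply, hΛl, hΛr, LinearMap.add_apply, hΛl]
      ring
    rw [h2, h3, map_mul, map_smul, key f _ (habs f) (habs' f), key g _ (habs g) (habs' g),
      key (f + g) _ (add_nonneg (habs f) (habs g)) (by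
        rw [← h2]; exact add_nonneg (habs' f) (habs' g)), hχ, smul_mul_smul_comm,
      smul_comm (zmodPow q _)] at h1
    exact smul_right_injective A (mul_ne_zero (hχne |f|) (hχne |g|)) h1
  · have h1 : 0 ≤ |f| + f := fun i => by
      have := neg_abs_le (f i)
      change 0 ≤ |f i| + f i
      omega
    have h2 := key (ℓ • f) |f| (habs f) (by rw [← smul_add]; exact hℓ _ h1)
    rw [← smul_add, hvχ _ h1, hχ, Algebra.algebraMap_eq_smul_one, mul_smul] at h2
    rw [Algebra.algebraMap_eq_smul_one]
    exact (smul_right_injective A (hχne |f|) h2).symm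
  · rw [eq_top_iff]
    rintro a -
    obtain ⟨r, rfl⟩ := hπ a
    obtain ⟨g, hg, hgr⟩ := hspan r
    have h1 : π (v (ℓ • g) * r) ∈ Submodule.span k (Set.range u) := by
      refine (Submodule.map_span_le π.toLinearMap _ _).2 ?_ ⟨_, hgr, rfl⟩
      rintro _ ⟨f, hf, rfl⟩
      exact Submodule.subset_span ⟨f, key0 f hf⟩
    rw [map_mul, hvχ g hg, ← Algebra.smul_def] at h1
    have h2 := Submodule.smul_mem _ (χ g)⁻¹ h1
    rwa [smul_smul, inv_mul_cancel₀ (hχne g), one_smul] at h2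

end IsTwistedSpanning

end Fibre

/-- The Nullstellensatz: the residue field is finite over the algebraically closed field `k`. -/
theorem exists_algHom_of_isMaximal {k L : Type*} [Field k] [IsAlgClosed k] [CommRing L]
    [Algebra k L] [Algebra.FiniteType k L] (n : Ideal L) [n.IsMaximal] :
    ∃ ψ : L →ₐ[k] k, n = RingHom.ker ψ := by
  let := Ideal.Quotient.field n
  have := finite_of_finite_type_of_isJacobsonRing k (L ⧸ n)
  let e : k ≃ₐ[k] (L ⧸ n) := AlgEquiv.ofBijective (Algebra.ofId k _)
    (IsAlgClosed.algebraMap_bijective_of_isIntegral)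
  refine ⟨e.symm.toAlgHom.comp (Ideal.Quotient.mkₐ k n), ?_⟩
  ext x
  rw [RingHom.mem_ker]
  change _ ↔ e.symm (Ideal.Quotient.mk n x) = 0
  rw [EmbeddingLike.map_eq_zero_iff, Ideal.Quotient.eq_zero_iff_mem]

theorem isTwoSided_extendedIdeal {C R : Type u} [CommRing C] [Ring R] {ι : C →+* R}
    (hι : ∀ c r, Commute (ι c) r) (m : Ideal C) : (extendedIdeal ι m).IsTwoSided := by
  refine ⟨fun {a} b ha => ?_⟩
  induction ha using Submodule.span_induction with
  | mem a ha =>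
    obtain ⟨c, hc, rfl⟩ := ha
    rw [(hι c b).eq]
    exact Ideal.mul_mem_left _ _ (Ideal.subset_span ⟨c, hc, rfl⟩)
  | zero => rw [zero_mul]; exact zero_mem _
  | add x y _ _ hx hy => rw [add_mul]; exact add_mem hx hy
  | smul r x _ hx => rw [smul_eq_mul, mul_assoc]; exact Ideal.mul_mem_left _ _ hx

/-! ### The rank of the division algebra over its centre -/

namespace QuantumSeed

variable {ℓ N : ℕ} {ex inv : Finset (Fin N)} {F : Type u} [DivisionRing F]
variable {k : Type u} [Field k] [Algebra k F] {q : k} {S : QuantumSeed ℓ N ex F}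

theorem commute_cuToU (Θ : Set (QuantumSeed ℓ N ex F)) (c : interCU k inv Θ)
    (r : interU k inv Θ) : Commute ((cuToU k inv Θ).toRingHom c) r :=
  Subtype.ext (Subalgebra.mem_center_iff.1 c.1.2 r.1).symm

namespace IsToricFrame

variable [NeZero ℓ] (h : S.IsToricFrame q) (hq : IsPrimitiveRoot q ℓ) (hodd : Odd ℓ)
include h hq hodd

/-- Monomials from `Ker Λ` are central, so the span `W` of coset representatives over the centre
contains the quantum torus. It is closed under products and inverses, hence contains all fractions.
-/
theorem finrank_center_le : FiniteDimensional (Subring.center F) F ∧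
    Module.finrank (Subring.center F) F ≤ S.ker.index := by
  have hmem : ∀ f ∈ S.ker, S.M f ∈ Subring.center F := by
    intro f hf
    have h1 : ∀ g, S.M f * S.M g = S.M g * S.M f := by
      intro g
      rw [h.M_mul_comm hq, show S.Λ f g = 0 from LinearMap.congr_fun (LinearMap.mem_ker.1 hf) g,
        mul_zero, zmodPow_zero, one_smul]
    have h2 : ∀ z ∈ Submodule.span k (Set.range S.M), S.M f * z = z * S.M f := by
      intro z hz
      induction hz using Submodule.span_induction with
      | mem z hz => obtain ⟨g, rfl⟩ := hz; exact h1 g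
      | zero => simp
      | add a b _ _ ha hb => rw [mul_add, ha, hb, add_mul]
      | smul c a _ ha => rw [mul_smul_comm, ha, smul_mul_assoc]
    rw [Subring.mem_center_iff]
    intro z
    obtain ⟨a, ha, b, hb, -, rfl⟩ := h.fractions z
    exact (Commute.mul_right (h2 a ha) (Commute.inv_right₀ (h2 b hb))).eq.symm
  have hk : ∀ c : k, algebraMap k F c ∈ Subring.center F := fun c =>
    Subring.mem_center_iff.2 fun z => (Algebra.commutes c z).symm
  let v : (Fin N → ℤ) ⧸ S.ker → F := fun x => S.M x.out
  set W := Submodule.span (Subring.center F) (Set.range v) with hW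
  have hkW : ∀ (c : k), ∀ z ∈ W, c • z ∈ W := by
    intro c z hz
    rw [Algebra.smul_def]
    exact W.smul_mem ⟨_, hk c⟩ hz
  have hMW : ∀ f, S.M f ∈ W := by
    intro f
    let x : (Fin N → ℤ) ⧸ S.ker := QuotientAddGroup.mk f
    have hx : -x.out + f ∈ S.ker := by
      rw [← QuotientAddGroup.eq, QuotientAddGroup.out_eq']
    have h1 := h.M_add hq (-x.out + f) x.out
    rw [add_comm, add_neg_cancel_left] at h1
    rw [h1]
    exact hkW _ _ (W.smul_mem ⟨_, hmem _ hx⟩ (Submodule.subset_span ⟨x, rfl⟩))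
  have hmulW : ∀ a ∈ W, ∀ b ∈ W, a * b ∈ W := by
    intro a ha b hb
    induction ha using Submodule.span_induction with
    | mem a ha =>
      obtain ⟨x, rfl⟩ := ha
      induction hb using Submodule.span_induction with
      | mem b hb =>
        obtain ⟨y, rfl⟩ := hb
        change S.M _ * S.M _ ∈ _
        rw [h.mul]
        exact hkW _ _ (hMW _)
      | zero => rw [mul_zero]; exact zero_mem _
      | add b c _ _ hb hc => rw [mul_add]; exact add_mem hb hc
      | smul z b _ hb => rw [mul_smul_comm]; exact W.smul_mem z hb
    | zero => rw [zero_mul]; exact zero_mem _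
    | add b c _ _ hb hc => rw [add_mul]; exact add_mem hb hc
    | smul z b _ hb => rw [smul_mul_assoc]; exact W.smul_mem z hb
  have hfin : Finite ((Fin N → ℤ) ⧸ S.ker) := by
    refine Finite.of_injective (fun x => (S.Λ x.out : (Fin N → ℤ) →ₗ[ℤ] ZMod ℓ) ∘
      fun i : Fin N => (Pi.single i 1 : Fin N → ℤ)) fun x y hxy => ?_
    rw [← QuotientAddGroup.out_eq' x, ← QuotientAddGroup.out_eq' y, QuotientAddGroup.eq]
    change S.Λ _ = 0
    refine LinearMap.pi_ext' fun i => LinearMap.ext_ring ?_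
    have := congrFun hxy i
    simp only [Function.comp_apply] at this
    change S.Λ _ (Pi.single i 1) = 0
    rw [map_add, map_neg, LinearMap.add_apply, LinearMap.neg_apply, this, neg_add_cancel]
  have hWfin : FiniteDimensional (Subring.center F) W :=
    FiniteDimensional.span_of_finite _ (Set.finite_range v)
  have hspan : ∀ a ∈ Submodule.span k (Set.range S.M), a ∈ W := by
    intro a ha
    induction ha using Submodule.span_induction with
    | mem z hz => obtain ⟨g, rfl⟩ := hz; exact hMW g
    | zero => exact zero_mem _
    | add a b _ _ ha hb => exact add_mem ha hb
    | smul c a _ ha => exact hkW c a ha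
  -- Multiplication by `b` is injective on the finite dimensional space `W`, hence surjective, and
  -- reaches `1`.
  have hinv : ∀ b ∈ W, b ≠ 0 → b⁻¹ ∈ W := by
    intro b hb hb0
    let L : W →ₗ[Subring.center F] W := (LinearMap.mulLeft (Subring.center F) b).restrict
      fun a ha => hmulW b hb a ha
    have hL : Function.Injective L := by
      intro x y hxy
      exact Subtype.ext (mul_left_cancel₀ hb0 (congrArg Subtype.val hxy))
    obtain ⟨⟨c, hc⟩, hbc⟩ := LinearMap.injective_iff_surjective.1 hL
      ⟨1, by rw [← S.M_zero]; exact hMW 0⟩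
    have h1 : b * c = 1 := congrArg Subtype.val hbc
    rwa [← eq_inv_of_mul_eq_one_right h1]
  have htop : W = ⊤ := by
    rw [eq_top_iff]
    rintro z -
    obtain ⟨a, ha, b, hb, hb0, rfl⟩ := h.fractions z
    exact hmulW _ (hspan a ha) _ (hinv b (hspan b hb) hb0)
  have : Fintype ((Fin N → ℤ) ⧸ S.ker) := Fintype.ofFinite _
  have h1 := finrank_range_le_card (R := Subring.center F) v
  rw [Set.finrank, ← hW, htop, finrank_top] at h1
  refine ⟨?_, h1.trans_eq ?_⟩
  · rw [htop] at hWfin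
    exact Submodule.topEquiv.finiteDimensional
  · rw [AddSubgroup.index, Nat.card_eq_fintype_card]

end IsToricFrame

end QuantumSeed

/-! ### Fibres of `U(Θ)` over the points of a torus -/

namespace QuantumSeed

variable {ℓ N : ℕ} {ex inv : Finset (Fin N)} {F : Type u} [DivisionRing F]
variable {k : Type u} [Field k] [Algebra k F] {q : k} {S : QuantumSeed ℓ N ex F}

namespace IsRootOfUnityQuantumSeed

variable {D : ex → ℕ} (hS : S.IsRootOfUnityQuantumSeed q D) [NeZero ℓ] [CharZero k]
variable (hq : IsPrimitiveRoot q ℓ) (hodd : Odd ℓ) (hcop : ∀ i, Nat.Coprime ℓ (D i))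
variable {Θ : Set (QuantumSeed ℓ N ex F)} (hΘ : Θ ⊆ S.mutationClass q) (hST : S ∈ Θ)
include hS hq hodd hcop hΘ

include hST in
theorem locCU_eq_adjoin : locCU k inv Θ S = Algebra.adjoin k
    (Set.range (fun i : Fin N => hS.frame.centralM (Pi.single i 1)) ∪
      Set.range fun i : Fin N => hS.frame.centralM (-Pi.single i 1)) := by
  refine le_antisymm (fun z hz => ?_) (Algebra.adjoin_le ?_)
  · rw [hS.mem_locCU_iff hq hodd hcop hΘ hST, ← Set.inter_univ (multiples ℓ N)] at hz
    exact hS.frame.mem_of_mem_frameSpan_multiples (fun f _ => hS.frame.centralM_mem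
      (fun i => Algebra.subset_adjoin (Or.inl ⟨i, rfl⟩))
      fun i _ => Algebra.subset_adjoin (Or.inr ⟨i, rfl⟩)) hz
  · rintro _ (⟨i, rfl⟩ | ⟨i, rfl⟩)
    · exact hS.centralM_mem_locCU hq hodd hcop hΘ _
    · exact hS.centralM_mem_locCU hq hodd hcop hΘ _

include hST in
theorem finiteType_locCU : Algebra.FiniteType k (locCU k inv Θ S) := by
  rw [← Subalgebra.fg_iff_finiteType, hS.locCU_eq_adjoin hq hodd hcop hΘ hST]
  exact Subalgebra.fg_def.2 ⟨_, (Set.finite_range _).union (Set.finite_range _), rfl⟩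

/-- The central element `M(ℓ f)` as an element of the localization of `CU(Θ)`. -/
def locM (inv : Finset (Fin N)) (f : Fin N → ℤ) : locCU k inv Θ S :=
  ⟨hS.frame.centralM f, hS.centralM_mem_locCU hq hodd hcop hΘ f⟩

theorem locM_add (f g : Fin N → ℤ) : hS.locM hq hodd hcop hΘ inv (f + g) =
    hS.locM hq hodd hcop hΘ inv f * hS.locM hq hodd hcop hΘ inv g :=
  Subtype.ext (hS.frame.centralM_add f g)

theorem locM_zero : hS.locM hq hodd hcop hΘ inv 0 = 1 := Subtype.ext hS.frame.centralM_zero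

theorem isUnit_locM (f : Fin N → ℤ) : IsUnit (hS.locM hq hodd hcop hΘ inv f) :=
  IsUnit.of_mul_eq_one (hS.locM hq hodd hcop hΘ inv (-f)) (by
    rw [← locM_add, add_neg_cancel, locM_zero])

include hST in
-- Every element of the localization becomes an element of `CU(Θ)` after multiplication by a unit
-- `M(ℓg)`, so an ideal is determined by its contraction.
theorem injective_comap_toLocCU : Function.Injective fun n : MaximalSpectrum (locCU k inv Θ S) =>
    n.asIdeal.comap (toLocCU k inv Θ S) := by
  have key : ∀ n n' : MaximalSpectrum (locCU k inv Θ S),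
      n.asIdeal.comap (toLocCU k inv Θ S) = n'.asIdeal.comap (toLocCU k inv Θ S) →
      n.asIdeal ≤ n'.asIdeal := by
    intro n n' h c hc
    obtain ⟨g, hg, hgc⟩ := hS.exists_centralM_mul_mem_interCU hq hodd hcop hΘ hST c.2
    have h1 : (⟨_, hgc⟩ : interCU k inv Θ) ∈ n.asIdeal.comap (toLocCU k inv Θ S) :=
      n.asIdeal.mul_mem_left (hS.locM hq hodd hcop hΘ inv g) hc
    rw [h] at h1
    exact (Ideal.unit_mul_mem_iff_mem n'.asIdeal (hS.isUnit_locM hq hodd hcop hΘ g)).1 h1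
  intro n n' h
  exact MaximalSpectrum.ext ((key n n' h).antisymm (key n' n h.symm))

variable (ψ : locCU k inv Θ S →ₐ[k] k)

/-- The maximal ideal of `CU(Θ)` at a point of the torus of a seed. -/
def pointIdeal (ψ : locCU k inv Θ S →ₐ[k] k) : Ideal (interCU k inv Θ) :=
  RingHom.ker (ψ.comp (toLocCU k inv Θ S))

omit hS hq hodd hcop hΘ [NeZero ℓ] [CharZero k] in
theorem isMaximal_pointIdeal : (pointIdeal ψ).IsMaximal :=
  RingHom.ker_isMaximal_of_surjective (ψ.comp (toLocCU k inv Θ S)) fun c =>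
    ⟨algebraMap k _ c, AlgHom.commutes _ c⟩

omit hS hq hodd hcop hΘ [NeZero ℓ] [CharZero k] in
theorem cuToU_sub_mem (c : interCU k inv Θ) :
    cuToU k inv Θ c - algebraMap k _ (ψ (toLocCU k inv Θ S c)) ∈
      extendedIdeal (cuToU k inv Θ).toRingHom (pointIdeal ψ) := by
  refine Ideal.subset_span ⟨c - algebraMap k _ (ψ (toLocCU k inv Θ S c)), ?_, ?_⟩
  · change ψ.comp (toLocCU k inv Θ S) _ = 0
    rw [map_sub, AlgHom.commutes]
    exact sub_self _
  · change cuToU k inv Θ _ = _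
    rw [map_sub, AlgHom.commutes]

include hST in
/-- A functional on the quantum torus which detects the fibre over a point. -/
theorem exists_functional : ∃ θ : F →ₗ[k] ((Fin N → ZMod ℓ) →₀ k),
    (∀ x : Fin N → ZMod ℓ, θ (S.M (IsTwistedSpanning.residueRepr ℓ x)) = Finsupp.single x 1) ∧
    ∀ r ∈ extendedIdeal (cuToU k inv Θ).toRingHom (pointIdeal ψ), θ r = 0 := by
  classical
  let χ : (Fin N → ℤ) → k := fun f => ψ (hS.locM hq hodd hcop hΘ inv f)
  have hχ : ∀ f g, χ (f + g) = χ f * χ g := fun f g => by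
    simp only [χ, locM_add, map_mul]
  let r : (Fin N → ℤ) → (Fin N → ZMod ℓ) := fun f i => (f i : ZMod ℓ)
  -- Divide `f` by `ℓ` with remainder: the quotient is evaluated at the point and the remainder
  -- indexes a basis vector. This makes `θ` linear over the localized centre acting through `ψ`.
  obtain ⟨θ, hθ⟩ := hS.frame.linearIndependent.exists_linearMap_apply
    fun f : Fin N → ℤ => χ (fun i => f i / ℓ) • Finsupp.single (r f) (1 : k)
  have hℓ : (ℓ : ℤ) ≠ 0 := by exact_mod_cast NeZero.ne ℓ
  have hmul : ∀ x ∈ S.frameSpan k (multiples ℓ N), ∃ c : locCU k inv Θ S,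
      ((c : Subalgebra.center k F) : F) = x ∧
      ∀ z ∈ S.frameSpan k Set.univ, θ (z * x) = ψ c • θ z := by
    intro x hx
    induction hx using frameSpan_induction with
    | mem g hg =>
      obtain ⟨g, rfl⟩ := hg
      refine ⟨hS.locM hq hodd hcop hΘ inv g, rfl, fun z hz => ?_⟩
      induction hz using frameSpan_induction with
      | mem f hf =>
        have h1 : (fun i => (f + ℓ • g) i / (ℓ : ℤ)) = (fun i => f i / (ℓ : ℤ)) + g := by
          funext i
          rw [Pi.add_apply, Pi.smul_apply, nsmul_eq_mul, Int.add_mul_ediv_left _ _ hℓ]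
          rfl
        have h2 : r (f + ℓ • g) = r f := by
          funext i
          simp [r]
        dsimp only
        rw [hS.frame.M_mul_M_smul, hθ, hθ, h1, h2, hχ, mul_comm, mul_smul]
      | zero => simp
      | add a b _ _ ha hb => rw [add_mul, map_add, ha, hb, map_add, smul_add]
      | smul c a _ ha => rw [smul_mul_assoc, map_smul, ha, map_smul, smul_comm]
    | zero => exact ⟨0, rfl, fun z _ => by simp⟩
    | add a b _ _ ha hb =>
      obtain ⟨x, rfl, hx⟩ := ha
      obtain ⟨y, rfl, hy⟩ := hb
      exact ⟨x + y, rfl, fun z hz => by rw [mul_add, map_add, hx z hz, hy z hz, map_add, add_smul]⟩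
    | smul c a _ ha =>
      obtain ⟨x, rfl, hx⟩ := ha
      exact ⟨c • x, rfl, fun z hz => by
        rw [mul_smul_comm, map_smul, hx z hz, map_smul, smul_assoc]⟩
  refine ⟨θ, fun x => ?_, fun y hy => ?_⟩
  · have h1 : (fun i => IsTwistedSpanning.residueRepr ℓ x i / (ℓ : ℤ)) = 0 := by
      funext i
      exact Int.ediv_eq_zero_of_lt (Int.natCast_nonneg _) (Int.ofNat_lt.2 (ZMod.val_lt (x i)))
    have h2 : r (IsTwistedSpanning.residueRepr ℓ x) = x := by
      funext i
      simp [r, IsTwistedSpanning.residueRepr]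
    have h3 : χ 0 = 1 := by simp only [χ, locM_zero, map_one]
    rw [hθ, h1, h2, h3, one_smul]
  -- Left multipliers `a` are included so that the claim passes through the left ideal generated by
  -- `m`.
  · have key : ∀ a : interU k inv Θ, θ ((a * y : interU k inv Θ) : F) = 0 := by
      induction hy using Submodule.span_induction with
      | mem y hy =>
        obtain ⟨c, hc, rfl⟩ := hy
        intro a
        obtain ⟨c', hc', hθc⟩ := hmul _ (hS.mem_frameSpan_of_mem_interCU hodd hST c.2)
        have h1 : c' = toLocCU k inv Θ S c := Subtype.ext (Subtype.ext hc')
        have h2 := hθc a (hS.mem_frameSpan_of_mem_interU hST a.2)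
        rw [h1, show ψ (toLocCU k inv Θ S c) = 0 from hc, zero_smul] at h2
        exact h2
      | zero => intro a; simp
      | add x y _ _ hx hy =>
        intro a
        rw [mul_add, Subalgebra.coe_add, map_add, hx, hy, add_zero]
      | smul b x _ hx =>
        intro a
        rw [smul_eq_mul, ← mul_assoc]
        exact hx (a * b)
    simpa using key 1

include hST in
-- The residue monomials span `U/mU`, and the functional `θ` shows that they are independent, so the
-- dimension is exactly `ℓ^N`. Counting dimensions in the block decomposition gives `n d^2 = ℓ^N`.
theorem exists_fibre [IsAlgClosed k] :
    ∃ n d : ℕ, 0 < d ∧ d ^ 2 = S.ker.index ∧ n * d ^ 2 = ℓ ^ N ∧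
      ∃ ρ : interU k inv Θ →ₐ[k] (Fin n → Matrix (Fin d) (Fin d) k), Function.Surjective ρ ∧
        ∀ r, ρ r = 0 ↔ r ∈ extendedIdeal (cuToU k inv Θ).toRingHom (pointIdeal ψ) := by
  classical
  set I := extendedIdeal (cuToU k inv Θ).toRingHom (pointIdeal ψ) with hI
  have : I.IsTwoSided := isTwoSided_extendedIdeal (commute_cuToU Θ) _
  let π : interU k inv Θ →ₐ[k] (interU k inv Θ ⧸ I) := Ideal.Quotient.mkₐ k I
  have hπ : Function.Surjective π := Ideal.Quotient.mk_surjective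
  have hπ0 : ∀ r, π r = 0 ↔ r ∈ I := fun r => Ideal.Quotient.eq_zero_iff_mem
  -- Only nonnegative exponents are guaranteed to give elements of `U(Θ)`; the default `0` elsewhere
  -- is never used.
  let v : (Fin N → ℤ) → interU k inv Θ := fun f =>
    if hf : 0 ≤ f then ⟨S.M f, hS.M_mem_interU hq hodd hcop hΘ hf⟩ else 0
  have hv : ∀ f, 0 ≤ f → (v f : F) = S.M f := fun f hf => by
    simp only [v, dif_pos hf]
  have hℓ : ∀ f : Fin N → ℤ, 0 ≤ f → 0 ≤ ℓ • f := fun f hf => smul_nonneg (Nat.zero_le ℓ) hf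
  have hspan0 : ∀ z ∈ S.frameSpan k {f | 0 ≤ f}, ∃ r ∈ Submodule.span k (v '' {f | 0 ≤ f}),
      (r : F) = z := by
    intro z hz
    induction hz using frameSpan_induction with
    | mem f hf => exact ⟨v f, Submodule.subset_span ⟨f, hf, rfl⟩, hv f hf⟩
    | zero => exact ⟨0, zero_mem _, rfl⟩
    | add a b _ _ ha hb =>
      obtain ⟨x, hx, rfl⟩ := ha
      obtain ⟨y, hy, rfl⟩ := hb
      exact ⟨x + y, add_mem hx hy, rfl⟩
    | smul c a _ ha =>
      obtain ⟨x, hx, rfl⟩ := ha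
      exact ⟨c • x, Submodule.smul_mem _ c hx, rfl⟩
  obtain ⟨u, hu, hu0⟩ := IsTwistedSpanning.of_order (q := q) (Λ := S.Λ) π hπ
    (hS.frame.Λ_self hodd) v (Subtype.ext (by rw [hv 0 le_rfl, S.M_zero]; rfl))
    (fun f g hf hg => Subtype.ext (by
      change (v f : F) * (v g : F) = _ • (v (f + g) : F)
      rw [hv f hf, hv g hg, hv _ (add_nonneg hf hg), hS.frame.mul]))
    (fun f => ψ (hS.locM hq hodd hcop hΘ inv f)) (by rw [locM_zero, map_one])
    (fun f g => by rw [locM_add, map_mul])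
    (by
      intro f hf
      have h1 : v (ℓ • f) = cuToU k inv Θ
          ⟨hS.frame.centralM f, hS.centralM_mem_interCU hq hodd hcop hΘ hf⟩ :=
        Subtype.ext (hv _ (hℓ f hf))
      have h2 := (hπ0 _).2 (cuToU_sub_mem ψ
        ⟨hS.frame.centralM f, hS.centralM_mem_interCU hq hodd hcop hΘ hf⟩)
      rw [map_sub, ← h1, AlgHom.commutes, sub_eq_zero] at h2
      exact h2)
    (by
      intro r
      have hadj : ∀ z, z ∈ Algebra.adjoin k (S.M '' {f | 0 ≤ f}) ↔
          z ∈ S.frameSpan k {f | 0 ≤ f} := fun z =>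
        hS.frame.adjoin_eq_frameSpan (P := {f | 0 ≤ f}) (le_refl (0 : Fin N → ℤ))
          fun f hf g hg => add_nonneg (Set.mem_ofPred.1 hf) (Set.mem_ofPred.1 hg)
      obtain ⟨g, hg, hgr⟩ := hS.frame.exists_M_smul_mul_mem
        (B := Algebra.adjoin k (S.M '' {f | 0 ≤ f}))
        (fun f hf => Algebra.subset_adjoin ⟨_, hℓ f hf, rfl⟩) (P := Set.univ)
        (fun f _ => ⟨|f|, abs_nonneg f, Algebra.subset_adjoin ⟨_, fun i => by
          have h1 : (1 : ℤ) ≤ ℓ := by exact_mod_cast (NeZero.one_le : 1 ≤ ℓ)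
          have := neg_abs_le (f i)
          rw [Pi.add_apply, Pi.smul_apply, nsmul_eq_mul, Pi.abs_apply]
          change 0 ≤ (ℓ : ℤ) * |f i| + f i
          nlinarith [abs_nonneg (f i)], rfl⟩⟩)
        (hS.mem_frameSpan_of_mem_interU hST r.2)
      rw [hadj] at hgr
      obtain ⟨y, hy, hyr⟩ := hspan0 _ hgr
      refine ⟨g, hg, ?_⟩
      have h1 : v (ℓ • g) * r = y := Subtype.ext (by
        rw [hyr, ← hv _ (hℓ g hg)]; rfl)
      rwa [h1])
  obtain ⟨θ, hθ1, hθ2⟩ := hS.exists_functional hq hodd hcop hΘ hST ψ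
  have hrepr : ∀ x : Fin N → ZMod ℓ, 0 ≤ IsTwistedSpanning.residueRepr ℓ x :=
    fun x i => Int.natCast_nonneg _
  have hfd : FiniteDimensional k (interU k inv Θ ⧸ I) := hu.finiteDimensional
  -- A relation in the quotient lifts to an element of `mU`, on which `θ` vanishes while reading off
  -- the coefficients.
  have hli : LinearIndependent k fun x : Fin N → ZMod ℓ =>
      π (v (IsTwistedSpanning.residueRepr ℓ x)) := by
    rw [Fintype.linearIndependent_iff]
    intro c hc x
    simp_rw [← map_smul, ← map_sum, hπ0] at hc
    have h1 := hθ2 _ hc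
    rw [AddSubmonoidClass.coe_finsetSum, map_sum] at h1
    have h2 : ∀ y : Fin N → ZMod ℓ,
        θ ((c y • v (IsTwistedSpanning.residueRepr ℓ y) : interU k inv Θ) : F) =
        Finsupp.single y (c y) := by
      intro y
      rw [Subalgebra.coe_smul, map_smul, hv _ (hrepr y), hθ1, Finsupp.smul_single, smul_eq_mul,
        mul_one]
    simp_rw [h2] at h1
    have h3 := DFunLike.congr_fun h1 x
    rw [Finsupp.finsetSum_apply, Finset.sum_eq_single x] at h3
    · simpa using h3
    · intro y _ hy
      rw [Finsupp.single_eq_of_ne hy.symm]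
    · simp
  have hrank : Module.finrank k (interU k inv Θ ⧸ I) = ℓ ^ N := by
    refine le_antisymm hu.finrank_le ?_
    have := hli.fintype_card_le_finrank
    rwa [Fintype.card_fun, ZMod.card, Fintype.card_fin] at this
  have hnt : Nontrivial (interU k inv Θ ⧸ I) := by
    refine Module.nontrivial_of_finrank_pos (R := k) ?_
    rw [hrank]
    exact pow_pos (Nat.pos_of_ne_zero (NeZero.ne ℓ)) N
  obtain ⟨n, d, ⟨e⟩, hd, hd0⟩ := hu.exists_algEquiv_pi_matrix hq hodd
  refine ⟨n, d, hd0, hd, ?_, e.toAlgHom.comp π, e.surjective.comp hπ, fun r => ?_⟩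
  · rw [← hrank, e.toLinearEquiv.finrank_eq, Module.finrank_pi_fintype]
    simp [Module.finrank_matrix, sq]
  · rw [← hπ0]
    exact map_eq_zero_iff e e.injective

end IsRootOfUnityQuantumSeed

end QuantumSeed

/-! ### The fully Azumaya locus -/

namespace QuantumSeed

variable {ℓ N : ℕ} {ex inv : Finset (Fin N)} {F : Type u} [DivisionRing F]
variable {k : Type u} [Field k] [Algebra k F] {q : k} {S : QuantumSeed ℓ N ex F}

namespace IsRootOfUnityQuantumSeed

variable {D : ex → ℕ} (hS : S.IsRootOfUnityQuantumSeed q D) [NeZero ℓ] [CharZero k]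
include hS

omit [NeZero ℓ] [CharZero k] in
theorem surjective_mutationMap (j : ex) : Function.Surjective (S.mutationMap j) := by
  intro f
  refine ⟨(S.mutate q j).mutationMap j (f + f j.1 • S.col j), ?_⟩
  have h : S.col j j.1 = 0 := hS.skew.diag j
  rw [hS.mutationMap_mutationMap, Pi.add_apply, Pi.smul_apply, h, smul_zero, add_zero,
    add_sub_cancel_right]

omit [NeZero ℓ] [CharZero k] in
-- The new radical is the preimage of the old one under the surjective exponent map of the mutation.
theorem index_ker_mutate (j : ex) : (S.mutate q j).ker.index = S.ker.index := by
  have h1 := hS.surjective_mutationMap j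
  have h2 : (S.mutate q j).ker = S.ker.comap (S.mutationMap j).toAddMonoidHom := by
    ext f
    change S.Λ.compl₁₂ (S.mutationMap j) (S.mutationMap j) f = 0 ↔ S.Λ (S.mutationMap j f) = 0
    constructor
    · intro h
      refine LinearMap.ext fun g => ?_
      obtain ⟨g, rfl⟩ := h1 g
      exact LinearMap.congr_fun h g
    · intro h
      refine LinearMap.ext fun g => ?_
      rw [LinearMap.compl₁₂_apply, h]
      rfl
  rw [h2]
  exact S.ker.index_comap_of_surjective h1

variable (hq : IsPrimitiveRoot q ℓ) (hodd : Odd ℓ)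
include hq hodd

theorem index_ker_mutateList (w : List ex) : (S.mutateList q w).ker.index = S.ker.index := by
  induction w generalizing S with
  | nil => rfl
  | cons j w ih => exact (ih (hS.mutate hq hodd j)).trans (hS.index_ker_mutate j)

theorem d_eq_of_mem_mutationClass {T : QuantumSeed ℓ N ex F} (hT : T ∈ S.mutationClass q) :
    T.d = S.d := by
  obtain ⟨w, rfl⟩ := hT
  rw [d, d, hS.index_ker_mutateList hq hodd]

variable (hcop : ∀ i, Nat.Coprime ℓ (D i)) [IsAlgClosed k]
include hcop

/-- The index of the radical is a perfect square. -/
theorem d_sq : S.d ^ 2 = S.ker.index := by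
  -- The fibre over any point of the torus of the single seed `S` has blocks whose size squares to
  -- the index, so it suffices that such a point exists.
  have hΘ : {S} ⊆ S.mutationClass q := Set.singleton_subset_iff.2 self_mem_mutationClass
  have := hS.finiteType_locCU (inv := ∅) hq hodd hcop hΘ (Set.mem_singleton S)
  obtain ⟨n, hn⟩ := Ideal.exists_maximal (locCU k ∅ {S} S)
  obtain ⟨ψ, -⟩ := exists_algHom_of_isMaximal (k := k) n
  obtain ⟨-, d, -, hd, -⟩ := hS.exists_fibre hq hodd hcop hΘ (Set.mem_singleton S) ψ
  rw [QuantumSeed.d, ← hd, sq d, Nat.sqrt_eq, sq]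

variable {Θ : Set (QuantumSeed ℓ N ex F)} (hΘ : Θ ⊆ S.mutationClass q) (hST : S ∈ Θ)
include hΘ hST

/-- In the fibre all irreducible representations have dimension `d`. The embedding of `U(Θ)` into
`F`, of rank at most `d^2` over its centre, bounds every other finite dimensional one by `d`. -/
theorem fibre (ψ : locCU k inv Θ S →ₐ[k] k) :
    IsFullyAzumayaAt k (cuToU k inv Θ).toRingHom (pointIdeal ψ) ∧
    (∀ (V : Type u) [AddCommGroup V] [Module k V] [Module (interU k inv Θ) V]
      [IsScalarTower k (interU k inv Θ) V], IsSimpleModule (interU k inv Θ) V →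
      AnnihilatedBy (cuToU k inv Θ).toRingHom (pointIdeal ψ) V → Module.finrank k V = S.d) ∧
    (∃ n : ℕ, n * S.d ^ 2 = ℓ ^ N ∧
      HasExactlyIrreps (cuToU k inv Θ).toRingHom (pointIdeal ψ) n) ∧
    (∃ n : ℕ, n * S.d = ℓ ^ N ∧
      IsSemisimpleModule (interU k inv Θ)
        (interU k inv Θ ⧸ extendedIdeal (cuToU k inv Θ).toRingHom (pointIdeal ψ)) ∧
      Module.length (interU k inv Θ)
        (interU k inv Θ ⧸ extendedIdeal (cuToU k inv Θ).toRingHom (pointIdeal ψ)) = n) := by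
  obtain ⟨n, d, hd0, hd, hn, ρ, hρ, hker⟩ := hS.exists_fibre hq hodd hcop hΘ hST ψ
  have hSd : S.d = d := by rw [QuantumSeed.d, ← hd, sq d, Nat.sqrt_eq]
  have : NeZero d := ⟨hd0.ne'⟩
  obtain ⟨hfin, hle⟩ := hS.frame.finrank_center_le hq hodd
  rw [hSd]
  refine ⟨fun V _ _ _ _ hV hm => ?_, fun V _ _ _ _ hV hm =>
    (BlockModule.finrank_of_annihilatedBy hρ hker hV hm).2,
    ⟨n, hn, BlockModule.hasExactlyIrreps hρ hker⟩,
    ⟨n * d, by rw [← hn, sq, mul_assoc], BlockModule.isSemisimpleModule_quotient hρ hker,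
      BlockModule.length_quotient hρ hker⟩⟩
  obtain ⟨h1, h2⟩ := BlockModule.finrank_of_annihilatedBy hρ hker hV hm
  refine ⟨h1, fun W _ _ _ _ hW hWfin => ?_⟩
  rw [h2]
  have h3 := finrank_sq_le_of_isSimpleModule (k := k) (Z := Subring.center F) (W := W)
    (interU k inv Θ).val.toRingHom Subtype.val_injective
  rw [← hd] at hle
  exact (Nat.pow_le_pow_iff_left two_ne_zero).1 (h3.trans hle)

end IsRootOfUnityQuantumSeed

end QuantumSeed

/-! ### The cluster `𝒜`-variety -/

theorem isOpenImmersion_specMap_of_away {C L : Type u} [CommRing C] [CommRing L] (f : C →+* L)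
    (hf : Function.Injective f) (y : C) (hy : IsUnit (f y))
    (hsurj : ∀ z, ∃ n c, z * f y ^ n = f c) :
    IsOpenImmersion (Spec.map (CommRingCat.ofHom f)) := by
  let := f.toAlgebra
  have : IsLocalization.Away y L := by
    refine (isLocalization_iff _ _).2 ⟨?_, fun z => ?_, fun {a b} hab => ⟨1, by rw [hf hab]⟩⟩
    · rintro ⟨_, n, rfl⟩
      change IsUnit (f (y ^ n))
      rw [map_pow]
      exact hy.pow n
    · obtain ⟨n, c, h⟩ := hsurj z
      refine ⟨⟨c, ⟨y ^ n, n, rfl⟩⟩, ?_⟩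
      change z * f (y ^ n) = f c
      rw [map_pow, h]
  exact IsOpenImmersion.of_isLocalization y

theorem specMap_comp_eq {A B C : Type u} [CommRing A] [CommRing B] [CommRing C] {f : A →+* B}
    {g : B →+* C} {h : A →+* C} (hfg : g.comp f = h) :
    Spec.map (CommRingCat.ofHom g) ≫ Spec.map (CommRingCat.ofHom f) =
      Spec.map (CommRingCat.ofHom h) := by
  rw [← Spec.map_comp, ← CommRingCat.ofHom_comp, hfg]

theorem isOpenImmersion_specMap_and_range_of_equiv {A B C : Type u} [CommRing A] [CommRing B]
    [CommRing C] (f : A →+* B) (g : A →+* C) (e : B ≃+* C) (h : ∀ a, e (f a) = g a) :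
    (IsOpenImmersion (Spec.map (CommRingCat.ofHom f)) →
      IsOpenImmersion (Spec.map (CommRingCat.ofHom g))) ∧
    Set.range (Spec.map (CommRingCat.ofHom g)) = Set.range (Spec.map (CommRingCat.ofHom f)) := by
  have : IsIso (CommRingCat.ofHom e.toRingHom) := inferInstanceAs (IsIso e.toCommRingCatIso.hom)
  rw [← specMap_comp_eq (RingHom.ext h : e.toRingHom.comp f = g)]
  refine ⟨fun _ => inferInstance, ?_⟩
  rw [Scheme.Hom.comp_base, TopCat.coe_comp, Set.range_comp,
    Set.range_eq_univ.2 (Scheme.Hom.surjective _), Set.image_univ]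

namespace QuantumSeed

variable {ℓ N : ℕ} {ex inv : Finset (Fin N)} {F : Type u} [DivisionRing F]
variable {k : Type u} [Field k] [Algebra k F] {q : k} {S : QuantumSeed ℓ N ex F}

namespace IsRootOfUnityQuantumSeed

section LocCU

variable {D : ex → ℕ} (hS : S.IsRootOfUnityQuantumSeed q D) [NeZero ℓ] [CharZero k]
variable (hq : IsPrimitiveRoot q ℓ) (hodd : Odd ℓ) (hcop : ∀ i, Nat.Coprime ℓ (D i))
variable {Θ : Set (QuantumSeed ℓ N ex F)} (hΘ : Θ ⊆ S.mutationClass q) (hST : S ∈ Θ)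
include hS hq hodd hcop hΘ hST

/-- It suffices to invert `M(ℓ(1,…,1))`, the product of all `M(e_i)^ℓ`: a large power of it is
divisible in `CU(Θ)` by any clearing monomial `M(ℓg)`. -/
theorem isOpenImmersion_specLocCU : IsOpenImmersion (specLocCU k inv Θ S) := by
  refine isOpenImmersion_specMap_of_away _
    (Subalgebra.inclusion_injective (le_sup_left : _ ≤ locCU k inv Θ S))
    ⟨hS.frame.centralM 1, hS.centralM_mem_interCU hq hodd hcop hΘ zero_le_one⟩
    (hS.isUnit_locM hq hodd hcop hΘ 1) fun z => ?_
  obtain ⟨g, hg, hgz⟩ := hS.exists_centralM_mul_mem_interCU hq hodd hcop hΘ hST z.2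
  obtain ⟨n, hn⟩ : ∃ n : ℕ, ∀ i, g i ≤ n := by
    refine ⟨∑ i, (g i).natAbs, fun i => ?_⟩
    have h1 := Finset.single_le_sum (f := fun i => (g i).natAbs) (fun _ _ => Nat.zero_le _)
      (Finset.mem_univ i)
    have h2 : g i ≤ ((g i).natAbs : ℤ) := Int.le_natAbs
    exact h2.trans (by exact_mod_cast h1)
  have h1 : 0 ≤ n • (1 : Fin N → ℤ) - g := by
    intro i
    have := hn i
    simpa using this
  have h2 : z.1 * hS.frame.centralM 1 ^ n =
      hS.frame.centralM (n • (1 : Fin N → ℤ) - g) * (hS.frame.centralM g * z.1) := by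
    rw [← hS.frame.centralM_nsmul, ← mul_assoc, ← hS.frame.centralM_add, sub_add_cancel, mul_comm]
  refine ⟨n, ⟨_, mul_mem (hS.centralM_mem_interCU hq hodd hcop hΘ h1) hgz⟩, ?_⟩
  exact Subtype.ext h2

omit hS hq hodd hcop hΘ [NeZero ℓ] [CharZero k] in
-- Enlarging the prime above `p` to a maximal ideal keeps the contraction equal to `p`, which is
-- already maximal.
theorem mem_maxSpecUnion_of_mem_range {p : PrimeSpectrum (interCU k inv Θ)}
    (hp : p.asIdeal.IsMaximal) (h : specCUPoint k inv Θ p ∈ Set.range (specLocCU k inv Θ S)) :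
    p.asIdeal ∈ maxSpecUnion k inv Θ := by
  obtain ⟨P, hP⟩ := h
  have hP' : (PrimeSpectrum.comap (toLocCU k inv Θ S).toRingHom) P = p := hP
  obtain ⟨n, hn, hPn⟩ := Ideal.exists_le_maximal P.asIdeal P.2.ne_top
  refine ⟨S, hST, ⟨n, hn⟩, hp.eq_of_le ?_ ?_⟩
  · have := hn.isPrime
    exact (Ideal.IsPrime.comap (toLocCU k inv Θ S)).ne_top
  · rw [← hP']
    exact Ideal.comap_mono hPn

omit hS hq hodd hcop hΘ hST [NeZero ℓ] [CharZero k] in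
theorem mem_range_specLocCU (P : PrimeSpectrum (locCU k inv Θ S))
    {p : PrimeSpectrum (interCU k inv Θ)} (h : p.asIdeal = P.asIdeal.comap (toLocCU k inv Θ S)) :
    specCUPoint k inv Θ p ∈ Set.range (specLocCU k inv Θ S) :=
  ⟨P, PrimeSpectrum.ext h.symm⟩

end LocCU

/-! ### The classical upper cluster algebra and its toric charts -/

section ClusterVariety

variable {D : ex → ℕ} (hS : S.IsRootOfUnityQuantumSeed q D) [NeZero ℓ] [CharZero k]
variable (hq : IsPrimitiveRoot q ℓ) (hodd : Odd ℓ) (hcop : ∀ i, Nat.Coprime ℓ (D i))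

include hS hq hodd hcop

theorem centerHom_mutateList (w : List ex) (i : Fin N) :
    centerHom hS.frame hodd (((initialSeed k S.B).mutateList w).x i) =
      (hS.mutateList hq hodd w).frame.centralM (Pi.single i 1) :=
  Subtype.ext (hS.clusterHom_mutateList hq hodd hcop w i)

theorem centerHom_mutateList_inv (w : List ex) (i : Fin N) :
    centerHom hS.frame hodd (((initialSeed k S.B).mutateList w).x i)⁻¹ =
      (hS.mutateList hq hodd w).frame.centralM (-Pi.single i 1) := by
  refine Subtype.ext ?_
  change clusterHom hS.frame hodd _ = _
  rw [map_inv₀, hS.clusterHom_mutateList hq hodd hcop,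
    ← (hS.mutateList hq hodd w).frame.M_neg hodd, ← smul_neg]
  rfl

theorem map_mixedTorus (w : List ex) :
    (((initialSeed k S.B).mutateList w).mixedTorus k inv).map (centerHom hS.frame hodd) =
      (S.mutateList q w).centralMixedTorus k inv := by
  have hT := (hS.mutateList hq hodd w).frame
  rw [ClusterSeed.mixedTorus, AlgHom.map_adjoin, centralMixedTorus]
  congr 1
  ext z
  constructor
  · rintro ⟨_, ⟨i, rfl⟩ | ⟨i, hi, rfl⟩, rfl⟩
    · exact Or.inl ⟨i, (hT.centralM_single_iff _ i).2 (hS.centerHom_mutateList hq hodd hcop w i)⟩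
    · exact Or.inr ⟨i, hi,
        (hT.centralM_neg_single_iff hodd _ i).2 (hS.centerHom_mutateList_inv hq hodd hcop w i)⟩
  · rintro (⟨i, hz⟩ | ⟨i, hi, hz⟩)
    · rw [hT.centralM_single_iff] at hz
      exact ⟨_, Or.inl ⟨i, rfl⟩, hz ▸ hS.centerHom_mutateList hq hodd hcop w i⟩
    · rw [hT.centralM_neg_single_iff hodd] at hz
      exact ⟨_, Or.inr ⟨i, hi, rfl⟩, hz ▸ hS.centerHom_mutateList_inv hq hodd hcop w i⟩

theorem map_torus (w : List ex) :
    (((initialSeed k S.B).mutateList w).torus k).map (centerHom hS.frame hodd) =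
      locCU k inv (S.mutationClass q) (S.mutateList q w) := by
  have hw : S.mutateList q w ∈ S.mutationClass q := ⟨w, rfl⟩
  have hT := hS.mutateList hq hodd w
  rw [hT.locCU_eq_adjoin hq hodd hcop (hS.mutationClass_eq hq hodd hw).ge hw,
    ClusterSeed.torus, AlgHom.map_adjoin, Set.image_union, ← Set.range_comp, ← Set.range_comp]
  congr 3
  · exact funext fun i => hS.centerHom_mutateList hq hodd hcop w i
  · exact funext fun i => hS.centerHom_mutateList_inv hq hodd hcop w i

theorem mem_range_centerHom {z : Subalgebra.center k F}
    (hz : z ∈ interCU k inv (S.mutationClass q)) : z ∈ (centerHom hS.frame hodd).range := by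
  have h1 : z ∈ locCU k inv (S.mutationClass q) (S.mutateList q []) :=
    (le_sup_left : interCU k inv (S.mutationClass q) ≤ _) hz
  rw [← hS.map_torus hq hodd hcop] at h1
  obtain ⟨x, -, hx⟩ := h1
  exact ⟨x, hx⟩

/-- Both intersections are indexed by words of mutations, and `centerHom` matches them term by term;
no bijection between quantum and classical seeds is needed. -/
theorem centerHom_mem_interCU_iff {x : ClusterField k N} :
    centerHom hS.frame hodd x ∈ interCU k inv (S.mutationClass q) ↔
      x ∈ upperClusterAlgebra k inv S.B := by
  simp only [interCU, upperClusterAlgebra, Algebra.mem_iInf, mutationClass,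
    ClusterSeed.mutationClass, Set.forall_mem_range]
  refine forall_congr' fun w => ?_
  rw [← hS.map_mixedTorus hq hodd hcop]
  constructor
  · rintro ⟨y, hy, hyx⟩
    rwa [← centerHom_injective hS.frame hodd hyx]
  · exact fun hx => ⟨x, hx, rfl⟩

/-- The embedding of `CU` of all seeds into the field of rational functions. -/
noncomputable def toClusterField (inv : Finset (Fin N)) :
    interCU k inv (S.mutationClass q) →ₐ[k] ClusterField k N :=
  (AlgEquiv.ofInjective _ (centerHom_injective hS.frame hodd)).symm.toAlgHom.comp
    (Subalgebra.inclusion fun _ hz => hS.mem_range_centerHom hq hodd hcop hz)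

theorem centerHom_toClusterField (c : interCU k inv (S.mutationClass q)) :
    centerHom hS.frame hodd (hS.toClusterField hq hodd hcop inv c) = c := by
  have := (AlgEquiv.ofInjective _ (centerHom_injective hS.frame hodd)).apply_symm_apply
    (Subalgebra.inclusion (fun _ hz => hS.mem_range_centerHom hq hodd hcop hz) c)
  exact congrArg Subtype.val this

theorem toClusterField_injective :
    Function.Injective (hS.toClusterField hq hodd hcop inv) := by
  intro a b hab
  refine Subtype.ext ?_
  rw [← hS.centerHom_toClusterField hq hodd hcop a, hab,
    hS.centerHom_toClusterField hq hodd hcop b]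

theorem range_toClusterField :
    (hS.toClusterField hq hodd hcop inv).range = upperClusterAlgebra k inv S.B := by
  ext x
  rw [← hS.centerHom_mem_interCU_iff hq hodd hcop]
  constructor
  · rintro ⟨c, rfl⟩
    change centerHom hS.frame hodd (hS.toClusterField hq hodd hcop inv c) ∈ _
    rw [hS.centerHom_toClusterField]
    exact c.2
  · intro hx
    exact ⟨⟨_, hx⟩, centerHom_injective hS.frame hodd
      (hS.centerHom_toClusterField hq hodd hcop ⟨_, hx⟩)⟩

theorem exists_toClusterField_eq (w : List ex) (i : Fin N) :
    ∃ c : interCU k inv (S.mutationClass q),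
      ((c : Subalgebra.center k F) : F) = (S.mutateList q w).M (Pi.single i 1) ^ ℓ ∧
      hS.toClusterField hq hodd hcop inv c = ((initialSeed k S.B).mutateList w).x i := by
  have hw : S.mutateList q w ∈ S.mutationClass q := ⟨w, rfl⟩
  have hT := hS.mutateList hq hodd w
  have h1 : hT.frame.centralM (Pi.single i 1) ∈ interCU k inv (S.mutationClass q) :=
    hT.centralM_single_mem_interCU hq hodd hcop (hS.mutationClass_eq hq hodd hw).ge i
  refine ⟨⟨_, h1⟩, (hT.frame.centralM_single_iff _ i).2 rfl, centerHom_injective hS.frame hodd ?_⟩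
  rw [hS.centerHom_toClusterField, hS.centerHom_mutateList hq hodd hcop]

/-- The Laurent polynomial ring of a classical seed is the localization of `CU` at the quantum
seed. -/
noncomputable def torusEquiv (inv : Finset (Fin N)) (w : List ex) :
    ((initialSeed k S.B).mutateList w).torus k ≃ₐ[k]
      locCU k inv (S.mutationClass q) (S.mutateList q w) :=
  (Subalgebra.equivMapOfInjective _ _ (centerHom_injective hS.frame hodd)).trans
    (Subalgebra.equivOfEq _ _ (hS.map_torus hq hodd hcop w))

theorem torusEquiv_symm_coe (w : List ex) (c : interCU k inv (S.mutationClass q)) :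
    (((hS.torusEquiv hq hodd hcop inv w).symm
      (toLocCU k inv (S.mutationClass q) (S.mutateList q w) c) : _) : ClusterField k N) =
      hS.toClusterField hq hodd hcop inv c := by
  refine centerHom_injective hS.frame hodd ?_
  rw [hS.centerHom_toClusterField hq hodd hcop]
  have h1 : ∀ t, ((hS.torusEquiv hq hodd hcop inv w t : _) : Subalgebra.center k F) =
      centerHom hS.frame hodd t := fun _ => rfl
  rw [← h1, AlgEquiv.apply_symm_apply]
  rfl

/-- The homomorphism from `CU` to the Laurent polynomial ring of a classical seed. -/
noncomputable def torusHom (inv : Finset (Fin N)) (s : (initialSeed k S.B).mutationClass) :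
    interCU k inv (S.mutationClass q) →ₐ[k] s.1.torus k :=
  (hS.toClusterField hq hodd hcop inv).codRestrict _ fun c => by
    obtain ⟨_, w, rfl⟩ := s
    rw [← hS.torusEquiv_symm_coe hq hodd hcop w]
    exact Subtype.property _

theorem exists_algEquiv_torusHom (s : (initialSeed k S.B).mutationClass) (w : List ex)
    (hw : (initialSeed k S.B).mutateList w = s.1) :
    ∃ γ : locCU k inv (S.mutationClass q) (S.mutateList q w) ≃ₐ[k] s.1.torus k,
      ∀ c, γ (toLocCU k inv (S.mutationClass q) (S.mutateList q w) c) =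
        hS.torusHom hq hodd hcop inv s c := by
  obtain ⟨s, hs⟩ := s
  obtain rfl : _ = s := hw
  exact ⟨(hS.torusEquiv hq hodd hcop inv w).symm, fun c =>
    Subtype.ext (hS.torusEquiv_symm_coe hq hodd hcop w c)⟩

/-- The toric chart of a seed in the spectrum of `CU`. -/
noncomputable def torusChart (inv : Finset (Fin N)) (s : (initialSeed k S.B).mutationClass) :
    s.1.torusSpec k ⟶ specCU k inv (S.mutationClass q) :=
  Spec.map (CommRingCat.ofHom (hS.torusHom hq hodd hcop inv s).toRingHom)

theorem isOpenImmersion_torusChart (s : (initialSeed k S.B).mutationClass) :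
    IsOpenImmersion (hS.torusChart hq hodd hcop inv s) := by
  obtain ⟨w, hw⟩ := s.2
  obtain ⟨γ, hγ⟩ := hS.exists_algEquiv_torusHom hq hodd hcop (inv := inv) s w hw
  have hT : S.mutateList q w ∈ S.mutationClass q := ⟨w, rfl⟩
  exact (isOpenImmersion_specMap_and_range_of_equiv _ _ γ.toRingEquiv hγ).1
    ((hS.mutateList hq hodd w).isOpenImmersion_specLocCU (inv := inv) hq hodd hcop
      (hS.mutationClass_eq hq hodd hT).ge hT)

theorem range_torusChart (s : (initialSeed k S.B).mutationClass) (w : List ex)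
    (hw : (initialSeed k S.B).mutateList w = s.1) :
    Set.range (hS.torusChart hq hodd hcop inv s) =
      Set.range (specLocCU k inv (S.mutationClass q) (S.mutateList q w)) := by
  obtain ⟨γ, hγ⟩ := hS.exists_algEquiv_torusHom hq hodd hcop (inv := inv) s w hw
  exact (isOpenImmersion_specMap_and_range_of_equiv _ _ γ.toRingEquiv hγ).2

theorem torusChart_comp_structure (s : (initialSeed k S.B).mutationClass) :
    hS.torusChart hq hodd hcop inv s ≫ specCUStructure k inv (S.mutationClass q) =
      s.1.torusStructure k :=
  specMap_comp_eq (hS.torusHom hq hodd hcop inv s).comp_algebraMap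

theorem torusGeneric_comp_torusChart (s : (initialSeed k S.B).mutationClass) :
    s.1.torusGeneric k ≫ hS.torusChart hq hodd hcop inv s =
      specCUGeneric k inv (S.mutationClass q) (hS.toClusterField hq hodd hcop inv) :=
  specMap_comp_eq (RingHom.ext fun _ => rfl)

/-- The union of the toric charts in the spectrum of `CU`. -/
theorem exists_clusterAVariety (X : (specCU k inv (S.mutationClass q)).Opens)
    (hX : (X : Set (specCU k inv (S.mutationClass q))) =
      (⋃ T ∈ S.mutationClass q, Set.range (specLocCU k inv (S.mutationClass q) T))) :
    ∃ A : ClusterAVariety k S.B X.toScheme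
        (X.ι ≫ specCUStructure k inv (S.mutationClass q)),
      ∀ s, s.1.torusGeneric k ≫ A.chart s ≫ X.ι =
        specCUGeneric k inv (S.mutationClass q) (hS.toClusterField hq hodd hcop inv) := by
  have hchart : ∀ s : (initialSeed k S.B).mutationClass,
      ∃ c : s.1.torusSpec k ⟶ X.toScheme, IsOpenImmersion c ∧
        c ≫ X.ι ≫ specCUStructure k inv (S.mutationClass q) = s.1.torusStructure k ∧
        s.1.torusGeneric k ≫ c ≫ X.ι =
          specCUGeneric k inv (S.mutationClass q) (hS.toClusterField hq hodd hcop inv) ∧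
        ∀ w, (initialSeed k S.B).mutateList w = s.1 →
          Set.range (specLocCU k inv (S.mutationClass q) (S.mutateList q w)) ⊆
          Set.range (c ≫ X.ι) := by
    intro s
    have hc := hS.isOpenImmersion_torusChart hq hodd hcop (inv := inv) s
    have hr : Set.range (hS.torusChart hq hodd hcop inv s) ⊆ Set.range X.ι := by
      obtain ⟨w, hw⟩ := s.2
      rw [hS.range_torusChart hq hodd hcop s w hw, Scheme.Opens.range_ι, hX]
      exact Set.subset_biUnion_of_mem
        (u := fun T => Set.range (specLocCU k inv (S.mutationClass q) T)) ⟨w, rfl⟩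
    have hfac := IsOpenImmersion.lift_fac X.ι (hS.torusChart hq hodd hcop inv s) hr
    have hc' : IsOpenImmersion (IsOpenImmersion.lift X.ι (hS.torusChart hq hodd hcop inv s) hr ≫
        X.ι) := by rw [hfac]; exact hc
    refine ⟨IsOpenImmersion.lift X.ι (hS.torusChart hq hodd hcop inv s) hr,
      IsOpenImmersion.of_comp _ X.ι, ?_, ?_, fun w hw => ?_⟩
    · rw [← Category.assoc, hfac, hS.torusChart_comp_structure hq hodd hcop]
    · rw [hfac, hS.torusGeneric_comp_torusChart hq hodd hcop]
    · rw [hfac, hS.range_torusChart hq hodd hcop s w hw]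
  -- A morphism of affine schemes is separated, and the open subscheme `X` inherits this.
  have : IsSeparated (specCUStructure k inv (S.mutationClass q)) :=
    inferInstanceAs (IsSeparated (Spec.map _))
  choose c h1 h2 h3 h4 using hchart
  refine ⟨⟨c, h1, h2, fun p => ?_, fun s t => ?_, inferInstance⟩, h3⟩
  · have hp : p.1 ∈ (X : Set (specCU k inv (S.mutationClass q))) := p.2
    rw [hX, Set.mem_iUnion₂] at hp
    obtain ⟨_, ⟨w, rfl⟩, hp⟩ := hp
    obtain ⟨z, hz⟩ := h4 ⟨_, w, rfl⟩ w rfl hp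
    refine ⟨_, z, X.ι.isOpenEmbedding.injective ?_⟩
    rw [← Scheme.Hom.comp_apply]
    exact hz
  -- In the spectrum of `CU` every chart restricts to the same generic point map, and the inclusion
  -- of `X` is a monomorphism.
  · rw [← cancel_mono X.ι, Category.assoc, Category.assoc, h3, h3]

end ClusterVariety

end IsRootOfUnityQuantumSeed

end QuantumSeed

namespace QuantumSeed

namespace IsRootOfUnityQuantumSeed

variable {ℓ N : ℕ} {ex inv : Finset (Fin N)} {F : Type u} [DivisionRing F]
variable {k : Type u} [Field k] [Algebra k F] {q : k} {S : QuantumSeed ℓ N ex F}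

theorem exists_pointIdeal_eq [IsAlgClosed k] [CharZero k] [NeZero ℓ] {D : ex → ℕ}
    (hS : S.IsRootOfUnityQuantumSeed q D) (hq : IsPrimitiveRoot q ℓ) (hodd : Odd ℓ)
    (hcop : ∀ i, Nat.Coprime ℓ (D i)) {Θ : Set (QuantumSeed ℓ N ex F)}
    (hΘ : Θ ⊆ S.mutationClass q) {m : Ideal (interCU k inv Θ)} (hm : m ∈ maxSpecUnion k inv Θ) :
    ∃ T ∈ Θ, ∃ (ψ : locCU k inv Θ T →ₐ[k] k), m = pointIdeal ψ := by
  obtain ⟨T, hT, n, rfl⟩ := hm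
  have hT' := hS.of_mem_mutationClass hq hodd (hΘ hT)
  have := hT'.finiteType_locCU (inv := inv) hq hodd hcop
    (hΘ.trans (hS.mutationClass_eq hq hodd (hΘ hT)).ge) hT
  obtain ⟨ψ, hψ⟩ := exists_algHom_of_isMaximal (k := k) n.asIdeal
  exact ⟨T, hT, ψ, by rw [hψ]; rfl⟩

end IsRootOfUnityQuantumSeed

end QuantumSeed

/-! ### The main theorem -/

theorem theoremB {k : Type u} [Field k] [IsAlgClosed k] [CharZero k]
    {F : Type u} [DivisionRing F] [Algebra k F]
    {N : ℕ} {ex inv : Finset (Fin N)} (hinv : Disjoint ex inv)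
    {ℓ : ℕ} {q : k} (hq : IsPrimitiveRoot q ℓ)
    (D : ex → ℕ) (S₀ : QuantumSeed ℓ N ex F) (hS₀ : S₀.IsRootOfUnityQuantumSeed q D)
    (hodd : Odd ℓ) (hcop : ∀ i, Nat.Coprime ℓ (D i)) :
    -- `d` is the square root of the index of the radical, for every seed
    (∀ S ∈ S₀.mutationClass q, S.d = S₀.d ∧ S.d ^ 2 = S.ker.index) ∧
    -- an arbitrary connected set of vertices of the exchange graph
    (∀ Θ : Set (QuantumSeed ℓ N ex F), Θ ⊆ S₀.mutationClass q →
      ((QuantumSeed.exchangeGraph ℓ ex F q).induce Θ).Connected →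
      (∀ S ∈ Θ, Function.Injective fun n : MaximalSpectrum (locCU k inv Θ S) =>
        n.asIdeal.comap (toLocCU k inv Θ S)) ∧
      ∀ m ∈ maxSpecUnion k inv Θ,
        m.IsMaximal ∧
        IsFullyAzumayaAt k (cuToU k inv Θ).toRingHom m ∧
        (∀ (V : Type u) [AddCommGroup V] [Module k V] [Module (interU k inv Θ) V]
          [IsScalarTower k (interU k inv Θ) V], IsSimpleModule (interU k inv Θ) V →
          AnnihilatedBy (cuToU k inv Θ).toRingHom m V → Module.finrank k V = S₀.d) ∧
        (∃ n : ℕ, n * S₀.d ^ 2 = ℓ ^ N ∧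
          HasExactlyIrreps (cuToU k inv Θ).toRingHom m n) ∧
        (∃ n : ℕ, n * S₀.d = ℓ ^ N ∧
          IsSemisimpleModule (interU k inv Θ)
            (interU k inv Θ ⧸ extendedIdeal (cuToU k inv Θ).toRingHom m) ∧
          Module.length (interU k inv Θ)
            (interU k inv Θ ⧸ extendedIdeal (cuToU k inv Θ).toRingHom m) = n)) ∧
    -- the set of all seeds: the union is a copy of the cluster 𝒜-variety
    ∃ X : (specCU k inv (S₀.mutationClass q)).Opens,
      (X : Set (specCU k inv (S₀.mutationClass q))) =
        (⋃ S ∈ S₀.mutationClass q, Set.range (specLocCU k inv (S₀.mutationClass q) S)) ∧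
      (∀ p : PrimeSpectrum (interCU k inv (S₀.mutationClass q)),
        p.asIdeal ∈ maxSpecUnion k inv (S₀.mutationClass q) ↔
          p.asIdeal.IsMaximal ∧ specCUPoint k inv (S₀.mutationClass q) p ∈ X) ∧
      ∃ φ : interCU k inv (S₀.mutationClass q) →ₐ[k] ClusterField k N,
        Function.Injective φ ∧
        φ.range = upperClusterAlgebra k inv S₀.B ∧
        (∀ (w : List ex) (i : Fin N), ∃ c : interCU k inv (S₀.mutationClass q),
          ((c : Subalgebra.center k F) : F) = (S₀.mutateList q w).M (Pi.single i 1) ^ ℓ ∧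
          φ c = ((initialSeed k S₀.B).mutateList w).x i) ∧
        ∃ A : ClusterAVariety k S₀.B X.toScheme
            (X.ι ≫ specCUStructure k inv (S₀.mutationClass q)),
          ∀ s, s.1.torusGeneric k ≫ A.chart s ≫ X.ι =
            specCUGeneric k inv (S₀.mutationClass q) φ := by
  have : NeZero ℓ := ⟨hodd.pos.ne'⟩
  refine ⟨fun S hS => ⟨hS₀.d_eq_of_mem_mutationClass hq hodd hS,
    (hS₀.of_mem_mutationClass hq hodd hS).d_sq hq hodd hcop⟩, fun Θ hΘ _ =>
    ⟨fun S hS => (hS₀.of_mem_mutationClass hq hodd (hΘ hS)).injective_comap_toLocCU hq hodd hcop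
      (hΘ.trans (hS₀.mutationClass_eq hq hodd (hΘ hS)).ge) hS, fun m hm => ?_⟩, ?_⟩
  · obtain ⟨S, hS, ψ, rfl⟩ := hS₀.exists_pointIdeal_eq hq hodd hcop hΘ hm
    rw [← hS₀.d_eq_of_mem_mutationClass hq hodd (hΘ hS)]
    exact ⟨QuantumSeed.IsRootOfUnityQuantumSeed.isMaximal_pointIdeal ψ,
      (hS₀.of_mem_mutationClass hq hodd (hΘ hS)).fibre hq hodd hcop
        (hΘ.trans (hS₀.mutationClass_eq hq hodd (hΘ hS)).ge) hS ψ⟩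
  · have hopen (S) (hS : S ∈ S₀.mutationClass q) :
        IsOpenImmersion (specLocCU k inv (S₀.mutationClass q) S) :=
      (hS₀.of_mem_mutationClass hq hodd hS).isOpenImmersion_specLocCU hq hodd hcop
        (hS₀.mutationClass_eq hq hodd hS).ge hS
    refine ⟨⟨⋃ S ∈ S₀.mutationClass q, Set.range (specLocCU k inv (S₀.mutationClass q) S),
      isOpen_biUnion fun S hS => (hopen S hS).base_open.isOpen_range⟩, rfl, fun p =>
      ⟨fun hp => ⟨?_, ?_⟩, fun ⟨hp, hpX⟩ => ?_⟩,
      hS₀.toClusterField hq hodd hcop inv, hS₀.toClusterField_injective hq hodd hcop,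
      hS₀.range_toClusterField hq hodd hcop, hS₀.exists_toClusterField_eq hq hodd hcop,
      hS₀.exists_clusterAVariety hq hodd hcop _ rfl⟩
    · obtain ⟨S, hS, ψ, h⟩ := hS₀.exists_pointIdeal_eq hq hodd hcop subset_rfl hp
      rw [h]
      exact QuantumSeed.IsRootOfUnityQuantumSeed.isMaximal_pointIdeal ψ
    · obtain ⟨S, hS, n, hn⟩ := hp
      exact Set.mem_biUnion hS (QuantumSeed.IsRootOfUnityQuantumSeed.mem_range_specLocCU
        ⟨n.asIdeal, n.isMaximal.isPrime⟩ hn)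
    · obtain ⟨S, hS, h⟩ := Set.mem_iUnion₂.1 hpX
      exact QuantumSeed.IsRootOfUnityQuantumSeed.mem_maxSpecUnion_of_mem_range hS hp h
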